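/- Let $G=(A,B;E)$ be a finite simple bipartite graph in which every vertex $v$ has a strict linear order $\prec_v$ (its preferences) over its neighbours. A matching is a set of pairwise non-adjacent edges. An edge $(a,b)\in E$ blocks a matching $M$ if $a$ is unmatched in $M$ or prefers $b$ to $M(a)$, and $b$ is unmatched in $M$ or prefers $a$ to $M(b)$; $\mathrm{bp}(M)$ is the set of blocking edges of $M$. A vertex prefers $M$ over $M'$ if it is matched in $M$, and it is unmatched in $M'$ or prefers its partner in $M$ to its partner in $M'$. A matching $M$ is popular if there is no matching $M'$ such that more vertices prefer $M'$ over $M$ than prefer $M$ over $M'$. An instance $(G,\prec,\omega,c,t,k)$ of Max-Utility Popular Matching with Instability Costs consists of such a bipartite graph with preferences, functions $\omega,c:E\to\mathbb N$ and numbers $t,k\in\mathbb N$; the question is whether there is a popular matching $M$ with $\sum_{e\in M}\omega(e)\ge t$ and $\sum_{e\in\mathrm{bp}(M)}c(e)\le k$. The instance admits a master list on one side if there is a linear ordering of all vertices of $A$ whose restriction to the neighbourhood of $b$ is the preference order of $b$, for every $b\in B$, or the same holds with $A$ and $B$ exchanged. **Theorem.** Max-Utility Popular Matching with Instability Costs can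 be solved in $O(|E|^{k+1})$ time on bipartite instances that admit a master list on one side and satisfy $c(e)\ge 1$ for all $e\in E$. Precisely: there are a single program for a random access machine with unit-cost addition, subtraction, comparison and memory access, and constants $C,D$, such that for every such instance (given in memory by its preference lists, with the positions of each edge on the lists of its endpoints, and by $\omega,c,t,k$) the program halts after at most $C\,(|E|^{k+1}+1)$ steps with the correct yes/no answer, and every number that it stores is smaller than $N^{D}$, where $N=|A|+|B|+|E|+t+k+\sum_{e\in E}\omega(e)+\sum_{e\in E}c(e)+2$. (The additional $1$ in the time bound matters only if $E=\emptyset$.) -/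

import Mathlib

/-! ### A random access machine with unit cost

Programs use finitely many registers and finitely many zero-initialised arrays (all indexed by
natural numbers). The only arithmetic is addition, truncated subtraction and comparison. Every
stored value has to be smaller than the bound `W` of the machine words, otherwise the run fails. -/

namespace RAM

/-- The contents of the registers `var x` and of the array cells `arr a i`. -/
structure State where
  var : ℕ → ℕ
  arr : ℕ → ℕ → ℕ

/-- Expressions; an expression is true when its value is not `0`. -/
inductive Expr where
  | const (c : ℕ)
  | var (x : ℕ)
  | get (a : ℕ) (i : Expr)
  | add (e f : Expr)
  | sub (e f : Expr)
  | lt (e f : Expr)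
  | eq (e f : Expr)

def Expr.eval (s : State) : Expr → ℕ
  | .const c => c
  | .var x => s.var x
  | .get a i => s.arr a (i.eval s)
  | .add e f => e.eval s + f.eval s
  | .sub e f => e.eval s - f.eval s
  | .lt e f => if e.eval s < f.eval s then 1 else 0
  | .eq e f => if e.eval s = f.eval s then 1 else 0

/-- The number of elementary operations in the evaluation of an expression. -/
def Expr.cost : Expr → ℕ
  | .const _ => 1
  | .var _ => 1
  | .get _ i => i.cost + 1
  | .add e f => e.cost + f.cost + 1
  | .sub e f => e.cost + f.cost + 1
  | .lt e f => e.cost + f.cost + 1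
  | .eq e f => e.cost + f.cost + 1

/-- Structured programs: `assign x e` is `x := e`, `put a i e` is `a[i] := e`. -/
inductive Cmd where
  | nop
  | assign (x : ℕ) (e : Expr)
  | put (a : ℕ) (i e : Expr)
  | seq (p q : Cmd)
  | cond (e : Expr) (p q : Cmd)
  | loop (e : Expr) (p : Cmd)

def State.setVar (s : State) (x v : ℕ) : State :=
  { s with var := Function.update s.var x v }

def State.setArr (s : State) (a i v : ℕ) : State :=
  { s with arr := Function.update s.arr a (Function.update (s.arr a) i v) }

/-- `Exec W p s s' T`: with words bounded by `W`, the program `p` started in state `s` halts in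
state `s'` after `T` steps. -/
inductive Exec (W : ℕ) : Cmd → State → State → ℕ → Prop where
  | nop (s : State) : Exec W .nop s s 1
  | assign (s : State) (x : ℕ) (e : Expr) (he : e.eval s < W) :
      Exec W (.assign x e) s (s.setVar x (e.eval s)) (e.cost + 1)
  | put (s : State) (a : ℕ) (i e : Expr) (hi : i.eval s < W) (he : e.eval s < W) :
      Exec W (.put a i e) s (s.setArr a (i.eval s) (e.eval s)) (i.cost + e.cost + 1)
  | seq {p q : Cmd} {s s₁ s₂ : State} {T₁ T₂ : ℕ}
      (hp : Exec W p s s₁ T₁) (hq : Exec W q s₁ s₂ T₂) :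
      Exec W (.seq p q) s s₂ (T₁ + T₂)
  | condTrue {e : Expr} {p q : Cmd} {s s' : State} {T : ℕ}
      (he : e.eval s ≠ 0) (hp : Exec W p s s' T) :
      Exec W (.cond e p q) s s' (e.cost + 1 + T)
  | condFalse {e : Expr} {p q : Cmd} {s s' : State} {T : ℕ}
      (he : e.eval s = 0) (hq : Exec W q s s' T) :
      Exec W (.cond e p q) s s' (e.cost + 1 + T)
  | loopTrue {e : Expr} {p : Cmd} {s s₁ s₂ : State} {T₁ T₂ : ℕ}
      (he : e.eval s ≠ 0) (hp : Exec W p s s₁ T₁) (hq : Exec W (.loop e p) s₁ s₂ T₂) :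
      Exec W (.loop e p) s s₂ (e.cost + 1 + T₁ + T₂)
  | loopFalse {e : Expr} {p : Cmd} {s : State} (he : e.eval s = 0) :
      Exec W (.loop e p) s s (e.cost + 1)

end RAM

/-! ### The problem -/

/-- An instance `(G, ≺, ω, c, t, k)` of Max-Utility Popular Matching with Instability Costs on a
bipartite graph `G = (A, B; E)` with `A = Fin nA` and `B = Fin nB`. The strict linear order of a
vertex over its neighbours is given by its preference list, with the best neighbour first. Only the
values of `util` and `cost` on edges are ever used. -/
structure MUPM where
  nA : ℕ
  nB : ℕ
  prefA : Fin nA → List (Fin nB)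
  prefB : Fin nB → List (Fin nA)
  nodupA : ∀ a, (prefA a).Nodup
  nodupB : ∀ b, (prefB b).Nodup
  mem_iff : ∀ a b, b ∈ prefA a ↔ a ∈ prefB b
  util : Fin nA × Fin nB → ℕ
  cost : Fin nA × Fin nB → ℕ
  t : ℕ
  k : ℕ

namespace MUPM

variable (I : MUPM)

/-- The edge set `E`. -/
def edges : Finset (Fin I.nA × Fin I.nB) :=
  Finset.univ.filter fun e => e.2 ∈ I.prefA e.1

/-- `I.ltA a b b'`: the vertex `a` prefers its neighbour `b'` to its neighbour `b`. -/
def ltA (a : Fin I.nA) (b b' : Fin I.nB) : Prop :=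
  (I.prefA a).idxOf b' < (I.prefA a).idxOf b

/-- `I.ltB b a a'`: the vertex `b` prefers its neighbour `a'` to its neighbour `a`. -/
def ltB (b : Fin I.nB) (a a' : Fin I.nA) : Prop :=
  (I.prefB b).idxOf a' < (I.prefB b).idxOf a

/-- A matching: a set of edges, no two of which share an endpoint. -/
def IsMatching (M : Finset (Fin I.nA × Fin I.nB)) : Prop :=
  M ⊆ I.edges ∧ ∀ e ∈ M, ∀ f ∈ M, e ≠ f → e.1 ≠ f.1 ∧ e.2 ≠ f.2

/-- The edge `e = (a, b)` blocks `M`: `a` is unmatched or prefers `b` to `M(a)`, and `b` is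
unmatched or prefers `a` to `M(b)`. -/
def Blocks (M : Finset (Fin I.nA × Fin I.nB)) (e : Fin I.nA × Fin I.nB) : Prop :=
  (∀ b, (e.1, b) ∈ M → I.ltA e.1 b e.2) ∧ (∀ a, (a, e.2) ∈ M → I.ltB e.2 a e.1)

open Classical in
/-- The set `bp(M)` of the blocking edges of `M`. -/
noncomputable def bp (M : Finset (Fin I.nA × Fin I.nB)) : Finset (Fin I.nA × Fin I.nB) :=
  I.edges.filter (I.Blocks M)

/-- The vertex `a` prefers `M` over `M'`: it is matched in `M`, and it is unmatched in `M'` or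
prefers `M(a)` to `M'(a)`. -/
def PrefersA (M M' : Finset (Fin I.nA × Fin I.nB)) (a : Fin I.nA) : Prop :=
  ∃ b, (a, b) ∈ M ∧ ∀ b', (a, b') ∈ M' → I.ltA a b' b

/-- The vertex `b` prefers `M` over `M'`. -/
def PrefersB (M M' : Finset (Fin I.nA × Fin I.nB)) (b : Fin I.nB) : Prop :=
  ∃ a, (a, b) ∈ M ∧ ∀ a', (a', b) ∈ M' → I.ltB b a' a

open Classical in
/-- The number of vertices that prefer `M` over `M'`. -/
noncomputable def votes (M M' : Finset (Fin I.nA × Fin I.nB)) : ℕ :=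
  (Finset.univ.filter (I.PrefersA M M')).card + (Finset.univ.filter (I.PrefersB M M')).card

/-- A popular matching: no matching is more popular. -/
def IsPopular (M : Finset (Fin I.nA × Fin I.nB)) : Prop :=
  I.IsMatching M ∧ ∀ M', I.IsMatching M' → ¬ I.votes M M' < I.votes M' M

/-- The answer to the instance is yes: some popular matching has utility at least `t` and blocking
edges of total cost at most `k`. -/
def IsYes : Prop :=
  ∃ M, I.IsPopular M ∧ I.t ≤ ∑ e ∈ M, I.util e ∧ ∑ e ∈ I.bp M, I.cost e ≤ I.k

/-- `L` is a master list over the vertices of `A`, with the best vertex first. -/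
def IsMasterListA (L : List (Fin I.nA)) : Prop :=
  L.Nodup ∧ (∀ a, a ∈ L) ∧ ∀ b, L.filter (fun a => a ∈ I.prefB b) = I.prefB b

/-- `L` is a master list over the vertices of `B`, with the best vertex first. -/
def IsMasterListB (L : List (Fin I.nB)) : Prop :=
  L.Nodup ∧ (∀ b, b ∈ L) ∧ ∀ a, L.filter (fun b => b ∈ I.prefA a) = I.prefA a

def AdmitsMasterListOnOneSide : Prop :=
  (∃ L, I.IsMasterListA L) ∨ (∃ L, I.IsMasterListB L)

/-! ### The instance in the memory of the machine -/

/-- The edges in the order of their numbers `0, …, |E| - 1`: the preference lists of the vertices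
of `A`, one after the other. -/
def edgeList : List (Fin I.nA × Fin I.nB) :=
  (List.finRange I.nA).flatMap fun a => (I.prefA a).map fun b => (a, b)

/-- The preference lists of the vertices of `B`, one after the other. -/
def edgeListB : List (Fin I.nA × Fin I.nB) :=
  (List.finRange I.nB).flatMap fun b => (I.prefB b).map fun a => (a, b)

/-- An array that starts with the entries of `l`; all further cells are `0`. -/
def toArr (l : List ℕ) : ℕ → ℕ := fun i => l.getD i 0

def initVar : ℕ → ℕ
  | 1 => I.nA
  | 2 => I.nB
  | 3 => I.edges.card
  | 4 => I.t
  | 5 => I.k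
  | _ => 0

/-- For every edge: its endpoints in `A` and `B`, its positions on the preference lists of these
endpoints, its utility and its cost (arrays 0 to 5). For every vertex: the place where its
preference list starts and its degree (6 and 7 for `A`, 8 and 9 for `B`). The list of a vertex `a`
of `A` consists of the edges with the numbers from its start on, since edges are numbered in
this order; the lists of `B` are stored one after the other, as edge numbers, in array 10. -/
def initArr : ℕ → ℕ → ℕ
  | 0 => toArr (I.edgeList.map fun e => (e.1 : ℕ))
  | 1 => toArr (I.edgeList.map fun e => (e.2 : ℕ))
  | 2 => toArr (I.edgeList.map fun e => (I.prefA e.1).idxOf e.2)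
  | 3 => toArr (I.edgeList.map fun e => (I.prefB e.2).idxOf e.1)
  | 4 => toArr (I.edgeList.map I.util)
  | 5 => toArr (I.edgeList.map I.cost)
  | 6 => toArr ((List.finRange I.nA).map fun a => ∑ a' ∈ Finset.Iio a, (I.prefA a').length)
  | 7 => toArr ((List.finRange I.nA).map fun a => (I.prefA a).length)
  | 8 => toArr ((List.finRange I.nB).map fun b => ∑ b' ∈ Finset.Iio b, (I.prefB b').length)
  | 9 => toArr ((List.finRange I.nB).map fun b => (I.prefB b).length)
  | 10 => toArr (I.edgeListB.map fun e => I.edgeList.idxOf e)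
  | _ => fun _ => 0

/-- The initial state of a machine that is given the instance `I`. -/
def initState : RAM.State where
  var := I.initVar
  arr := I.initArr

/-- The magnitude of an instance; words of `D * log (magnitude)` bits hold numbers
below `magnitude ^ D`. -/
def magnitude : ℕ :=
  I.nA + I.nB + I.edges.card + I.t + I.k + ∑ e ∈ I.edges, I.util e + ∑ e ∈ I.edges, I.cost e + 2

end MUPM

/-!
The program rests on two facts about popular matchings.

* A matching `M` is a stable matching of `G - bp(M)` (`IsMatching.isStableWithout_bp`), and under a
  master list on one side `G - S` has only one stable matching, for every set `S` of edges
  (`IsStableWithout.unique`, by induction along the master list). Hence a solution is determined by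
  its set of blocking edges. Since every edge has cost at least `1`, this set has at most `min k |E|`
  elements, and the program tries the empty set and all sequences of `min k |E|` edges, about
  `|E| ^ k` sets in all.

* For a given set `S` linear time suffices. Deferred acceptance finds the stable matching `M` of
  `G - S`. Utility and cost are sums over the edges. For popularity, let the votes of the endpoints
  of an edge on this edge against `M` be `1`, `0` or `-1`. A popular matching has a witness:
  values in `{-1, 0, 1}` of the vertices whose sums bound the vote sum of every edge from above,
  vanish on the edges of `M`, and which are `0` on unmatched vertices; conversely, a witness
  certifies popularity (`IsWitness.isPopular`, `IsPopular.exists_isWitness`). A witness is made of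
  weights of heaviest paths in a digraph of exchanges, in which popularity excludes cycles of
  positive weight (`exists_potential`). The endpoints of blocking edges have value `1` in every
  witness, and then so does every vertex that is joined, by an edge that not both endpoints vote
  against, to the partner of a vertex of value `1`. The vertices of one side that are forced in this
  way are found by a breadth-first search that scans the list of each partner once. A witness exists
  if and only if all forced vertices are matched and no two of them are matched to each other
  (`passes_of_isPopular`, `isPopular_of_passes`).

All words stay below the magnitude `N` itself, because sums of utilities and costs do.
-/

/-! ### Reasoning about programs -/

namespace RAM

@[simp] theorem State.setVar_var (s : State) (x v y : ℕ) :
    (s.setVar x v).var y = if y = x then v else s.var y := by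
  simp [State.setVar, Function.update_apply]

@[simp] theorem State.setVar_arr (s : State) (x v : ℕ) : (s.setVar x v).arr = s.arr := rfl

@[simp] theorem State.setArr_var (s : State) (a i v : ℕ) : (s.setArr a i v).var = s.var := rfl

@[simp] theorem State.setArr_arr (s : State) (a i v b : ℕ) :
    (s.setArr a i v).arr b = if b = a then Function.update (s.arr a) i v else s.arr b := by
  by_cases h : b = a
  · subst h; simp [State.setArr]
  · simp [State.setArr, h]

/-- With words bounded by `W`, the program `p` started in `s` halts after at most `B` steps in a
state that satisfies `Q`. -/
def Run (W : ℕ) (p : Cmd) (s : State) (B : ℕ) (Q : State → Prop) : Prop :=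
  ∃ s' T, Exec W p s s' T ∧ T ≤ B ∧ Q s'

/-- The weakest precondition of a program without loops. -/
def wp (W : ℕ) : Cmd → (State → Prop) → State → Prop
  | .nop, Q, s => Q s
  | .assign x e, Q, s => e.eval s < W ∧ Q (s.setVar x (e.eval s))
  | .put a i e, Q, s => i.eval s < W ∧ e.eval s < W ∧ Q (s.setArr a (i.eval s) (e.eval s))
  | .seq p q, Q, s => wp W p (wp W q Q) s
  | .cond e p q, Q, s => (e.eval s ≠ 0 → wp W p Q s) ∧ (e.eval s = 0 → wp W q Q s)
  | .loop _ _, _, _ => False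

/-- A bound on the running time of a program without loops. -/
def Cmd.time : Cmd → ℕ
  | .nop => 1
  | .assign _ e => e.cost + 1
  | .put _ i e => i.cost + e.cost + 1
  | .seq p q => p.time + q.time
  | .cond e p q => e.cost + 1 + (p.time + q.time)
  | .loop _ _ => 0

theorem Run.of_wp {W : ℕ} {p : Cmd} {Q : State → Prop} {s : State} (h : wp W p Q s) :
    Run W p s p.time Q := by
  induction p generalizing Q s with
  | nop => exact ⟨s, 1, .nop s, le_rfl, h⟩
  | assign x e => exact ⟨_, _, .assign s x e h.1, le_rfl, h.2⟩
  | put a i e => exact ⟨_, _, .put s a i e h.1 h.2.1, le_rfl, h.2.2⟩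
  | seq p q ihp ihq =>
    obtain ⟨s₁, T₁, h₁, hT₁, hQ₁⟩ := ihp h
    obtain ⟨s₂, T₂, h₂, hT₂, hQ₂⟩ := ihq hQ₁
    exact ⟨s₂, _, .seq h₁ h₂, Nat.add_le_add hT₁ hT₂, hQ₂⟩
  | cond e p q ihp ihq =>
    by_cases he : e.eval s = 0
    · obtain ⟨s₂, T₂, h₂, hT₂, hQ₂⟩ := ihq (h.2 he)
      exact ⟨s₂, _, .condFalse he h₂, by simp only [Cmd.time]; omega, hQ₂⟩
    · obtain ⟨s₂, T₂, h₂, hT₂, hQ₂⟩ := ihp (h.1 he)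
      exact ⟨s₂, _, .condTrue he h₂, by simp only [Cmd.time]; omega, hQ₂⟩
  | loop e p => exact h.elim

theorem Run.mono {W : ℕ} {p : Cmd} {Q Q' : State → Prop} {s : State} {B B' : ℕ}
    (h : Run W p s B Q) (hB : B ≤ B') (hQ : ∀ s', Q s' → Q' s') : Run W p s B' Q' := by
  obtain ⟨s', T, h₁, h₂, h₃⟩ := h
  exact ⟨s', T, h₁, h₂.trans hB, hQ _ h₃⟩

theorem Run.seq {W : ℕ} {p q : Cmd} {Q Q' : State → Prop} {s : State} {B B' : ℕ}
    (h : Run W p s B Q) (h' : ∀ s', Q s' → Run W q s' B' Q') : Run W (.seq p q) s (B + B') Q' := by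
  obtain ⟨s₁, T₁, h₁, hT₁, hQ₁⟩ := h
  obtain ⟨s₂, T₂, h₂, hT₂, hQ₂⟩ := h' _ hQ₁
  exact ⟨s₂, _, .seq h₁ h₂, Nat.add_le_add hT₁ hT₂, hQ₂⟩

/-- The registers that a program may change. -/
def Cmd.vars : Cmd → List ℕ
  | .nop => []
  | .assign x _ => [x]
  | .put _ _ _ => []
  | .seq p q => p.vars ++ q.vars
  | .cond _ p q => p.vars ++ q.vars
  | .loop _ p => p.vars

/-- The arrays that a program may change. -/
def Cmd.arrs : Cmd → List ℕ
  | .nop => []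
  | .assign _ _ => []
  | .put a _ _ => [a]
  | .seq p q => p.arrs ++ q.arrs
  | .cond _ p q => p.arrs ++ q.arrs
  | .loop _ p => p.arrs

/-- `s'` differs from `s` at most in what the program `p` may change. -/
def Frame (p : Cmd) (s s' : State) : Prop :=
  (∀ x, x ∉ p.vars → s'.var x = s.var x) ∧ ∀ a, a ∉ p.arrs → s'.arr a = s.arr a

theorem Frame.refl (p : Cmd) (s : State) : Frame p s s := ⟨fun _ _ => rfl, fun _ _ => rfl⟩

theorem Frame.trans {p : Cmd} {s s₁ s₂ : State} (h : Frame p s s₁) (h' : Frame p s₁ s₂) :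
    Frame p s s₂ :=
  ⟨fun x hx => (h'.1 x hx).trans (h.1 x hx), fun a ha => (h'.2 a ha).trans (h.2 a ha)⟩

theorem Frame.of_exec {W : ℕ} {p : Cmd} {s s' : State} {T : ℕ} (h : Exec W p s s' T) :
    Frame p s s' := by
  induction h with
  | nop s => exact .refl _ _
  | assign s x e he =>
    refine ⟨fun y hy => ?_, fun _ _ => rfl⟩
    rw [Cmd.vars, List.mem_singleton] at hy
    simp [hy]
  | put s a i e hi he =>
    refine ⟨fun _ _ => rfl, fun b hb => ?_⟩
    rw [Cmd.arrs, List.mem_singleton] at hb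
    simp [hb]
  | seq _ _ ihp ihq =>
    refine ⟨fun x hx => ?_, fun a ha => ?_⟩
    · simp only [Cmd.vars, List.mem_append, not_or] at hx
      exact (ihq.1 x hx.2).trans (ihp.1 x hx.1)
    · simp only [Cmd.arrs, List.mem_append, not_or] at ha
      exact (ihq.2 a ha.2).trans (ihp.2 a ha.1)
  | condTrue _ _ ih =>
    refine ⟨fun x hx => ?_, fun a ha => ?_⟩
    · simp only [Cmd.vars, List.mem_append, not_or] at hx
      exact ih.1 x hx.1
    · simp only [Cmd.arrs, List.mem_append, not_or] at ha
      exact ih.2 a ha.1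
  | condFalse _ _ ih =>
    refine ⟨fun x hx => ?_, fun a ha => ?_⟩
    · simp only [Cmd.vars, List.mem_append, not_or] at hx
      exact ih.1 x hx.2
    · simp only [Cmd.arrs, List.mem_append, not_or] at ha
      exact ih.2 a ha.2
  | loopTrue _ _ _ ihp ihq => exact Frame.trans (p := .loop _ _) ihp ihq
  | loopFalse _ => exact .refl _ _

theorem Run.frame {W : ℕ} {p : Cmd} {Q : State → Prop} {s : State} {B : ℕ}
    (h : Run W p s B Q) : Run W p s B fun s' => Q s' ∧ Frame p s s' := by
  obtain ⟨s', T, h₁, h₂, h₃⟩ := h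
  exact ⟨s', T, h₁, h₂, h₃, .of_exec h₁⟩

/-- The rule for loops: `Inv n` is the invariant when at most `n` rounds are left. -/
theorem Run.loop {W : ℕ} {e : Expr} {p : Cmd} {B : ℕ} {s₀ : State} (Inv : ℕ → State → Prop)
    (hstep : ∀ n s, Frame p s₀ s → Inv n s → e.eval s ≠ 0 →
      Run W p s B fun s' => ∃ n' < n, Inv n' s')
    (n : ℕ) (h : Inv n s₀) :
    Run W (.loop e p) s₀ (n * (e.cost + 1 + B) + (e.cost + 1))
      fun s' => (∃ n', Inv n' s') ∧ e.eval s' = 0 := by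
  suffices H : ∀ n s, Frame p s₀ s → Inv n s →
      Run W (.loop e p) s (n * (e.cost + 1 + B) + (e.cost + 1))
        fun s' => (∃ n', Inv n' s') ∧ e.eval s' = 0 from H n s₀ (.refl _ _) h
  intro n
  induction n using Nat.strong_induction_on with
  | _ n ih =>
    intro s hf hs
    by_cases he : e.eval s = 0
    · exact ⟨s, _, .loopFalse he, Nat.le_add_left _ _, ⟨n, hs⟩, he⟩
    · obtain ⟨s₁, T₁, h₁, hT₁, n', hn', hs₁⟩ := hstep n s hf hs he
      obtain ⟨s₂, T₂, h₂, hT₂, hQ⟩ := ih n' hn' s₁ (hf.trans (.of_exec h₁)) hs₁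
      refine ⟨s₂, _, .loopTrue he h₁ h₂, ?_, hQ⟩
      have : (n' + 1) * (e.cost + 1 + B) ≤ n * (e.cost + 1 + B) := Nat.mul_le_mul_right _ hn'
      rw [Nat.add_mul] at this
      omega

/-- `for i := 0, …, m - 1 do p`, with `i` in register 8 and `m` in register 3. -/
def Cmd.forEdges (p : Cmd) : Cmd :=
  .seq (.assign 8 (.const 0)) (.loop (.lt (.var 8) (.var 3))
    (.seq p (.assign 8 (.add (.var 8) (.const 1)))))

theorem Run.forEdges {W : ℕ} {p : Cmd} {s : State} {m B : ℕ} (Inv : ℕ → State → Prop)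
    (hm : s.var 3 = m) (hmW : m < W) (h3 : 3 ∉ p.vars) (h8 : 8 ∉ p.vars)
    (h0 : Inv 0 (s.setVar 8 0))
    (hstep : ∀ i < m, ∀ s', Frame p.forEdges s s' → s'.var 8 = i → Inv i s' →
      Run W p s' B fun s'' => Inv (i + 1) (s''.setVar 8 (i + 1))) :
    Run W p.forEdges s (2 + (m * (8 + B) + 4)) fun s' => Inv m s' := by
  let Inv' : ℕ → State → Prop := fun n s' =>
    s'.var 3 = m ∧ s'.var 8 + n = m ∧ Inv (s'.var 8) s'
  have hW : 0 < W := by omega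
  refine Run.seq (Run.of_wp (p := .assign 8 (.const 0)) (Q := fun s' => s' = s.setVar 8 0)
    ⟨hW, rfl⟩) ?_
  rintro _ rfl
  refine Run.mono (Run.loop (B := B + 4) Inv' ?_ m
    ⟨by simpa using hm, by simp, by simpa using h0⟩) ?_ ?_
  · rintro n s' hf ⟨h3', hn, hs'⟩ he
    have hlt : s'.var 8 < m := by
      by_contra hc
      exact he (by simp [Expr.eval, h3', hc])
    have hf' : Frame p.forEdges s s' := by
      refine ⟨fun x hx => ?_, fun a ha => ?_⟩
      · simp only [Cmd.forEdges, Cmd.vars, List.cons_append, List.nil_append, List.mem_cons,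
          List.mem_append] at hx
        rw [hf.1 x (by simp only [Cmd.vars, List.mem_append, List.mem_singleton]; tauto)]
        simp only [State.setVar_var]
        rw [if_neg (by tauto)]
      · simp only [Cmd.forEdges, Cmd.arrs, List.nil_append] at ha
        rw [hf.2 a ha]
        rfl
    refine Run.seq (hstep _ hlt s' hf' rfl hs').frame ?_
    rintro s'' ⟨h1, h2⟩
    have h8'' : s''.var 8 = s'.var 8 := h2.1 8 h8
    refine Run.of_wp (p := .assign 8 (.add (.var 8) (.const 1))) ⟨?_, ?_⟩
    · simp only [Expr.eval, h8'']; omega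
    · simp only [Expr.eval, h8'']
      exact ⟨n - 1, by omega, by simpa using (h2.1 3 h3).trans h3', by simp; omega,
        by simpa using h1⟩
  · have : Expr.cost (.lt (.var 8) (.var 3)) = 3 := rfl
    rw [this, show 3 + 1 + (B + 4) = 8 + B by ring]
  · rintro s' ⟨⟨n, h3', hn, hs'⟩, he⟩
    have : s'.var 8 = m := by
      by_contra hc
      have : s'.var 8 < m := by omega
      simp [Expr.eval, h3', this] at he
    rwa [this] at hs'

end RAM

/-! ### Potentials -/

section Potential

variable {X : Type*}

/-- The weight of the walk with the list of vertices `l`. -/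
def walkWeight (w : X → X → ℤ) (l : List X) : ℤ :=
  (List.zipWith w l l.tail).sum

theorem walkWeight_cons_cons (w : X → X → ℤ) (x y : X) (l : List X) :
    walkWeight w (x :: y :: l) = w x y + walkWeight w (y :: l) := by
  simp [walkWeight]

theorem walkWeight_append (w : X → X → ℤ) (l₁ : List X) (x : X) (l₂ : List X) :
    walkWeight w (l₁ ++ x :: l₂) = walkWeight w (l₁ ++ [x]) + walkWeight w (x :: l₂) := by
  induction l₁ with
  | nil => simp [walkWeight]
  | cons y l₁ ih =>
    cases l₁ with
    | nil => simp [walkWeight]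
    | cons z l₁ =>
      simp only [List.cons_append, walkWeight_cons_cons] at ih ⊢
      rw [ih, add_assoc]

theorem map_formPerm_cons [DecidableEq X] {x : X} {l : List X} (h : (x :: l).Nodup) :
    (x :: l).map (List.formPerm (x :: l)) = l ++ [x] := by
  apply List.ext_getElem
  · simp
  · intro i h₁ h₂
    rw [List.getElem_map, List.formPerm_apply_getElem _ h]
    simp only [List.length_append, List.length_cons, List.length_nil] at h₂
    rcases Nat.lt_or_ge i l.length with hi | hi
    · simp only [List.length_cons, Nat.mod_eq_of_lt (show i + 1 < l.length + 1 by omega)]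
      simp [List.getElem_append_left hi]
    · have : i = l.length := by omega
      subst this
      simp

/-- A cycle without repeated vertices is a permutation that fixes all other vertices. -/
theorem walkWeight_cycle_le [Fintype X] [DecidableEq X] {r : X → X → Prop} {w : X → X → ℤ}
    (hr : ∀ x, r x x) (hw : ∀ x, w x x = 0)
    (h : ∀ σ : Equiv.Perm X, (∀ x, r x (σ x)) → ∑ x, w x (σ x) ≤ 0)
    {x : X} {l : List X} (hl : (x :: l).Nodup) (hc : List.IsChain r (x :: l ++ [x])) :
    walkWeight w (x :: l ++ [x]) ≤ 0 := by
  set σ := List.formPerm (x :: l) with hσ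
  have hmap := map_formPerm_cons hl
  have h₁ : walkWeight w (x :: l ++ [x]) = ∑ y, w y (σ y) := by
    have : List.zipWith w (x :: l ++ [x]) (x :: l ++ [x]).tail
        = (x :: l).map fun y => w y (σ y) := by
      simp only [List.cons_append, List.tail_cons]
      rw [← List.cons_append, ← hmap]
      rw [show List.zipWith w (x :: l ++ [x]) (List.map (x :: l).formPerm (x :: l))
        = List.zipWith w (x :: l) (List.map (x :: l).formPerm (x :: l)) from ?_]
      · simp only [List.zipWith_map_right, List.zipWith_self, ← hσ]
      · apply List.ext_getElem
        · simp
        · intro i h₁ h₂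
          simp only [List.getElem_zipWith]
          congr 1
          rw [List.getElem_append_left]
    rw [walkWeight, this, ← List.sum_toFinset _ hl]
    refine Finset.sum_subset (Finset.subset_univ _) fun y _ hy => ?_
    rw [List.mem_toFinset] at hy
    rw [hσ, List.formPerm_apply_of_notMem hy, hw]
  rw [h₁]
  refine h σ fun y => ?_
  by_cases hy : y ∈ x :: l
  · obtain ⟨i, hi, rfl⟩ := List.getElem_of_mem hy
    have h₂ : σ (x :: l)[i] = (l ++ [x])[i]'(by simpa using hi) := by
      simp only [← hmap, List.getElem_map]; rfl
    rw [h₂]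
    have h₃ := List.isChain_iff_getElem.1 hc i (by simpa using hi)
    rw [List.getElem_append_left hi] at h₃
    exact h₃
  · rw [hσ, List.formPerm_apply_of_notMem hy]
    exact hr y

/-- If the identity has maximum weight among all permutations along arcs, then there are
potentials: the potential of `x` is the maximum weight of a path that starts in `x`, and a path
that returns to `x` splits off a cycle, whose weight is at most `0`. -/
theorem exists_potential [Fintype X] {r : X → X → Prop} {w : X → X → ℤ}
    (hr : ∀ x, r x x) (hw : ∀ x, w x x = 0)
    (h : ∀ σ : Equiv.Perm X, (∀ x, r x (σ x)) → ∑ x, w x (σ x) ≤ 0) :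
    ∃ p : X → ℤ, ∀ x y, r x y → w x y + p y ≤ p x := by
  classical
  have hmax : ∀ x, ∃ l : List X, ((x :: l).Nodup ∧ List.IsChain r (x :: l)) ∧
      ∀ l' : List X, (x :: l').Nodup → List.IsChain r (x :: l') →
        walkWeight w (x :: l') ≤ walkWeight w (x :: l) := by
    intro x
    have hfin : {l : List X | (x :: l).Nodup ∧ List.IsChain r (x :: l)}.Finite := by
      refine Set.Finite.subset (s := {l : List X | l.Nodup}) ?_ fun l hl => hl.1.of_cons
      exact inferInstanceAs (Finite {l : List X // l.Nodup})
    obtain ⟨l, hl, hl'⟩ := Set.exists_max_image _ (fun l => walkWeight w (x :: l)) hfin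
      ⟨[], by simp⟩
    exact ⟨l, hl, fun l' h₁ h₂ => hl' l' ⟨h₁, h₂⟩⟩
  choose f hf hmax using hmax
  refine ⟨fun x => walkWeight w (x :: f x), fun x y hxy => ?_⟩
  by_cases hx : x ∈ y :: f y
  · obtain ⟨l₁, l₂, hl⟩ := List.append_of_mem hx
    have hnd := (hf y).1
    have hch := (hf y).2
    rw [hl] at hnd hch
    have h₁ : walkWeight w (x :: l₂) ≤ walkWeight w (x :: f x) :=
      hmax x l₂ hnd.of_append_right hch.right_of_append
    have h₂ : w x y + walkWeight w (l₁ ++ [x]) ≤ 0 := by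
      cases l₁ with
      | nil =>
        have : x = y := by simpa using (congrArg List.head? hl).symm
        subst this
        simp [hw, walkWeight]
      | cons z l₁ =>
        obtain rfl : y = z := by simpa using congrArg List.head? hl
        rw [List.cons_append, ← walkWeight_cons_cons]
        refine walkWeight_cycle_le (l := y :: l₁) hr hw h ?_ ?_
        · refine (List.perm_middle.nodup_iff.1 hnd).sublist ?_
          simp
        · rw [← List.singleton_append (x := x) (l := l₂), ← List.append_assoc] at hch
          exact List.isChain_cons_cons.2 ⟨hxy, hch.left_of_append⟩
    simp only
    rw [hl, walkWeight_append]
    linarith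
  · rw [← walkWeight_cons_cons]
    exact hmax x _ (List.nodup_cons.2 ⟨hx, (hf y).1⟩) (List.isChain_cons_cons.2 ⟨hxy, (hf y).2⟩)

end Potential

/-! ### Popular matchings and their witnesses -/

section Votes

variable {β : Type*} [DecidableEq β]

/-- A vertex with the preference list `l` prefers its partner in `p` to its situation in `p'`.
Here `p` and `p'` hold for the partners of the vertex in two matchings. -/
def Prefers (l : List β) (p p' : β → Prop) : Prop :=
  ∃ b, p b ∧ ∀ b', p' b' → l.idxOf b < l.idxOf b'

open Classical in
/-- The vote of a vertex for the neighbour `b` against its situation in `p`. -/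
noncomputable def vote (l : List β) (p : β → Prop) (b : β) : ℤ :=
  if p b then 0 else if ∀ b', p b' → l.idxOf b < l.idxOf b' then 1 else -1

open Classical in
/-- The vote of a vertex for `p'` against `p`. -/
noncomputable def gain (l : List β) (p p' : β → Prop) : ℤ :=
  (if Prefers l p' p then 1 else 0) - if Prefers l p p' then 1 else 0

theorem gain_eq_vote {l : List β} {p p' : β → Prop} {b : β} (hl : ∀ b, p b → b ∈ l)
    (hp : ∀ b b', p b → p b' → b = b') (hp' : ∀ b b', p' b → p' b' → b = b') (hb : p' b) :
    gain l p p' = vote l p b := by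
  have h₁ : Prefers l p' p ↔ ∀ b', p b' → l.idxOf b < l.idxOf b' :=
    ⟨fun ⟨c, hc, h⟩ => hp' c b hc hb ▸ h, fun h => ⟨b, hb, h⟩⟩
  have h₂ : Prefers l p p' ↔ ∃ b', p b' ∧ l.idxOf b' < l.idxOf b :=
    ⟨fun ⟨c, hc, h⟩ => ⟨c, hc, h b hb⟩,
      fun ⟨c, hc, h⟩ => ⟨c, hc, fun b' hb' => hp' b b' hb hb' ▸ h⟩⟩
  unfold gain vote
  rw [h₁, h₂]
  by_cases h : p b
  · have h₃ : ¬ ∀ b', p b' → l.idxOf b < l.idxOf b' := fun h' => lt_irrefl _ (h' b h)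
    have h₄ : ¬ ∃ b', p b' ∧ l.idxOf b' < l.idxOf b := fun ⟨b', hb', h'⟩ =>
      lt_irrefl _ (hp b b' h hb' ▸ h')
    simp only [h, h₃, h₄, if_true, if_false, sub_zero]
  · by_cases h' : ∀ b', p b' → l.idxOf b < l.idxOf b'
    · have h₄ : ¬ ∃ b', p b' ∧ l.idxOf b' < l.idxOf b := fun ⟨b', hb', h''⟩ =>
        lt_asymm h'' (h' b' hb')
      rw [if_pos h', if_neg h₄, if_neg h, if_pos h', sub_zero]
    · have h₄ : ∃ b', p b' ∧ l.idxOf b' < l.idxOf b := by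
        push Not at h'
        obtain ⟨b', hb', h'⟩ := h'
        refine ⟨b', hb', lt_of_le_of_ne h' fun he => h ?_⟩
        rwa [(List.idxOf_inj (hl b' hb')).1 he] at hb'
      rw [if_neg h', if_pos h₄, if_neg h, if_neg h', zero_sub]

open Classical in
theorem gain_of_unmatched {l : List β} {p p' : β → Prop} (h : ∀ b, ¬ p' b) :
    gain l p p' = -if ∃ b, p b then 1 else 0 := by
  have h₁ : ¬ Prefers l p' p := fun ⟨b, hb, _⟩ => h b hb
  have h₂ : Prefers l p p' ↔ ∃ b, p b :=
    ⟨fun ⟨c, hc, _⟩ => ⟨c, hc⟩, fun ⟨c, hc⟩ => ⟨c, hc, fun b hb => (h b hb).elim⟩⟩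
  rw [gain, h₂, if_neg h₁, zero_sub]

end Votes

namespace MUPM

variable {I : MUPM} {M M' : Finset (Fin I.nA × Fin I.nB)}

theorem mem_edges {e : Fin I.nA × Fin I.nB} : e ∈ I.edges ↔ e.2 ∈ I.prefA e.1 := by
  simp [edges]

theorem IsMatching.fst_inj (h : I.IsMatching M) {a : Fin I.nA} {b b' : Fin I.nB}
    (hb : (a, b) ∈ M) (hb' : (a, b') ∈ M) : b = b' := by
  by_contra hne
  exact (h.2 _ hb _ hb' (by simp [hne])).1 rfl

theorem IsMatching.snd_inj (h : I.IsMatching M) {a a' : Fin I.nA} {b : Fin I.nB}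
    (ha : (a, b) ∈ M) (ha' : (a', b) ∈ M) : a = a' := by
  by_contra hne
  exact (h.2 _ ha _ ha' (by simp [hne])).2 rfl

theorem IsMatching.mem_prefA (h : I.IsMatching M) {a : Fin I.nA} {b : Fin I.nB}
    (hb : (a, b) ∈ M) : b ∈ I.prefA a := mem_edges.1 (h.1 hb)

theorem IsMatching.mem_prefB (h : I.IsMatching M) {a : Fin I.nA} {b : Fin I.nB}
    (hb : (a, b) ∈ M) : a ∈ I.prefB b := (I.mem_iff a b).1 (h.mem_prefA hb)

/-- The vote of the vertex `a` for `M'` against `M`. -/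
noncomputable def gainA (M M' : Finset (Fin I.nA × Fin I.nB)) (a : Fin I.nA) : ℤ :=
  gain (I.prefA a) (fun b => (a, b) ∈ M) fun b => (a, b) ∈ M'

/-- The vote of the vertex `b` for `M'` against `M`. -/
noncomputable def gainB (M M' : Finset (Fin I.nA × Fin I.nB)) (b : Fin I.nB) : ℤ :=
  gain (I.prefB b) (fun a => (a, b) ∈ M) fun a => (a, b) ∈ M'

/-- The vote of the endpoint of the edge `e` in `A` for this edge against `M`. -/
noncomputable def voteA (M : Finset (Fin I.nA × Fin I.nB)) (e : Fin I.nA × Fin I.nB) : ℤ :=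
  vote (I.prefA e.1) (fun b => (e.1, b) ∈ M) e.2

/-- The vote of the endpoint of the edge `e` in `B` for this edge against `M`. -/
noncomputable def voteB (M : Finset (Fin I.nA × Fin I.nB)) (e : Fin I.nA × Fin I.nB) : ℤ :=
  vote (I.prefB e.2) (fun a => (a, e.2) ∈ M) e.1

theorem voteA_of_mem {e : Fin I.nA × Fin I.nB} (he : e ∈ M) : voteA M e = 0 := if_pos he

theorem voteB_of_mem {e : Fin I.nA × Fin I.nB} (he : e ∈ M) : voteB M e = 0 := if_pos he

theorem gainA_of_mem (h : I.IsMatching M) (h' : I.IsMatching M') {e : Fin I.nA × Fin I.nB}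
    (he : e ∈ M') : gainA M M' e.1 = voteA M e :=
  gain_eq_vote (fun _ => h.mem_prefA) (fun _ _ => h.fst_inj) (fun _ _ => h'.fst_inj) he

theorem gainB_of_mem (h : I.IsMatching M) (h' : I.IsMatching M') {e : Fin I.nA × Fin I.nB}
    (he : e ∈ M') : gainB M M' e.2 = voteB M e :=
  gain_eq_vote (fun _ => h.mem_prefB) (fun _ _ => h.snd_inj) (fun _ _ => h'.snd_inj) he

theorem votes_sub_votes (M M' : Finset (Fin I.nA × Fin I.nB)) :
    (I.votes M' M : ℤ) - I.votes M M' = ∑ a, gainA M M' a + ∑ b, gainB M M' b := by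
  classical
  simp only [gainA, gainB, gain, Finset.sum_sub_distrib, Finset.sum_boole, votes]
  have h₁ : ∀ N N' : Finset (Fin I.nA × Fin I.nB),
      (Finset.univ.filter (I.PrefersA N N')).card =
        (Finset.univ.filter fun a => Prefers (I.prefA a) (fun b => (a, b) ∈ N)
          fun b => (a, b) ∈ N').card := fun N N' => by congr 1
  have h₂ : ∀ N N' : Finset (Fin I.nA × Fin I.nB),
      (Finset.univ.filter (I.PrefersB N N')).card =
        (Finset.univ.filter fun b => Prefers (I.prefB b) (fun a => (a, b) ∈ N)
          fun a => (a, b) ∈ N').card := fun N N' => by congr 1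
  rw [← h₁, ← h₁, ← h₂, ← h₂]
  push_cast
  ring

/-- A witness of the popularity of `M`: an optimal solution of the linear program that is dual to
the maximisation of the votes against `M`. -/
structure IsWitness (M : Finset (Fin I.nA × Fin I.nB)) (α : Fin I.nA → ℤ) (β : Fin I.nB → ℤ) :
    Prop where
  edge : ∀ e ∈ I.edges, voteA M e + voteB M e ≤ α e.1 + β e.2
  mem : ∀ e ∈ M, α e.1 + β e.2 = 0
  unmatchedA : ∀ a, (∀ b, (a, b) ∉ M) → α a = 0
  unmatchedB : ∀ b, (∀ a, (a, b) ∉ M) → β b = 0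
  lowA : ∀ a, -1 ≤ α a
  lowB : ∀ b, -1 ≤ β b

theorem sum_le_sum_fst (h : I.IsMatching M) {f : Fin I.nA → ℤ}
    (hf : ∀ a, (∀ b, (a, b) ∉ M) → f a ≤ 0) : ∑ a, f a ≤ ∑ e ∈ M, f e.1 := by
  rw [← Finset.sum_image (f := f) (g := Prod.fst) (s := M)
    fun e he e' he' hee => by_contra fun hne => (h.2 e he e' he' hne).1 hee,
    ← Finset.sum_sdiff (Finset.subset_univ (M.image Prod.fst))]
  refine add_le_of_nonpos_left (Finset.sum_nonpos fun a ha => hf a fun b hb => ?_)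
  simp only [Finset.mem_sdiff, Finset.mem_image, not_exists, not_and] at ha
  exact ha.2 _ hb rfl

theorem sum_le_sum_snd (h : I.IsMatching M) {f : Fin I.nB → ℤ}
    (hf : ∀ b, (∀ a, (a, b) ∉ M) → f b ≤ 0) : ∑ b, f b ≤ ∑ e ∈ M, f e.2 := by
  rw [← Finset.sum_image (f := f) (g := Prod.snd) (s := M)
    fun e he e' he' hee => by_contra fun hne => (h.2 e he e' he' hne).2 hee,
    ← Finset.sum_sdiff (Finset.subset_univ (M.image Prod.snd))]
  refine add_le_of_nonpos_left (Finset.sum_nonpos fun b hb => hf b fun a ha => ?_)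
  simp only [Finset.mem_sdiff, Finset.mem_image, not_exists, not_and] at hb
  exact hb.2 _ ha rfl

theorem IsWitness.isPopular {α : Fin I.nA → ℤ} {β : Fin I.nB → ℤ} (hM : I.IsMatching M)
    (h : IsWitness M α β) : I.IsPopular M := by
  classical
  refine ⟨hM, fun M' hM' hlt => ?_⟩
  have h₀ : ∑ a, α a + ∑ b, β b ≤ 0 := by
    have h₁ := sum_le_sum_fst hM (f := α) fun a ha => (h.unmatchedA a ha).le
    have h₂ := sum_le_sum_snd hM (f := β) fun b hb => (h.unmatchedB b hb).le
    have h₃ : ∑ e ∈ M, α e.1 + ∑ e ∈ M, β e.2 = 0 := by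
      rw [← Finset.sum_add_distrib]
      exact Finset.sum_eq_zero h.mem
    linarith
  have h₁ := sum_le_sum_fst hM' (f := fun a => gainA M M' a - α a) fun a ha => by
    rw [gainA, gain_of_unmatched ha]
    have := h.lowA a
    split_ifs with hc
    · linarith
    · push Not at hc
      rw [h.unmatchedA a hc]; simp
  have h₂ := sum_le_sum_snd hM' (f := fun b => gainB M M' b - β b) fun b hb => by
    rw [gainB, gain_of_unmatched hb]
    have := h.lowB b
    split_ifs with hc
    · linarith
    · push Not at hc
      rw [h.unmatchedB b hc]; simp
  have h₃ : ∑ e ∈ M', (gainA M M' e.1 - α e.1) + ∑ e ∈ M', (gainB M M' e.2 - β e.2) ≤ 0 := by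
    rw [← Finset.sum_add_distrib]
    refine Finset.sum_nonpos fun e he => ?_
    rw [gainA_of_mem hM hM' he, gainB_of_mem hM hM' he]
    linarith [h.edge e (hM'.1 he)]
  have h₄ := votes_sub_votes (I := I) M M'
  simp only [Finset.sum_sub_distrib] at h₁ h₂ h₃
  have : (I.votes M M' : ℤ) < I.votes M' M := by exact_mod_cast hlt
  linarith

section Necessity

/-- The arcs of the auxiliary bipartite graph whose perfect matchings correspond to the matchings
of `I`. It contains a copy of every vertex (on the other side), to which a vertex is matched if it
is unmatched in `I`; the copies of two matched vertices are matched to each other. -/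
def Arc (I : MUPM) : Fin I.nA ⊕ Fin I.nB → Fin I.nB ⊕ Fin I.nA → Prop
  | .inl a, .inl b => (a, b) ∈ I.edges
  | .inl a, .inr a' => a = a'
  | .inr b, .inl b' => b = b'
  | .inr b, .inr a => (a, b) ∈ I.edges

open Classical in
/-- The votes against `M` that an edge of the auxiliary graph contributes. -/
noncomputable def arcWeight (M : Finset (Fin I.nA × Fin I.nB)) :
    Fin I.nA ⊕ Fin I.nB → Fin I.nB ⊕ Fin I.nA → ℤ
  | .inl a, .inl b => voteA M (a, b) + voteB M (a, b)
  | .inl a, .inr _ => -if ∃ b, (a, b) ∈ M then 1 else 0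
  | .inr _, .inl b => -if ∃ a, (a, b) ∈ M then 1 else 0
  | .inr _, .inr _ => 0

/-- A matching as a perfect matching of the auxiliary graph. -/
theorem IsMatching.exists_equiv (h : I.IsMatching M) :
    ∃ τ : Fin I.nA ⊕ Fin I.nB ≃ Fin I.nB ⊕ Fin I.nA,
      (∀ x, Arc I x (τ x)) ∧ (∀ x, arcWeight M x (τ x) = 0) ∧
      (∀ e ∈ M, τ (.inl e.1) = .inl e.2 ∧ τ (.inr e.2) = .inr e.1) ∧
      (∀ a, (∀ b, (a, b) ∉ M) → τ (.inl a) = .inr a) ∧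
      ∀ b, (∀ a, (a, b) ∉ M) → τ (.inr b) = .inl b := by
  classical
  let f : Fin I.nA ⊕ Fin I.nB → Fin I.nB ⊕ Fin I.nA := fun x => match x with
    | .inl a => if h : ∃ b, (a, b) ∈ M then .inl h.choose else .inr a
    | .inr b => if h : ∃ a, (a, b) ∈ M then .inr h.choose else .inl b
  have h₁ : ∀ a b, (a, b) ∈ M → f (.inl a) = .inl b := fun a b hab => by
    have he : ∃ b, (a, b) ∈ M := ⟨b, hab⟩
    simp only [f, dif_pos he]
    rw [h.fst_inj he.choose_spec hab]
  have h₂ : ∀ a b, (a, b) ∈ M → f (.inr b) = .inr a := fun a b hab => by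
    have he : ∃ a, (a, b) ∈ M := ⟨a, hab⟩
    simp only [f, dif_pos he]
    rw [h.snd_inj he.choose_spec hab]
  have h₃ : ∀ a, (∀ b, (a, b) ∉ M) → f (.inl a) = .inr a := fun a ha => by
    simp [f, ha]
  have h₄ : ∀ b, (∀ a, (a, b) ∉ M) → f (.inr b) = .inl b := fun b hb => by
    simp [f, hb]
  have hcase : ∀ a, (∃ b, (a, b) ∈ M) ∨ ∀ b, (a, b) ∉ M := fun a => by
    simpa only [not_exists] using em (∃ b, (a, b) ∈ M)
  have hcase' : ∀ b, (∃ a, (a, b) ∈ M) ∨ ∀ a, (a, b) ∉ M := fun b => by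
    simpa only [not_exists] using em (∃ a, (a, b) ∈ M)
  have hinj : Function.Injective f := by
    rintro (a | b) (a' | b') hxy
    · rcases hcase a with ⟨b, hb⟩ | ha <;> rcases hcase a' with ⟨b', hb'⟩ | ha'
      · rw [h₁ _ _ hb, h₁ _ _ hb'] at hxy
        obtain rfl := Sum.inl.inj hxy
        rw [h.snd_inj hb hb']
      · rw [h₁ _ _ hb, h₃ _ ha'] at hxy; cases hxy
      · rw [h₃ _ ha, h₁ _ _ hb'] at hxy; cases hxy
      · rw [h₃ _ ha, h₃ _ ha'] at hxy; rw [Sum.inr.inj hxy]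
    · rcases hcase a with ⟨b, hb⟩ | ha <;> rcases hcase' b' with ⟨a', ha'⟩ | hb'
      · rw [h₁ _ _ hb, h₂ _ _ ha'] at hxy; cases hxy
      · rw [h₁ _ _ hb, h₄ _ hb'] at hxy
        exact (hb' a (Sum.inl.inj hxy ▸ hb)).elim
      · rw [h₃ _ ha, h₂ _ _ ha'] at hxy
        exact (ha b' ((Sum.inr.inj hxy).symm ▸ ha')).elim
      · rw [h₃ _ ha, h₄ _ hb'] at hxy; cases hxy
    · rcases hcase' b with ⟨a, ha⟩ | hb <;> rcases hcase a' with ⟨b', hb'⟩ | ha'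
      · rw [h₂ _ _ ha, h₁ _ _ hb'] at hxy; cases hxy
      · rw [h₂ _ _ ha, h₃ _ ha'] at hxy
        exact (ha' b (Sum.inr.inj hxy ▸ ha)).elim
      · rw [h₄ _ hb, h₁ _ _ hb'] at hxy
        exact (hb a' ((Sum.inl.inj hxy).symm ▸ hb')).elim
      · rw [h₄ _ hb, h₃ _ ha'] at hxy; cases hxy
    · rcases hcase' b with ⟨a, ha⟩ | hb <;> rcases hcase' b' with ⟨a', ha'⟩ | hb'
      · rw [h₂ _ _ ha, h₂ _ _ ha'] at hxy
        obtain rfl := Sum.inr.inj hxy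
        rw [h.fst_inj ha ha']
      · rw [h₂ _ _ ha, h₄ _ hb'] at hxy; cases hxy
      · rw [h₄ _ hb, h₂ _ _ ha'] at hxy; cases hxy
      · rw [h₄ _ hb, h₄ _ hb'] at hxy; rw [Sum.inl.inj hxy]
  have hbij : Function.Bijective f :=
    (Fintype.bijective_iff_injective_and_card f).2 ⟨hinj, by simp [add_comm]⟩
  refine ⟨Equiv.ofBijective f hbij, ?_, ?_, fun e he => ⟨h₁ _ _ he, h₂ _ _ he⟩, h₃, h₄⟩
  · rintro (a | b)
    · rw [Equiv.ofBijective_apply]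
      rcases hcase a with ⟨b, hb⟩ | ha
      · rw [h₁ _ _ hb]; exact h.1 hb
      · rw [h₃ _ ha]; rfl
    · rw [Equiv.ofBijective_apply]
      rcases hcase' b with ⟨a, ha⟩ | hb
      · rw [h₂ _ _ ha]; exact h.1 ha
      · rw [h₄ _ hb]; rfl
  · rintro (a | b)
    · rw [Equiv.ofBijective_apply]
      rcases hcase a with ⟨b, hb⟩ | ha
      · rw [h₁ _ _ hb, arcWeight, voteA_of_mem hb, voteB_of_mem hb]; rfl
      · rw [h₃ _ ha]; simp [arcWeight, ha]
    · rw [Equiv.ofBijective_apply]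
      rcases hcase' b with ⟨a, ha⟩ | hb
      · rw [h₂ _ _ ha]; rfl
      · rw [h₄ _ hb]; simp [arcWeight, hb]

/-- A perfect matching of the auxiliary graph yields a matching of `I`, and its weight is the
outcome of the election between the two matchings. -/
theorem IsPopular.sum_arcWeight_le (h : I.IsPopular M)
    (τ : Fin I.nA ⊕ Fin I.nB ≃ Fin I.nB ⊕ Fin I.nA) (hτ : ∀ x, Arc I x (τ x)) :
    ∑ x, arcWeight M x (τ x) ≤ 0 := by
  classical
  set M' := I.edges.filter fun e => τ (.inl e.1) = .inl e.2 with hM'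
  have hmem : ∀ a b, (a, b) ∈ M' ↔ τ (.inl a) = .inl b := fun a b => by
    rw [hM', Finset.mem_filter]
    exact and_iff_right_of_imp fun hab => by have := hτ (.inl a); rw [hab] at this; exact this
  have hmat : I.IsMatching M' := by
    refine ⟨Finset.filter_subset _ _, ?_⟩
    rintro ⟨a, b⟩ he ⟨a', b'⟩ hf hne
    rw [hmem] at he hf
    refine ⟨fun hc => hne ?_, fun hc => hne ?_⟩
    · obtain rfl : a = a' := hc
      rw [Sum.inl.inj (he.symm.trans hf)]
    · obtain rfl : b = b' := hc
      rw [Sum.inl.inj (τ.injective (he.trans hf.symm))]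
  let g : Fin I.nA ⊕ Fin I.nB → ℤ := Sum.elim (gainA M M') 0
  let k : Fin I.nB ⊕ Fin I.nA → ℤ := Sum.elim (gainB M M') 0
  have hpt : ∀ x, arcWeight M x (τ x) = g x + k (τ x) := by
    rintro (a | b)
    · have harc := hτ (.inl a)
      rcases hx : τ (.inl a) with b | a'
      · have hab := (hmem a b).2 hx
        simp only [arcWeight, g, k, Sum.elim_inl]
        rw [← gainA_of_mem h.1 hmat hab, ← gainB_of_mem h.1 hmat hab]
      · simp only [arcWeight, g, k, Sum.elim_inl, Sum.elim_inr, gainA]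
        rw [gain_of_unmatched]
        · simp
        · intro b hb
          rw [hmem, hx] at hb
          cases hb
    · have harc := hτ (.inr b)
      rcases hx : τ (.inr b) with b' | a
      · rw [hx] at harc
        obtain rfl : b = b' := harc
        simp only [arcWeight, g, k, Sum.elim_inl, Sum.elim_inr, gainB]
        rw [gain_of_unmatched]
        · simp
        · intro a ha
          rw [hmem, ← hx] at ha
          cases τ.injective ha
      · simp [arcWeight, g, k]
  have h₁ := votes_sub_votes (I := I) M M'
  have h₂ : (I.votes M' M : ℤ) ≤ I.votes M M' := by exact_mod_cast not_lt.1 (h.2 M' hmat)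
  simp only [hpt, Finset.sum_add_distrib]
  rw [Equiv.sum_comp τ k, Fintype.sum_sum_type, Fintype.sum_sum_type]
  simp only [g, k, Sum.elim_inl, Sum.elim_inr, Pi.zero_apply, Finset.sum_const_zero, add_zero]
  linarith

/-- The value of a vertex is the potential of the vertex minus the potential of the vertex that is
matched to its copy in the auxiliary graph. The identity corresponds to `M` itself and has maximum
weight, because `M` is popular. -/
theorem IsPopular.exists_isWitness (h : I.IsPopular M) : ∃ α β, IsWitness M α β := by
  classical
  obtain ⟨τ, hτ, hτ0, hτM, hτA, hτB⟩ := h.1.exists_equiv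
  obtain ⟨p, hp⟩ := exists_potential (r := fun x y => Arc I x (τ y))
    (w := fun x y => arcWeight M x (τ y)) hτ hτ0
    fun σ hσ => h.sum_arcWeight_le (σ.trans τ) hσ
  have hp' : ∀ x y, Arc I x y → arcWeight M x y + p (τ.symm y) ≤ p x := fun x y hxy => by
    have := hp x (τ.symm y)
    simp only [Equiv.apply_symm_apply] at this
    exact this hxy
  have hA : ∀ a, -1 ≤ p (.inl a) - p (τ.symm (.inr a)) := fun a => by
    have := hp' (.inl a) (.inr a) rfl
    simp only [arcWeight] at this
    split_ifs at this <;> linarith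
  have hB : ∀ b, -1 ≤ p (.inr b) - p (τ.symm (.inl b)) := fun b => by
    have := hp' (.inr b) (.inl b) rfl
    simp only [arcWeight] at this
    split_ifs at this <;> linarith
  refine ⟨fun a => p (.inl a) - p (τ.symm (.inr a)), fun b => p (.inr b) - p (τ.symm (.inl b)),
    ?_, ?_, ?_, ?_, hA, hB⟩
  · rintro ⟨a, b⟩ he
    have h₁ := hp' (.inl a) (.inl b) he
    have h₂ := hp' (.inr b) (.inr a) he
    simp only [arcWeight] at h₁ h₂
    simp only
    linarith
  · rintro ⟨a, b⟩ he
    have h₁ := (hτM _ he).1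
    have h₂ := (hτM _ he).2
    simp only at h₁ h₂ ⊢
    rw [← h₁, ← h₂]
    simp
  · intro a ha
    rw [← hτA a ha]; simp
  · intro b hb
    rw [← hτB b hb]; simp

end Necessity

end MUPM

/-! ### Master lists and the uniqueness of stable matchings -/

theorem idxOf_lt_idxOf_of_sublist {β : Type*} [DecidableEq β] {L l : List β} (hL : L.Nodup)
    (h : l.Sublist L) {x y : β} (hy : y ∈ l) (hxy : l.idxOf x < l.idxOf y) :
    L.idxOf x < L.idxOf y := by
  have hP : L.Pairwise fun x y => L.idxOf x < L.idxOf y := by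
    rw [List.pairwise_iff_getElem]
    intro i j hi hj hij
    rwa [hL.idxOf_getElem, hL.idxOf_getElem]
  have hj := List.idxOf_lt_length_iff.2 hy
  have := List.pairwise_iff_getElem.1 (hP.sublist h) _ _ (hxy.trans hj) hj hxy
  simpa using this

namespace MUPM

variable {I : MUPM} {M M' S : Finset (Fin I.nA × Fin I.nB)}

/-- `M` is a stable matching of the graph without the edges of `S`. -/
structure IsStableWithout (I : MUPM) (S M : Finset (Fin I.nA × Fin I.nB)) : Prop where
  isMatching : I.IsMatching M
  notMem : ∀ e ∈ M, e ∉ S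
  stable : ∀ e ∈ I.edges, e ∉ S → ¬ I.Blocks M e

theorem mem_bp {e : Fin I.nA × Fin I.nB} : e ∈ I.bp M ↔ e ∈ I.edges ∧ I.Blocks M e := by
  simp [bp]

theorem IsMatching.isStableWithout_bp (h : I.IsMatching M) : I.IsStableWithout (I.bp M) M where
  isMatching := h
  notMem _ he hS := lt_irrefl _ ((mem_bp.1 hS).2.1 _ he)
  stable _ he hS hb := hS (mem_bp.2 ⟨he, hb⟩)

theorem IsStableWithout.exists_of_notMem (h : I.IsStableWithout S M) {a : Fin I.nA} {b : Fin I.nB}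
    (he : b ∈ I.prefA a) (hS : (a, b) ∉ S) (hM : (a, b) ∉ M) :
    (∃ b', (a, b') ∈ M ∧ I.ltA a b b') ∨ ∃ a', (a', b) ∈ M ∧ I.ltB b a a' := by
  have := h.stable (a, b) (mem_edges.2 he) hS
  rw [Blocks, not_and_or] at this
  push Not at this
  rcases this with ⟨b', hb', hlt⟩ | ⟨a', ha', hlt⟩
  · refine .inl ⟨b', hb', lt_of_le_of_ne (not_lt.1 hlt) fun hc => hM ?_⟩
    rwa [← (List.idxOf_inj (h.isMatching.mem_prefA hb')).1 hc]
  · refine .inr ⟨a', ha', lt_of_le_of_ne (not_lt.1 hlt) fun hc => hM ?_⟩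
    rwa [← (List.idxOf_inj (h.isMatching.mem_prefB ha')).1 hc]

/-- By induction along the master list, every vertex has the same partner in both matchings. -/
theorem IsMasterListA.mem_of_mem {L : List (Fin I.nA)} (hL : I.IsMasterListA L) (n : ℕ)
    (h : I.IsStableWithout S M) (h' : I.IsStableWithout S M')
    {a : Fin I.nA} {b : Fin I.nB} (ha : L.idxOf a = n) (hab : (a, b) ∈ M) : (a, b) ∈ M' := by
  have hrank : ∀ {a a' : Fin I.nA} {b : Fin I.nB}, b ∈ I.prefA a → I.ltB b a a' →
      L.idxOf a' < L.idxOf a := fun {a a' b} hb hlt =>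
    idxOf_lt_idxOf_of_sublist hL.1 (hL.2.2 b ▸ List.filter_sublist) ((I.mem_iff a b).1 hb) hlt
  induction n using Nat.strong_induction_on generalizing M M' a b with
  | _ n ih =>
    by_contra hn
    have hb := h.isMatching.mem_prefA hab
    rcases h'.exists_of_notMem hb (h.notMem _ hab) hn with ⟨b', hb', hlt⟩ | ⟨a', ha', hlt⟩
    · have hn' : (a, b') ∉ M := fun hc => by
        rw [h.isMatching.fst_inj hc hab] at hlt; exact lt_irrefl _ hlt
      rcases h.exists_of_notMem (h'.isMatching.mem_prefA hb') (h'.notMem _ hb') hn' with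
        ⟨b'', hb'', hlt'⟩ | ⟨a'', ha'', hlt'⟩
      · rw [h.isMatching.fst_inj hb'' hab] at hlt'
        exact lt_asymm hlt hlt'
      · have hr := hrank (h'.isMatching.mem_prefA hb') hlt'
        have := ih _ (ha ▸ hr) h h' rfl ha''
        rw [h'.isMatching.snd_inj this hb'] at hlt'
        exact lt_irrefl _ hlt'
    · have := ih _ (ha ▸ hrank hb hlt) h' h rfl ha'
      rw [h.isMatching.snd_inj this hab] at hlt
      exact lt_irrefl _ hlt

theorem IsMasterListB.mem_of_mem {L : List (Fin I.nB)} (hL : I.IsMasterListB L) (n : ℕ)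
    (h : I.IsStableWithout S M) (h' : I.IsStableWithout S M')
    {a : Fin I.nA} {b : Fin I.nB} (hb : L.idxOf b = n) (hab : (a, b) ∈ M) : (a, b) ∈ M' := by
  have hrank : ∀ {b b' : Fin I.nB} {a : Fin I.nA}, b ∈ I.prefA a → I.ltA a b b' →
      L.idxOf b' < L.idxOf b := fun {b b' a} hb hlt =>
    idxOf_lt_idxOf_of_sublist hL.1 (hL.2.2 a ▸ List.filter_sublist) hb hlt
  induction n using Nat.strong_induction_on generalizing M M' a b with
  | _ n ih =>
    by_contra hn
    have ha := h.isMatching.mem_prefA hab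
    rcases h'.exists_of_notMem ha (h.notMem _ hab) hn with ⟨b', hb', hlt⟩ | ⟨a', ha', hlt⟩
    · have := ih _ (hb ▸ hrank ha hlt) h' h rfl hb'
      rw [h.isMatching.fst_inj this hab] at hlt
      exact lt_irrefl _ hlt
    · have hn' : (a', b) ∉ M := fun hc => by
        rw [h.isMatching.snd_inj hc hab] at hlt; exact lt_irrefl _ hlt
      rcases h.exists_of_notMem (h'.isMatching.mem_prefA ha') (h'.notMem _ ha') hn' with
        ⟨b'', hb'', hlt'⟩ | ⟨a'', ha'', hlt'⟩
      · have hr := hrank (h'.isMatching.mem_prefA ha') hlt'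
        have := ih _ (hb ▸ hr) h h' rfl hb''
        rw [h'.isMatching.fst_inj this ha'] at hlt'
        exact lt_irrefl _ hlt'
      · rw [h.isMatching.snd_inj ha'' hab] at hlt'
        exact lt_asymm hlt hlt'

theorem IsStableWithout.unique (hI : I.AdmitsMasterListOnOneSide) (h : I.IsStableWithout S M)
    (h' : I.IsStableWithout S M') : M = M' := by
  ext ⟨a, b⟩
  rcases hI with ⟨L, hL⟩ | ⟨L, hL⟩
  · exact ⟨hL.mem_of_mem _ h h' rfl, hL.mem_of_mem _ h' h rfl⟩
  · exact ⟨hL.mem_of_mem _ h h' rfl, hL.mem_of_mem _ h' h rfl⟩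

end MUPM

/-! ### Graphs with numbered edges -/

/-- A bipartite graph with preferences as the program sees it: the edges are the numbers below `m`,
and the two sides are `false` for `A` and `true` for `B`. The edge `i` has the endpoint `V d i` on
side `d` and the position `P d i` on the preference list of this endpoint. The preference lists of
the vertices of side `d` are stored one after the other in `L d`, the one of `v` from `st d v` on.
The number `m` itself plays the part of the missing partner edge of an unmatched vertex. -/
structure Net where
  m : ℕ
  V : Bool → ℕ → ℕ
  P : Bool → ℕ → ℕ
  st : Bool → ℕ → ℕ
  L : Bool → ℕ → ℕ

namespace Net

/-- The laws that hold when the arrays store preference lists. The value of `P` at `m` makes every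
edge better than the missing one. -/
structure Good (D : Net) : Prop where
  L_lt : ∀ d j, j < D.m → D.L d j < D.m
  st_lt : ∀ d i, i < D.m → D.st d (D.V d i) + D.P d i < D.m
  L_st : ∀ d i, i < D.m → D.L d (D.st d (D.V d i) + D.P d i) = i
  st_L : ∀ d j, j < D.m → D.st d (D.V d (D.L d j)) + D.P d (D.L d j) = j
  full : ∀ d i p, i < D.m → D.P d i = p + 1 → ∃ i' < D.m, D.V d i' = D.V d i ∧ D.P d i' = p
  P_m : ∀ d, D.P d D.m = D.m
  L_false : ∀ j, j < D.m → D.L false j = j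

variable {D : Net}

theorem Good.P_lt (h : D.Good) (d : Bool) {i : ℕ} (hi : i < D.m) : D.P d i < D.m :=
  lt_of_le_of_lt (Nat.le_add_left _ _) (h.st_lt d i hi)

theorem Good.succ (h : D.Good) (d : Bool) {j : ℕ} (hj : j + 1 < D.m)
    (hP : D.P d (D.L d (j + 1)) ≠ 0) :
    D.V d (D.L d (j + 1)) = D.V d (D.L d j) ∧ D.P d (D.L d (j + 1)) = D.P d (D.L d j) + 1 := by
  obtain ⟨p, hp⟩ := Nat.exists_eq_succ_of_ne_zero hP
  obtain ⟨i, hi, hV, hPi⟩ := h.full d _ p (h.L_lt d _ hj) hp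
  have h₁ := h.st_L d _ hj
  have h₂ := h.L_st d i hi
  rw [hV, hPi, show D.st d (D.V d (D.L d (j + 1))) + p = j by omega] at h₂
  rw [h₂, hV, hPi, hp]
  exact ⟨rfl, rfl⟩

theorem Good.succ_false (h : D.Good) {j : ℕ} (hj : j + 1 < D.m) (hP : D.P false (j + 1) ≠ 0) :
    D.V false (j + 1) = D.V false j ∧ D.P false (j + 1) = D.P false j + 1 := by
  have := h.succ false hj (by rwa [h.L_false _ hj])
  rwa [h.L_false _ hj, h.L_false _ (by omega)] at this

theorem Good.inj (h : D.Good) (d : Bool) {i j : ℕ} (hi : i < D.m) (hj : j < D.m)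
    (hV : D.V d i = D.V d j) (hP : D.P d i = D.P d j) : i = j := by
  rw [← h.L_st d i hi, ← h.L_st d j hj, hV, hP]

theorem Good.P_zero (h : D.Good) (d : Bool) (hm : 0 < D.m) : D.P d (D.L d 0) = 0 := by
  have := h.st_L d 0 hm
  omega

/-! ### Deferred acceptance -/

/-- The next edge on the preference list of the endpoint in `A`. -/
def next (D : Net) (e : ℕ) : ℕ := if D.P false (e + 1) = 0 then D.m else e + 1

/-- The edge `e` has been proposed, if the vertices of `A` with first edge before `e₀` have started
and `R` is the set of the rejected edges. -/
def Proposed (D : Net) (e₀ : ℕ) (R : Finset ℕ) (e : ℕ) : Prop :=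
  if D.P false e = 0 then e < e₀ else e - 1 ∈ R

/-- The invariant of deferred acceptance: `e` is the edge that is currently proposed (or `m`), and
`mB` assigns to the vertices of `B` the edges that they hold (or `m`). Edges of `S` are always
rejected. The set `R` of the rejected edges does not exist in memory. -/
structure ProposalInv (D : Net) (S : ℕ → ℕ) (e₀ e : ℕ) (mB : ℕ → ℕ) (R : Finset ℕ) : Prop where
  start_le : e₀ ≤ D.m
  cur_le : e ≤ D.m
  rejected_lt : ∀ x ∈ R, x < D.m
  rejected_proposed : ∀ x ∈ R, D.Proposed e₀ R x
  active : ∀ x < D.m, (D.Proposed e₀ R x ∧ x ∉ R) ↔ (x = e ∨ mB (D.V true x) = x)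
  cur : e < D.m → mB (D.V true e) ≠ e
  held : ∀ x < D.m, mB (D.V true x) = D.m ∨
    (mB (D.V true x) < D.m ∧ D.V true (mB (D.V true x)) = D.V true x)
  held_notMem : ∀ x < D.m, mB (D.V true x) = x → S x = 0
  rejected : ∀ x ∈ R, S x ≠ 0 ∨ D.P true (mB (D.V true x)) < D.P true x

/-- The number of rounds that deferred acceptance can still take. -/
def proposalFuel (D : Net) (e₀ e : ℕ) (R : Finset ℕ) : ℕ :=
  2 * (D.m - e₀) + 2 * (D.m - R.card) + if e < D.m then 1 else 0

variable {S mB : ℕ → ℕ} {e₀ e : ℕ} {R : Finset ℕ}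

theorem ProposalInv.init (hmB : ∀ x < D.m, mB (D.V true x) = D.m) :
    D.ProposalInv S 0 D.m mB ∅ where
  start_le := Nat.zero_le _
  cur_le := le_rfl
  rejected_lt := by simp
  rejected_proposed := by simp
  active x hx := by
    have := hmB x hx
    simp only [Proposed]
    grind
  cur h := (lt_irrefl _ h).elim
  held x hx := .inl (hmB x hx)
  held_notMem x hx h := by have := hmB x hx; omega
  rejected := by simp

theorem ProposalInv.card_lt (h : D.ProposalInv S e₀ e mB R) {x : ℕ} (hx : x < D.m) (hR : x ∉ R) :
    R.card < D.m := by
  have : insert x R ⊆ Finset.range D.m := fun y hy => by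
    rcases Finset.mem_insert.1 hy with rfl | hy
    · exact Finset.mem_range.2 hx
    · exact Finset.mem_range.2 (h.rejected_lt y hy)
  have := Finset.card_le_card this
  rw [Finset.card_insert_of_notMem hR, Finset.card_range] at this
  omega

theorem ProposalInv.start (h : D.ProposalInv S e₀ D.m mB R) (he : e₀ < D.m) :
    D.ProposalInv S (e₀ + 1) (if D.P false e₀ = 0 then e₀ else D.m) mB R ∧
    D.proposalFuel (e₀ + 1) (if D.P false e₀ = 0 then e₀ else D.m) R
      < D.proposalFuel e₀ D.m R := by
  constructor
  · refine ⟨he, by grind, h.rejected_lt, fun x hx => ?_, fun x hx => ?_, fun hlt => ?_, h.held,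
      h.held_notMem, h.rejected⟩
    · have := h.rejected_proposed x hx
      grind [Proposed]
    · have := h.active x hx
      have := h.rejected_proposed x
      grind [Proposed]
    · have := h.active e₀ he
      grind [Proposed]
  · grind [proposalFuel]

theorem ProposalInv.reject (hD : D.Good) (h : D.ProposalInv S e₀ e mB R) (he : e < D.m)
    (hrej : S e ≠ 0 ∨ D.P true (mB (D.V true e)) < D.P true e) :
    D.ProposalInv S e₀ (D.next e) mB (insert e R) ∧
    D.proposalFuel e₀ (D.next e) (insert e R) < D.proposalFuel e₀ e R := by
  have hact := (h.active e he).2 (.inl rfl)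
  have hcur := h.cur he
  have hc := h.card_lt he hact.2
  have hm := hD.P_m false
  constructor
  · refine ⟨h.start_le, ?_, ?_, ?_, ?_, ?_, h.held, h.held_notMem, ?_⟩
    · grind [next]
    · have := h.rejected_lt
      grind
    · have := h.rejected_proposed
      grind [Proposed]
    · intro x hx
      have h₁ := h.active x hx
      have h₂ := h.rejected_proposed
      have h₃ := h.rejected_lt
      have h₄ := hD.succ_false (j := e)
      have h₅ := hD.P_zero false
      have h₆ := hD.L_false 0
      simp only [Proposed, next] at *
      grind
    · intro hlt
      have h₁ := h.active (D.next e) hlt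
      have h₂ := h.rejected_proposed
      simp only [Proposed, next] at *
      grind
    · have := h.rejected
      grind
  · rw [proposalFuel, proposalFuel, Finset.card_insert_of_notMem hact.2]
    grind

theorem ProposalInv.accept (hD : D.Good) (h : D.ProposalInv S e₀ e mB R) (he : e < D.m)
    (hS : S e = 0) (hacc : ¬ D.P true (mB (D.V true e)) < D.P true e) :
    ∃ R', D.ProposalInv S e₀
        (if mB (D.V true e) < D.m then D.next (mB (D.V true e)) else D.m)
        (Function.update mB (D.V true e) e) R' ∧
      D.proposalFuel e₀ (if mB (D.V true e) < D.m then D.next (mB (D.V true e)) else D.m) R'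
        < D.proposalFuel e₀ e R := by
  have hact := (h.active e he).2 (.inl rfl)
  have hcur := h.cur he
  have hP := hD.P_lt true he
  obtain ⟨f, hf⟩ : ∃ f, f = mB (D.V true e) := ⟨_, rfl⟩
  rw [← hf] at hacc hcur ⊢
  rcases h.held e he with hm | ⟨hlt, hV⟩
  · rw [← hf] at hm
    subst hm
    simp only [lt_irrefl, if_false]
    refine ⟨R, ⟨h.start_le, le_rfl, h.rejected_lt, h.rejected_proposed, ?_, ?_, ?_, ?_, ?_⟩, ?_⟩
    · intro x hx
      have h₁ := h.active x hx
      grind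
    · grind
    · intro x hx
      have h₁ := h.held x hx
      grind
    · intro x hx
      have h₁ := h.held_notMem x hx
      grind
    · intro x hx
      have h₁ := h.rejected x hx
      have h₂ := hD.P_lt true (h.rejected_lt x hx)
      have h₃ := hD.P_m true
      grind
    · simp only [proposalFuel, lt_irrefl, if_false, if_pos he]
      omega
  · rw [← hf] at hlt hV
    have hfact := (h.active f hlt).2 (.inr (by rw [hV, ← hf]))
    have hc := h.card_lt hlt hfact.2
    have hPf : D.P true e < D.P true f :=
      lt_of_le_of_ne (not_lt.1 hacc) fun hc => hcur (hD.inj true hlt he hV hc.symm)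
    have hm := hD.P_m false
    simp only [if_pos hlt]
    refine ⟨insert f R, ⟨h.start_le, ?_, ?_, ?_, ?_, ?_, ?_, ?_, ?_⟩, ?_⟩
    · grind [next]
    · have := h.rejected_lt
      grind
    · have := h.rejected_proposed
      grind [Proposed]
    · intro x hx
      have h₁ := h.active x hx
      have h₂ := h.rejected_proposed
      have h₃ := h.rejected_lt
      have h₄ := hD.succ_false (j := f)
      have h₅ := hD.P_zero false
      have h₆ := hD.L_false 0
      simp only [Proposed, next] at *
      grind
    · intro hlt
      have h₁ := h.active (D.next f) hlt
      have h₂ := h.rejected_proposed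
      simp only [Proposed, next] at *
      grind
    · intro x hx
      have h₁ := h.held x hx
      grind
    · intro x hx
      have h₁ := h.held_notMem x hx
      grind
    · intro x hx
      have h₁ := h.rejected x
      have h₂ := h.rejected_lt
      grind
    · rw [proposalFuel, proposalFuel, Finset.card_insert_of_notMem hfact.2]
      grind

/-- The edges that are held at the end of deferred acceptance. -/
def held (D : Net) (mB : ℕ → ℕ) : Finset ℕ := {x ∈ Finset.range D.m | mB (D.V true x) = x}

theorem mem_held {x : ℕ} : x ∈ D.held mB ↔ x < D.m ∧ mB (D.V true x) = x := by
  simp [held]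

/-- A matching of the edges that are not in `S`, without blocking edges outside of `S`. -/
structure Stable (D : Net) (S : ℕ → ℕ) (X : Finset ℕ) : Prop where
  lt : ∀ x ∈ X, x < D.m
  inj : ∀ d, ∀ x ∈ X, ∀ y ∈ X, D.V d x = D.V d y → x = y
  notMem : ∀ x ∈ X, S x = 0
  stable : ∀ e < D.m, S e = 0 → ∃ d, ∃ x ∈ X, D.V d x = D.V d e ∧ D.P d x ≤ D.P d e

theorem ProposalInv.stable (hD : D.Good) (h : D.ProposalInv S D.m D.m mB R) :
    D.Stable S (D.held mB) := by
  have hpred : ∀ {j}, j < D.m → D.P false j ≠ 0 →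
      0 < j ∧ D.V false j = D.V false (j - 1) ∧ D.P false j = D.P false (j - 1) + 1 := by
    intro j hj hP
    have h₀ := hD.P_zero false (by omega)
    rw [hD.L_false 0 (by omega)] at h₀
    have h₁ := hD.succ_false (j := j - 1)
    grind
  have hact : ∀ {x}, x < D.m → (x ∈ D.held mB ↔ D.Proposed D.m R x ∧ x ∉ R) := by
    intro x hx
    rw [h.active x hx, mem_held]
    grind
  have hpre : ∀ n {i j}, j < D.m → i < D.m → D.V false i = D.V false j →
      D.P false j = D.P false i + (n + 1) → D.Proposed D.m R j → i ∈ R := by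
    intro n
    induction n with
    | zero =>
      intro i j hj hi hV hP hpr
      have h₁ := hpred hj (by omega)
      have h₂ : i = j - 1 := hD.inj false hi (by omega) (hV.trans h₁.2.1) (by omega)
      rw [h₂]
      rwa [Proposed, if_neg (by omega)] at hpr
    | succ n ih =>
      intro i j hj hi hV hP hpr
      have h₁ := hpred hj (by omega)
      rw [Proposed, if_neg (by omega)] at hpr
      exact ih (by omega) hi (hV.trans h₁.2.1) (by omega) (h.rejected_proposed _ hpr)
  refine ⟨fun x hx => (mem_held.1 hx).1, ?_, ?_, ?_⟩
  · rintro (_ | _) x hx y hy hV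
    · have hxm := (mem_held.1 hx).1
      have hym := (mem_held.1 hy).1
      rw [hact hxm] at hx
      rw [hact hym] at hy
      rcases lt_trichotomy (D.P false x) (D.P false y) with hlt | heq | hlt
      · exact (hx.2 (hpre (D.P false y - D.P false x - 1) hym hxm hV (by omega) hy.1)).elim
      · exact hD.inj false hxm hym hV heq
      · exact (hy.2 (hpre (D.P false x - D.P false y - 1) hxm hym hV.symm (by omega) hx.1)).elim
    · rw [← (mem_held.1 hx).2, ← (mem_held.1 hy).2, hV]
  · intro x hx
    rw [mem_held] at hx
    exact h.held_notMem x hx.1 hx.2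
  · intro e he hS
    by_cases hR : e ∈ R
    · have h₁ := h.rejected e hR
      have h₂ := h.held e he
      have h₃ := hD.P_lt true he
      have h₄ := hD.P_m true
      refine ⟨true, mB (D.V true e), ?_, ?_, ?_⟩
      · rw [mem_held]; grind
      · grind
      · grind
    · suffices H : ∀ n e, D.P false e = n → e < D.m → e ∉ R →
          ∃ x ∈ D.held mB, D.V false x = D.V false e ∧ D.P false x ≤ D.P false e from
        ⟨false, H _ e rfl he hR⟩
      intro n
      induction n with
      | zero =>
        intro e hP he hR
        exact ⟨e, (hact he).2 ⟨by rwa [Proposed, if_pos hP], hR⟩, rfl, le_rfl⟩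
      | succ n ih =>
        intro e hP he hR
        by_cases hpr : e - 1 ∈ R
        · exact ⟨e, (hact he).2 ⟨by rwa [Proposed, if_neg (by omega)], hR⟩, rfl, le_rfl⟩
        · have h₁ := hpred he (by omega)
          obtain ⟨x, hx, hV, hle⟩ := ih (e - 1) (by omega) (by omega) hpr
          exact ⟨x, hx, hV.trans h₁.2.1.symm, by omega⟩

end Net

/-! ### The vertices that must have dual value one -/

namespace Net

theorem exists_lt_update {Q : ℕ → ℕ} {h t a j : ℕ} (hle : h ≤ t) :
    (∃ i < h, Function.update Q t a i = j) ↔ ∃ i < h, Q i = j := by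
  refine exists_congr fun i => and_congr_right fun hi => ?_
  rw [Function.update_of_ne (by omega)]

theorem exists_lt_succ_update {Q : ℕ → ℕ} {t a j : ℕ} :
    (∃ i < t + 1, Function.update Q t a i = j) ↔ (∃ i < t, Q i = j) ∨ a = j := by
  simp only [Nat.exists_lt_succ_right, Function.update_self, exists_lt_update le_rfl]

variable {D : Net} {X : Finset ℕ} {mt : Bool → ℕ → ℕ} {d : Bool} {u Q : ℕ → ℕ} {h t : ℕ}

/-- `mt d v` is the edge of `X` at the vertex `v` of side `d`, or `m` if there is none. -/
def IsPartner (D : Net) (X : Finset ℕ) (mt : Bool → ℕ → ℕ) : Prop :=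
  ∀ d, ∀ i < D.m, (mt d (D.V d i) = D.m ∧ ∀ x ∈ X, D.V d x ≠ D.V d i) ∨
    (mt d (D.V d i) ∈ X ∧ D.V d (mt d (D.V d i)) = D.V d i)

/-- The edge `i` blocks the matching with partner edges `mt`. -/
def Blocking (D : Net) (mt : Bool → ℕ → ℕ) (i : ℕ) : Prop :=
  ∀ d, D.P d i < D.P d (mt d (D.V d i))

/-- Some endpoint of `i` does not vote against `i`. -/
def Acceptable (D : Net) (mt : Bool → ℕ → ℕ) (i : ℕ) : Prop :=
  ∃ d, D.P d i ≤ D.P d (mt d (D.V d i))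

/-- A set of vertices of side `d` that contains the endpoints of the blocking edges and is closed
under passing from a vertex to its partner and on along an acceptable edge. Every vertex in the
least such set has value `1` in every witness. -/
structure Closed (D : Net) (X : Finset ℕ) (mt : Bool → ℕ → ℕ) (d : Bool) (C : ℕ → Prop) : Prop where
  blocking : ∀ i < D.m, D.Blocking mt i → C (D.V d i)
  step : ∀ x ∈ X, C (D.V d x) → ∀ i < D.m, D.V (!d) i = D.V (!d) x → D.Acceptable mt i →
    C (D.V d i)

/-- The invariant of the search for the least closed set. The cells `Q 0, …, Q (t - 1)` of the
queue contain positions in the lists of the other side, of which the first `h` have been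
inspected; a position enters the queue when its predecessor has been inspected or, if it is the
first position of a vertex, when the partner of this vertex has been marked in `u`. -/
structure SearchInv (D : Net) (X : Finset ℕ) (mt : Bool → ℕ → ℕ) (d : Bool) (u Q : ℕ → ℕ)
    (h t : ℕ) : Prop where
  head_le : h ≤ t
  lt : ∀ i < t, Q i < D.m
  inj : ∀ i < t, ∀ j < t, Q i = Q j → i = j
  succ : ∀ j, j + 1 < D.m → D.P (!d) (D.L (!d) (j + 1)) ≠ 0 →
    ((∃ i < t, Q i = j + 1) ↔ ∃ i < h, Q i = j)
  start : ∀ x ∈ X, (∃ i < t, Q i = D.st (!d) (D.V (!d) x)) ↔ u (D.V d x) ≠ 0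
  source : ∀ i < t, ∃ x ∈ X, D.V (!d) x = D.V (!d) (D.L (!d) (Q i)) ∧ u (D.V d x) ≠ 0
  sound : ∀ C, D.Closed X mt d C → ∀ i < D.m, u (D.V d i) ≠ 0 → C (D.V d i)

theorem SearchInv.tail_le (hI : D.SearchInv X mt d u Q h t) : t ≤ D.m := by
  have := Finset.card_le_card_of_injOn (s := Finset.range t) (t := Finset.range D.m) Q
    (fun i hi => by simpa using hI.lt i (by simpa using hi))
    (fun i hi j hj hij => hI.inj i (by simpa using hi) j (by simpa using hj) hij)
  simpa using this

theorem SearchInv.init (hX : ∀ x ∈ X, x < D.m) (hu : ∀ i < D.m, u (D.V d i) = 0) :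
    D.SearchInv X mt d u Q 0 0 where
  head_le := le_rfl
  lt := by simp
  inj := by simp
  succ := by simp
  start x hx := by simp [hu x (hX x hx)]
  source := by simp
  sound C _ i hi hne := (hne (hu i hi)).elim

/-- The first position in the list of a vertex. -/
theorem Good.start_spec (hD : D.Good) (d : Bool) {i : ℕ} (hi : i < D.m) :
    D.st d (D.V d i) < D.m ∧ D.V d (D.L d (D.st d (D.V d i))) = D.V d i ∧
      D.P d (D.L d (D.st d (D.V d i))) = 0 := by
  induction hp : D.P d i generalizing i with
  | zero =>
    have h₁ := hD.st_lt d i hi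
    have h₂ := hD.L_st d i hi
    rw [hp, add_zero] at h₁ h₂
    rw [h₂]
    exact ⟨h₁, rfl, hp⟩
  | succ p ih =>
    obtain ⟨i', hi', hV, hP⟩ := hD.full d i p hi hp
    rw [← hV]
    exact ih hi' hP

theorem SearchInv.mark_unmatched (hmt : D.IsPartner X mt) (hI : D.SearchInv X mt d u Q h t) {i : ℕ}
    (hi : i < D.m) (hC : ∀ C, D.Closed X mt d C → C (D.V d i)) (hm : ¬ mt d (D.V d i) < D.m)
    (hX : ∀ x ∈ X, x < D.m) :
    D.SearchInv X mt d (Function.update u (D.V d i) 1) Q h t := by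
  have hne : ∀ x ∈ X, D.V d x ≠ D.V d i := by
    rcases hmt d i hi with h' | h'
    · exact h'.2
    · exact (hm (hX _ h'.1)).elim
  refine ⟨hI.head_le, hI.lt, hI.inj, hI.succ, fun x hx => ?_, fun j hj => ?_, fun C hCC j hj => ?_⟩
  · rw [Function.update_of_ne (hne x hx)]
    exact hI.start x hx
  · obtain ⟨x, hx, h₁, h₂⟩ := hI.source j hj
    exact ⟨x, hx, h₁, by rwa [Function.update_of_ne (hne x hx)]⟩
  · have h₁ := hI.sound C hCC j hj
    have h₂ := hC C hCC
    grind

theorem SearchInv.mark_matched (hD : D.Good) (hmt : D.IsPartner X mt)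
    (hI : D.SearchInv X mt d u Q h t) {i : ℕ} (hi : i < D.m)
    (hC : ∀ C, D.Closed X mt d C → C (D.V d i)) (hm : mt d (D.V d i) < D.m)
    (hX : ∀ x ∈ X, x < D.m) (hinj : ∀ d, ∀ x ∈ X, ∀ y ∈ X, D.V d x = D.V d y → x = y)
    (hu : u (D.V d i) = 0) :
    D.SearchInv X mt d (Function.update u (D.V d i) 1)
      (Function.update Q t (D.st (!d) (D.V (!d) (mt d (D.V d i))))) h (t + 1) := by
  obtain ⟨y, hy⟩ : ∃ y, y = mt d (D.V d i) := ⟨_, rfl⟩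
  rw [← hy] at hm ⊢
  obtain ⟨hyX, hyV⟩ : y ∈ X ∧ D.V d y = D.V d i := by
    rcases hmt d i hi with h' | h'
    · omega
    · rwa [← hy] at h'
  obtain ⟨hs₁, hs₂, hs₃⟩ := hD.start_spec (!d) hm
  have hnew : ∀ j < t, Q j ≠ D.st (!d) (D.V (!d) y) := fun j hj hc =>
    (hI.start y hyX).1 ⟨j, hj, hc⟩ (hyV ▸ hu)
  have hle := hI.head_le
  refine ⟨by omega, ?_, ?_, ?_, ?_, ?_, ?_⟩
  · have := hI.lt
    grind
  · have := hI.inj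
    grind
  · intro j hj hP
    rw [exists_lt_update hle, ← hI.succ j hj hP, exists_lt_succ_update, or_iff_left]
    exact fun hc => hP (hc ▸ hs₃)
  · intro x hx
    have h₁ := hI.start x hx
    by_cases hxy : x = y
    · subst hxy
      rw [exists_lt_succ_update, hyV]
      simp
    · have h₂ : D.V d x ≠ D.V d i := fun hc => hxy (hinj d x hx y hyX (hc.trans hyV.symm))
      have h₃ : D.st (!d) (D.V (!d) y) ≠ D.st (!d) (D.V (!d) x) := by
        intro hc
        have := (hD.start_spec (!d) (hX x hx)).2.1
        rw [← hc, hs₂] at this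
        exact hxy (hinj (!d) y hyX x hx this).symm
      rw [Function.update_of_ne h₂, ← h₁, exists_lt_succ_update, or_iff_left h₃]
  · intro j hj
    by_cases hjt : j = t
    · subst hjt
      exact ⟨y, hyX, by simp [hs₂], by simp [hyV]⟩
    · obtain ⟨x, hx, h₁, h₂⟩ := hI.source j (by omega)
      refine ⟨x, hx, by rwa [Function.update_of_ne hjt], ?_⟩
      grind
  · intro C hCC j hj
    have h₁ := hI.sound C hCC j hj
    have h₂ := hC C hCC
    grind

theorem SearchInv.pop_last (hI : D.SearchInv X mt d u Q h t) (hlt : h < t)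
    (hlast : ¬ (Q h + 1 < D.m ∧ D.P (!d) (D.L (!d) (Q h + 1)) ≠ 0)) :
    D.SearchInv X mt d u Q (h + 1) t := by
  refine ⟨hlt, hI.lt, hI.inj, fun j hj hP => ?_, hI.start, hI.source, hI.sound⟩
  rw [hI.succ j hj hP]
  grind

theorem SearchInv.pop_succ (hD : D.Good) (hI : D.SearchInv X mt d u Q h t) (hlt : h < t)
    (hm : Q h + 1 < D.m) (hP : D.P (!d) (D.L (!d) (Q h + 1)) ≠ 0) (hX : ∀ x ∈ X, x < D.m) :
    D.SearchInv X mt d u (Function.update Q t (Q h + 1)) (h + 1) (t + 1) := by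
  have hnew : ∀ i < t, Q i ≠ Q h + 1 := fun i hi hc => by
    obtain ⟨i', hi', hc'⟩ := (hI.succ (Q h) hm hP).1 ⟨i, hi, hc⟩
    exact absurd (hI.inj _ (by omega) _ hlt hc') (by omega)
  refine ⟨by omega, ?_, ?_, ?_, ?_, ?_, hI.sound⟩
  · have := hI.lt
    grind
  · have := hI.inj
    grind
  · intro j hj hP'
    rw [exists_lt_update hlt, exists_lt_succ_update, hI.succ j hj hP', Nat.add_right_cancel_iff]
    exact Nat.exists_lt_succ_right.symm
  · intro x hx
    have h₁ := (hD.start_spec (!d) (hX x hx)).2.2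
    have h₂ : Q h + 1 ≠ D.st (!d) (D.V (!d) x) := fun hc => hP (hc ▸ h₁)
    rw [← hI.start x hx, exists_lt_succ_update, or_iff_left h₂]
  · intro j hj
    by_cases hjt : j = t
    · subst hjt
      obtain ⟨x, hx, h₁, h₂⟩ := hI.source h hlt
      refine ⟨x, hx, ?_, h₂⟩
      rw [Function.update_self, (hD.succ (!d) hm hP).1, h₁]
    · rw [Function.update_of_ne hjt]
      exact hI.source j (by omega)

/-- The inspection of the position `Q h` concerns a vertex of every closed set. -/
theorem SearchInv.closed_of_acceptable (hD : D.Good) (hI : D.SearchInv X mt d u Q h t) (hlt : h < t)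
    (hX : ∀ x ∈ X, x < D.m) (hacc : D.Acceptable mt (D.L (!d) (Q h))) {C : ℕ → Prop}
    (hC : D.Closed X mt d C) : C (D.V d (D.L (!d) (Q h))) := by
  obtain ⟨x, hx, h₁, h₂⟩ := hI.source h hlt
  exact hC.step x hx (hI.sound C hC x (hX x hx) h₂) _ (hD.L_lt _ _ (hI.lt _ hlt)) h₁.symm hacc

theorem SearchInv.closed (hD : D.Good) (hI : D.SearchInv X mt d u Q t t)
    (hblock : ∀ i < D.m, D.Blocking mt i → u (D.V d i) ≠ 0)
    (hmark : ∀ i < t, D.Acceptable mt (D.L (!d) (Q i)) → u (D.V d (D.L (!d) (Q i))) ≠ 0) :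
    D.Closed X mt d fun v => u v ≠ 0 := by
  refine ⟨hblock, fun x hx hux i hi hV hacc => ?_⟩
  have key : ∀ p i, i < D.m → D.V (!d) i = D.V (!d) x → D.P (!d) i = p →
      ∃ k < t, Q k = D.st (!d) (D.V (!d) i) + D.P (!d) i := by
    intro p
    induction p with
    | zero =>
      intro i hi hV hP
      rw [hP, hV]
      exact (hI.start x hx).2 hux
    | succ p ih =>
      intro i hi hV hP
      obtain ⟨i', hi', hV', hP'⟩ := hD.full (!d) i p hi hP
      have h₁ := ih i' hi' (hV'.trans hV) hP'
      have h₂ := hD.st_lt (!d) i hi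
      have h₃ := hD.L_st (!d) i hi
      rw [hV', hP'] at h₁
      rw [hP, ← add_assoc] at h₂ h₃ ⊢
      exact (hI.succ _ h₂ (by rw [h₃]; omega)).2 h₁
  obtain ⟨k, hk, hQ⟩ := key _ i hi hV rfl
  have := hmark k hk
  rw [hQ, hD.L_st (!d) i hi] at this
  exact this hacc

end Net

/-! ### The numbers of the edges of an instance -/

theorem getElem?_flatMap_finRange {n : ℕ} {γ : Type*} (f : Fin n → List γ) (a : Fin n) {p : ℕ}
    (hp : p < (f a).length) :
    ((List.finRange n).flatMap f)[(∑ a' ∈ Finset.Iio a, (f a').length) + p]? = (f a)[p]? := by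
  have h₁ : List.finRange n = (List.finRange n).take a ++ a :: (List.finRange n).drop (a + 1) := by
    conv_lhs => rw [← List.take_append_drop a (List.finRange n)]
    congr 1
    rw [List.drop_eq_getElem_cons (by simp)]
    simp
  have h₂ : ∑ a' ∈ Finset.Iio a, (f a').length
      = (((List.finRange n).take a).flatMap f).length := by
    rw [List.length_flatMap, ← List.sum_toFinset _ ((List.nodup_finRange n).sublist
      (List.take_sublist _ _))]
    congr 1
    ext a'
    simp only [Finset.mem_Iio, List.mem_toFinset, List.mem_take_iff_getElem, List.getElem_finRange]
    constructor
    · intro h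
      exact ⟨a', by simpa using h, by simp⟩
    · rintro ⟨i, hi, rfl⟩
      simpa [Fin.lt_def] using (lt_min_iff.1 hi).1
  rw [h₁, List.flatMap_append, List.flatMap_cons, h₂,
    List.getElem?_append_right (Nat.le_add_right _ _), Nat.add_sub_cancel_left,
    List.getElem?_append_left hp]

namespace MUPM

variable (I : MUPM)

theorem nodup_edgeList : I.edgeList.Nodup := by
  rw [edgeList, List.nodup_flatMap]
  refine ⟨fun a _ => (I.nodupA a).map fun b b' h => (Prod.mk.inj h).2, ?_⟩
  refine (List.nodup_finRange _).imp fun {a a'} hne => ?_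
  rw [Function.onFun, List.disjoint_left]
  simp only [List.mem_map]
  rintro _ ⟨b, _, rfl⟩ ⟨b', _, h⟩
  exact hne (Prod.mk.inj h).1.symm

theorem nodup_edgeListB : I.edgeListB.Nodup := by
  rw [edgeListB, List.nodup_flatMap]
  refine ⟨fun b _ => (I.nodupB b).map fun a a' h => (Prod.mk.inj h).1, ?_⟩
  refine (List.nodup_finRange _).imp fun {b b'} hne => ?_
  rw [Function.onFun, List.disjoint_left]
  simp only [List.mem_map]
  rintro _ ⟨a, _, rfl⟩ ⟨a', _, h⟩
  exact hne (Prod.mk.inj h).2.symm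

variable {I}

theorem mem_edgeList {e : Fin I.nA × Fin I.nB} : e ∈ I.edgeList ↔ e ∈ I.edges := by
  obtain ⟨a, b⟩ := e
  simp [edgeList, mem_edges]

theorem mem_edgeListB {e : Fin I.nA × Fin I.nB} : e ∈ I.edgeListB ↔ e ∈ I.edges := by
  obtain ⟨a, b⟩ := e
  simp [edgeListB, mem_edges, I.mem_iff]

variable (I)

theorem length_edgeList : I.edgeList.length = I.edges.card := by
  rw [← List.toFinset_card_of_nodup I.nodup_edgeList]
  congr 1
  ext e
  rw [List.mem_toFinset, mem_edgeList]

theorem length_edgeListB : I.edgeListB.length = I.edges.card := by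
  rw [← List.toFinset_card_of_nodup I.nodup_edgeListB]
  congr 1
  ext e
  rw [List.mem_toFinset, mem_edgeListB]

/-- The number of an edge. -/
def num (e : Fin I.nA × Fin I.nB) : ℕ := I.edgeList.idxOf e

variable {I}

theorem num_lt {e : Fin I.nA × Fin I.nB} (he : e ∈ I.edges) : I.num e < I.edges.card := by
  rw [← length_edgeList]
  exact List.idxOf_lt_length_iff.2 (mem_edgeList.2 he)

theorem num_inj {e f : Fin I.nA × Fin I.nB} (he : e ∈ I.edges) (h : I.num e = I.num f) : e = f :=
  (List.idxOf_inj (mem_edgeList.2 he)).1 h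

theorem exists_num {i : ℕ} (hi : i < I.edges.card) : ∃ e ∈ I.edges, I.num e = i := by
  rw [← length_edgeList] at hi
  exact ⟨_, mem_edgeList.1 (List.getElem_mem hi), I.nodup_edgeList.idxOf_getElem i hi⟩

theorem toArr_num {e : Fin I.nA × Fin I.nB} (he : e ∈ I.edges) (f : Fin I.nA × Fin I.nB → ℕ) :
    toArr (I.edgeList.map f) (I.num e) = f e := by
  have := List.idxOf_lt_length_iff.2 (mem_edgeList.2 he)
  rw [toArr, num, List.getD_eq_getElem _ _ (by simpa using this)]
  simp

theorem toArr_finRange {n : ℕ} (f : Fin n → ℕ) (a : Fin n) :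
    toArr ((List.finRange n).map f) a = f a := by
  rw [toArr, List.getD_eq_getElem _ _ (by simp)]
  simp

variable (I)

/-- The instance as the program sees it, once the program has written the number of edges to the
cells with this number in the arrays of positions. -/
def net : Net where
  m := I.edges.card
  V d := bif d then I.initArr 1 else I.initArr 0
  P d := bif d then Function.update (I.initArr 3) I.edges.card I.edges.card
    else Function.update (I.initArr 2) I.edges.card I.edges.card
  st d := bif d then I.initArr 8 else I.initArr 6
  L d := bif d then I.initArr 10 else fun j => if j < I.edges.card then j else 0

theorem net_m : I.net.m = I.edges.card := rfl

variable {I} {e : Fin I.nA × Fin I.nB}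

theorem net_V_false (he : e ∈ I.edges) : I.net.V false (I.num e) = e.1 := toArr_num he _

theorem net_V_true (he : e ∈ I.edges) : I.net.V true (I.num e) = e.2 := toArr_num he _

theorem net_P_false (he : e ∈ I.edges) :
    I.net.P false (I.num e) = (I.prefA e.1).idxOf e.2 :=
  (Function.update_of_ne (num_lt he).ne _ _).trans (toArr_num he _)

theorem net_P_true (he : e ∈ I.edges) :
    I.net.P true (I.num e) = (I.prefB e.2).idxOf e.1 :=
  (Function.update_of_ne (num_lt he).ne _ _).trans (toArr_num he _)

theorem net_st_false (a : Fin I.nA) :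
    I.net.st false a = ∑ a' ∈ Finset.Iio a, (I.prefA a').length := toArr_finRange _ a

theorem net_st_true (b : Fin I.nB) :
    I.net.st true b = ∑ b' ∈ Finset.Iio b, (I.prefB b').length := toArr_finRange _ b

theorem start_add_false (he : e ∈ I.edges) :
    I.net.st false e.1 + I.net.P false (I.num e) = I.num e := by
  have hlt := List.idxOf_lt_length_iff.2 (mem_edges.1 he)
  have h := getElem?_flatMap_finRange (fun a => (I.prefA a).map fun b => (a, b)) e.1
    (p := (I.prefA e.1).idxOf e.2) (by simpa using hlt)
  simp only [List.length_map, List.getElem?_map, List.getElem?_eq_getElem hlt,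
    List.getElem_idxOf, Option.map_some] at h
  rw [net_P_false he, net_st_false]
  have h' : I.edgeList[I.num e]? = some e := by
    have hn : I.num e < I.edgeList.length := by rw [length_edgeList]; exact num_lt he
    rw [List.getElem?_eq_getElem hn]
    exact congrArg some (List.getElem_idxOf hn)
  exact (List.getElem?_inj (List.getElem?_eq_some_iff.1 h).1 I.nodup_edgeList).1 (h.trans h'.symm)

theorem start_add_true (he : e ∈ I.edges) :
    I.edgeListB[I.net.st true e.2 + I.net.P true (I.num e)]? = some e := by
  have hlt := List.idxOf_lt_length_iff.2 ((I.mem_iff _ _).1 (mem_edges.1 he))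
  have h := getElem?_flatMap_finRange (fun b => (I.prefB b).map fun a => (a, b)) e.2
    (p := (I.prefB e.2).idxOf e.1) (by simpa using hlt)
  simp only [List.length_map, List.getElem?_map, List.getElem?_eq_getElem hlt,
    List.getElem_idxOf, Option.map_some] at h
  rw [net_P_true he, net_st_true]
  exact h

theorem net_L_true {j : ℕ} (h : I.edgeListB[j]? = some e) : I.net.L true j = I.num e := by
  obtain ⟨h₁, rfl⟩ := List.getElem?_eq_some_iff.1 h
  change toArr _ j = _
  rw [toArr, List.getD_eq_getElem _ _ (by simpa using h₁)]
  simp [num]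

theorem net_good (I : MUPM) : I.net.Good where
  L_lt d j hj := by
    cases d
    · rwa [show I.net.L false j = j from if_pos hj]
    · obtain ⟨e, he⟩ : ∃ e, I.edgeListB[j]? = some e :=
        ⟨_, List.getElem?_eq_getElem (by rw [length_edgeListB]; exact hj)⟩
      rw [net_L_true he]
      exact num_lt (mem_edgeListB.1 (List.mem_of_getElem? he))
  st_lt d i hi := by
    obtain ⟨e, he, rfl⟩ := exists_num hi
    cases d
    · rwa [net_V_false he, start_add_false he]
    · rw [net_V_true he]
      have := (List.getElem?_eq_some_iff.1 (start_add_true he)).1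
      rwa [length_edgeListB] at this
  L_st d i hi := by
    obtain ⟨e, he, rfl⟩ := exists_num hi
    cases d
    · rw [net_V_false he, start_add_false he]
      exact if_pos hi
    · rw [net_V_true he, net_L_true (start_add_true he)]
  st_L d j hj := by
    cases d
    · have : I.net.L false j = j := if_pos hj
      rw [this]
      obtain ⟨e, he, rfl⟩ := exists_num hj
      rw [net_V_false he, start_add_false he]
    · have hj' : j < I.edgeListB.length := by rw [length_edgeListB]; exact hj
      have he := List.getElem?_eq_getElem hj'
      have hm := mem_edgeListB.1 (List.mem_of_getElem? he)
      have h := start_add_true hm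
      rw [net_L_true he, net_V_true hm]
      exact (List.getElem?_inj (List.getElem?_eq_some_iff.1 h).1 I.nodup_edgeListB).1
        (h.trans he.symm)
  full d i p hi hP := by
    obtain ⟨e, he, rfl⟩ := exists_num hi
    cases d
    · rw [net_P_false he] at hP
      have hlt := List.idxOf_lt_length_iff.2 (mem_edges.1 he)
      have hp : p < (I.prefA e.1).length := by omega
      have he' : (e.1, (I.prefA e.1)[p]) ∈ I.edges := mem_edges.2 (List.getElem_mem hp)
      exact ⟨_, num_lt he', by rw [net_V_false he', net_V_false he],
        by rw [net_P_false he']; exact (I.nodupA e.1).idxOf_getElem p hp⟩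
    · rw [net_P_true he] at hP
      have hlt := List.idxOf_lt_length_iff.2 ((I.mem_iff _ _).1 (mem_edges.1 he))
      have hp : p < (I.prefB e.2).length := by omega
      have he' : ((I.prefB e.2)[p], e.2) ∈ I.edges :=
        mem_edges.2 ((I.mem_iff _ _).2 (List.getElem_mem hp))
      exact ⟨_, num_lt he', by rw [net_V_true he', net_V_true he],
        by rw [net_P_true he']; exact (I.nodupB e.2).idxOf_getElem p hp⟩
  P_m d := by cases d <;> simp [net]
  L_false j hj := if_pos hj

end MUPM

/-! ### The linear-time test of popularity -/

namespace Net

variable {D : Net} {X : Finset ℕ} {mt : Bool → ℕ → ℕ}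

/-- `X` is a matching with partner edges `mt`. -/
structure Matched (D : Net) (X : Finset ℕ) (mt : Bool → ℕ → ℕ) : Prop where
  lt : ∀ x ∈ X, x < D.m
  inj : ∀ d, ∀ x ∈ X, ∀ y ∈ X, D.V d x = D.V d y → x = y
  isPartner : D.IsPartner X mt

theorem Matched.eq_of_mem (h : D.Matched X mt) {d : Bool} {x : ℕ} (hx : x ∈ X) :
    mt d (D.V d x) = x := by
  rcases h.isPartner d x (h.lt x hx) with h' | h'
  · exact (h'.2 x hx rfl).elim
  · exact h.inj d _ h'.1 x hx h'.2

theorem Matched.forall_iff (hD : D.Good) (h : D.Matched X mt) {d : Bool} {i : ℕ} (hi : i < D.m) :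
    (∀ x ∈ X, D.V d x = D.V d i → D.P d i < D.P d x) ↔
      D.P d i < D.P d (mt d (D.V d i)) := by
  constructor
  · intro hx
    rcases h.isPartner d i hi with h' | h'
    · rw [h'.1, hD.P_m]
      exact hD.P_lt d hi
    · exact hx _ h'.1 h'.2
  · intro hlt x hx hV
    rwa [← hV, h.eq_of_mem hx] at hlt

/-- An edge outside of the matching never ties with the partner edge of an endpoint. -/
theorem Matched.lt_iff_le (hD : D.Good) (h : D.Matched X mt) {d : Bool} {i : ℕ} (hi : i < D.m)
    (hX : i ∉ X) : D.P d i < D.P d (mt d (D.V d i)) ↔ D.P d i ≤ D.P d (mt d (D.V d i)) := by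
  refine ⟨le_of_lt, fun hle => lt_of_le_of_ne hle fun hc => ?_⟩
  rcases h.isPartner d i hi with h' | h'
  · have := hD.P_lt d hi
    rw [h'.1, hD.P_m] at hc
    omega
  · exact hX (hD.inj d hi (h.lt _ h'.1) h'.2.symm hc ▸ h'.1)

/-- The marked vertices are matched, and no two of them are matched to each other. -/
def Passes (D : Net) (X : Finset ℕ) (mt u : Bool → ℕ → ℕ) : Prop :=
  (∀ d, ∀ i < D.m, u d (D.V d i) ≠ 0 → mt d (D.V d i) < D.m) ∧
    ∀ x ∈ X, ¬ (u false (D.V false x) ≠ 0 ∧ u true (D.V true x) ≠ 0)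

end Net

namespace MUPM

variable {I : MUPM} {X : Finset ℕ} {mt u : Bool → ℕ → ℕ} {S : ℕ → ℕ}
  {e : Fin I.nA × Fin I.nB}

/-- The edges with numbers in `X`. -/
def edgesOf (I : MUPM) (X : Finset ℕ) : Finset (Fin I.nA × Fin I.nB) :=
  {e ∈ I.edges | I.num e ∈ X}

theorem mem_edgesOf : e ∈ I.edgesOf X ↔ e ∈ I.edges ∧ I.num e ∈ X := by
  simp [edgesOf]

theorem exists_edge {x : ℕ} (hlt : ∀ x ∈ X, x < I.net.m) (hx : x ∈ X) :
    ∃ e ∈ I.edgesOf X, I.num e = x := by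
  obtain ⟨e, he, rfl⟩ := exists_num (hlt x hx)
  exact ⟨e, mem_edgesOf.2 ⟨he, hx⟩, rfl⟩

theorem sum_edgesOf (hlt : ∀ x ∈ X, x < I.net.m) {f : Fin I.nA × Fin I.nB → ℕ} {g : ℕ → ℕ}
    (hfg : ∀ e ∈ I.edges, g (I.num e) = f e) : ∑ e ∈ I.edgesOf X, f e = ∑ x ∈ X, g x := by
  refine Finset.sum_bij (fun e _ => I.num e) (fun e he => (mem_edgesOf.1 he).2)
    (fun e he f _ h => num_inj (mem_edgesOf.1 he).1 h) (fun x hx => ?_)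
    fun e he => (hfg e (mem_edgesOf.1 he).1).symm
  obtain ⟨e, he, h⟩ := exists_edge hlt hx
  exact ⟨e, he, h⟩

theorem isMatching_edgesOf (hinj : ∀ d, ∀ x ∈ X, ∀ y ∈ X, I.net.V d x = I.net.V d y → x = y) :
    I.IsMatching (I.edgesOf X) := by
  refine ⟨Finset.filter_subset _ _, fun e he f hf hne => ?_⟩
  rw [mem_edgesOf] at he hf
  refine ⟨fun hc => hne (num_inj he.1 (hinj false _ he.2 _ hf.2 ?_)),
    fun hc => hne (num_inj he.1 (hinj true _ he.2 _ hf.2 ?_))⟩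
  · rw [net_V_false he.1, net_V_false hf.1, hc]
  · rw [net_V_true he.1, net_V_true hf.1, hc]

/-- The vote of the endpoint in `A`, in terms of the numbers of the edges. -/
theorem forall_ltA_iff (hlt : ∀ x ∈ X, x < I.net.m) (he : e ∈ I.edges) :
    (∀ b, (e.1, b) ∈ I.edgesOf X → I.ltA e.1 b e.2) ↔ ∀ x ∈ X,
      I.net.V false x = I.net.V false (I.num e) → I.net.P false (I.num e) < I.net.P false x := by
  constructor
  · intro h x hx hV
    obtain ⟨f, hf, rfl⟩ := exists_edge hlt hx
    have hf' := (mem_edgesOf.1 hf).1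
    rw [net_V_false hf', net_V_false he, Fin.val_inj] at hV
    rw [net_P_false hf', net_P_false he, hV]
    exact h f.2 (hV ▸ hf)
  · intro h b hb
    have hf := mem_edgesOf.1 hb
    have := h _ hf.2 (by rw [net_V_false hf.1, net_V_false he])
    rwa [net_P_false hf.1, net_P_false he] at this

theorem forall_ltB_iff (hlt : ∀ x ∈ X, x < I.net.m) (he : e ∈ I.edges) :
    (∀ a, (a, e.2) ∈ I.edgesOf X → I.ltB e.2 a e.1) ↔ ∀ x ∈ X,
      I.net.V true x = I.net.V true (I.num e) → I.net.P true (I.num e) < I.net.P true x := by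
  constructor
  · intro h x hx hV
    obtain ⟨f, hf, rfl⟩ := exists_edge hlt hx
    have hf' := (mem_edgesOf.1 hf).1
    rw [net_V_true hf', net_V_true he, Fin.val_inj] at hV
    rw [net_P_true hf', net_P_true he, hV]
    exact h f.1 (hV ▸ hf)
  · intro h a ha
    have hf := mem_edgesOf.1 ha
    have := h _ hf.2 (by rw [net_V_true hf.1, net_V_true he])
    rwa [net_P_true hf.1, net_P_true he] at this

theorem isStableWithout_edgesOf (hX : I.net.Stable S X) :
    I.IsStableWithout {e ∈ I.edges | S (I.num e) ≠ 0} (I.edgesOf X) where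
  isMatching := isMatching_edgesOf hX.inj
  notMem e he hS := (Finset.mem_filter.1 hS).2 (hX.notMem _ (mem_edgesOf.1 he).2)
  stable e he hS hb := by
    have hS0 : S (I.num e) = 0 := by
      by_contra hc
      exact hS (Finset.mem_filter.2 ⟨he, hc⟩)
    rw [Blocks, forall_ltA_iff hX.lt he, forall_ltB_iff hX.lt he] at hb
    obtain ⟨_ | _, x, hx, hV, hP⟩ := hX.stable _ (num_lt he) hS0
    · exact absurd (hb.1 x hx hV) (not_lt.2 hP)
    · exact absurd (hb.2 x hx hV) (not_lt.2 hP)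

theorem blocks_edgesOf (h : I.net.Matched X mt) (he : e ∈ I.edges) :
    I.Blocks (I.edgesOf X) e ↔ I.net.Blocking mt (I.num e) := by
  rw [Blocks, forall_ltA_iff h.lt he, forall_ltB_iff h.lt he,
    h.forall_iff I.net_good (num_lt he), h.forall_iff I.net_good (num_lt he),
    Net.Blocking, Bool.forall_bool]

theorem voteA_edgesOf (h : I.net.Matched X mt) (he : e ∈ I.edges) : voteA (I.edgesOf X) e =
    if I.num e ∈ X then 0 else
      if I.net.P false (I.num e) < I.net.P false (mt false (I.net.V false (I.num e)))
        then 1 else -1 := by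
  have h₁ : (e.1, e.2) ∈ I.edgesOf X ↔ I.num e ∈ X := by rw [mem_edgesOf, and_iff_right he]
  have h₂ := (forall_ltA_iff h.lt he).trans (h.forall_iff I.net_good (num_lt he))
  simp only [ltA] at h₂
  simp only [voteA, vote, h₁, h₂]

theorem voteB_edgesOf (h : I.net.Matched X mt) (he : e ∈ I.edges) : voteB (I.edgesOf X) e =
    if I.num e ∈ X then 0 else
      if I.net.P true (I.num e) < I.net.P true (mt true (I.net.V true (I.num e)))
        then 1 else -1 := by
  have h₁ : (e.1, e.2) ∈ I.edgesOf X ↔ I.num e ∈ X := by rw [mem_edgesOf, and_iff_right he]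
  have h₂ := (forall_ltB_iff h.lt he).trans (h.forall_iff I.net_good (num_lt he))
  simp only [ltB] at h₂
  simp only [voteB, vote, h₁, h₂]

theorem voteA_le (e : Fin I.nA × Fin I.nB) (M : Finset (Fin I.nA × Fin I.nB)) : voteA M e ≤ 1 := by
  rw [voteA, vote]
  split_ifs <;> simp

theorem voteB_le (e : Fin I.nA × Fin I.nB) (M : Finset (Fin I.nA × Fin I.nB)) : voteB M e ≤ 1 := by
  rw [voteB, vote]
  split_ifs <;> simp

theorem Net.Blocking.notMem {D : Net} (h : D.Matched X mt) {i : ℕ} (hi : D.Blocking mt i) :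
    i ∉ X := fun hX => by
  have := hi false
  rw [h.eq_of_mem hX] at this
  exact lt_irrefl _ this

theorem votes_of_blocking (h : I.net.Matched X mt) (he : e ∈ I.edges)
    (hb : I.net.Blocking mt (I.num e)) :
    voteA (I.edgesOf X) e = 1 ∧ voteB (I.edgesOf X) e = 1 := by
  have hX := Net.Blocking.notMem h hb
  rw [voteA_edgesOf h he, voteB_edgesOf h he, if_neg hX, if_neg hX, if_pos (hb false),
    if_pos (hb true)]
  exact ⟨rfl, rfl⟩

theorem votes_of_acceptable (h : I.net.Matched X mt) (he : e ∈ I.edges)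
    (ha : I.net.Acceptable mt (I.num e)) :
    0 ≤ voteA (I.edgesOf X) e + voteB (I.edgesOf X) e := by
  rw [voteA_edgesOf h he, voteB_edgesOf h he]
  by_cases hX : I.num e ∈ X
  · simp [hX]
  · obtain ⟨_ | _, hd⟩ := ha <;> rw [← h.lt_iff_le I.net_good (num_lt he) hX] at hd
    · rw [if_neg hX, if_pos hd, if_neg hX]
      split_ifs <;> simp
    · rw [if_neg hX, if_neg hX, if_pos hd]
      split_ifs <;> simp

/-- The vertices of value `1` in a witness form closed sets, so the least closed sets pass. -/
theorem passes_of_isPopular (h : I.net.Matched X mt) (hpop : I.IsPopular (I.edgesOf X))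
    (hu : ∀ d C, I.net.Closed X mt d C → ∀ i < I.net.m, u d (I.net.V d i) ≠ 0 → C (I.net.V d i)) :
    I.net.Passes X mt u := by
  obtain ⟨α, β, hw⟩ := hpop.exists_isWitness
  -- The values of partners add up to `0`, so the lower bound `-1` gives the upper bound `1`, which
  -- both endpoints of a blocking edge attain.
  have hα : ∀ a, α a ≤ 1 := fun a => by
    by_cases ha : ∃ b, (a, b) ∈ I.edgesOf X
    · obtain ⟨b, hb⟩ := ha
      have h₁ := hw.mem _ hb
      have h₂ := hw.lowB b
      simp only at h₁
      omega
    · push Not at ha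
      rw [hw.unmatchedA a ha]; simp
  have hβ : ∀ b, β b ≤ 1 := fun b => by
    by_cases hb : ∃ a, (a, b) ∈ I.edgesOf X
    · obtain ⟨a, ha⟩ := hb
      have h₁ := hw.mem _ ha
      have h₂ := hw.lowA a
      simp only at h₁
      omega
    · push Not at hb
      rw [hw.unmatchedB b hb]; simp
  have hA : I.net.Closed X mt false fun v => ∀ a : Fin I.nA, a = v → α a = 1 := by
    refine ⟨fun i hi hb a ha => ?_, fun x hx hV i hi hVi hacc a ha => ?_⟩
    · obtain ⟨e, he, rfl⟩ := exists_num hi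
      have h₁ := votes_of_blocking h he hb
      rw [net_V_false he, Fin.val_inj] at ha
      have h₂ := hw.edge e he
      have h₃ := hα e.1
      have h₄ := hβ e.2
      subst ha
      omega
    · obtain ⟨e, he, rfl⟩ := exists_num hi
      obtain ⟨f, hf, rfl⟩ := exists_edge h.lt hx
      have hf' := (mem_edgesOf.1 hf).1
      have h₀ := hV f.1 (net_V_false hf').symm
      rw [Bool.not_false, net_V_true he, net_V_true hf', Fin.val_inj] at hVi
      rw [net_V_false he, Fin.val_inj] at ha
      have h₁ := votes_of_acceptable h he hacc
      have h₂ := hw.edge e he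
      have h₃ := hw.mem f hf
      have h₄ := hα a
      subst ha
      rw [hVi] at h₂
      omega
  have hB : I.net.Closed X mt true fun v => ∀ b : Fin I.nB, b = v → β b = 1 := by
    refine ⟨fun i hi hb b hb' => ?_, fun x hx hV i hi hVi hacc b hb' => ?_⟩
    · obtain ⟨e, he, rfl⟩ := exists_num hi
      have h₁ := votes_of_blocking h he hb
      rw [net_V_true he, Fin.val_inj] at hb'
      have h₂ := hw.edge e he
      have h₃ := hα e.1
      have h₄ := hβ e.2
      subst hb'
      omega
    · obtain ⟨e, he, rfl⟩ := exists_num hi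
      obtain ⟨f, hf, rfl⟩ := exists_edge h.lt hx
      have hf' := (mem_edgesOf.1 hf).1
      have h₀ := hV f.2 (net_V_true hf').symm
      rw [Bool.not_true, net_V_false he, net_V_false hf', Fin.val_inj] at hVi
      rw [net_V_true he, Fin.val_inj] at hb'
      have h₁ := votes_of_acceptable h he hacc
      have h₂ := hw.edge e he
      have h₃ := hw.mem f hf
      have h₄ := hβ b
      subst hb'
      rw [hVi] at h₂
      omega
  have hm : ∀ d, ∀ i < I.net.m, (∃ x ∈ X, I.net.V d x = I.net.V d i) →
      mt d (I.net.V d i) < I.net.m := fun d i hi ⟨x, hx, hV⟩ => by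
    rw [← hV, h.eq_of_mem hx]
    exact h.lt x hx
  refine ⟨?_, fun x hx hc => ?_⟩
  · rintro (_ | _) i hi hne <;> refine hm _ i hi ?_ <;> obtain ⟨e, he, rfl⟩ := exists_num hi
    · have h₁ := hu _ _ hA _ hi hne e.1 (net_V_false he).symm
      by_contra hc
      rw [hw.unmatchedA] at h₁
      · simp at h₁
      · intro b hb
        have hb' := mem_edgesOf.1 hb
        exact hc ⟨_, hb'.2, by rw [net_V_false hb'.1, net_V_false he]⟩
    · have h₁ := hu _ _ hB _ hi hne e.2 (net_V_true he).symm
      by_contra hc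
      rw [hw.unmatchedB] at h₁
      · simp at h₁
      · intro a ha
        have ha' := mem_edgesOf.1 ha
        exact hc ⟨_, ha'.2, by rw [net_V_true ha'.1, net_V_true he]⟩
  · obtain ⟨f, hf, rfl⟩ := exists_edge h.lt hx
    have hf' := (mem_edgesOf.1 hf).1
    have h₁ := hu _ _ hA _ (num_lt hf') hc.1 f.1 (net_V_false hf').symm
    have h₂ := hu _ _ hB _ (num_lt hf') hc.2 f.2 (net_V_true hf').symm
    have h₃ := hw.mem f hf
    omega

open Classical in
/-- If closed sets pass, then value `1` for their members and `-1` for the partners of their members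
is a witness. -/
theorem isPopular_of_passes (h : I.net.Matched X mt)
    (hu : ∀ d, I.net.Closed X mt d fun v => u d v ≠ 0) (hp : I.net.Passes X mt u) :
    I.IsPopular (I.edgesOf X) := by
  set M := I.edgesOf X with hM
  have hmat : I.IsMatching M := isMatching_edgesOf h.inj
  let UA : Fin I.nA → Prop := fun a => (∃ b, (a, b) ∈ I.edges) ∧ u false a ≠ 0
  let UB : Fin I.nB → Prop := fun b => (∃ a, (a, b) ∈ I.edges) ∧ u true b ≠ 0
  have hUA : ∀ a, UA a → ∃ b, (a, b) ∈ M := by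
    rintro a ⟨⟨b, hb⟩, hne⟩
    have h₁ := hp.1 false _ (num_lt hb) (by rwa [net_V_false hb])
    rcases h.isPartner false _ (num_lt hb) with h' | h'
    · omega
    · obtain ⟨f, hf, hf'⟩ := exists_edge h.lt h'.1
      have h₂ := h'.2
      rw [← hf', net_V_false (mem_edgesOf.1 hf).1, net_V_false hb, Fin.val_inj] at h₂
      exact ⟨f.2, by rw [show a = f.1 from h₂.symm]; exact hf⟩
  have hUB : ∀ b, UB b → ∃ a, (a, b) ∈ M := by
    rintro b ⟨⟨a, ha⟩, hne⟩
    have h₁ := hp.1 true _ (num_lt ha) (by rwa [net_V_true ha])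
    rcases h.isPartner true _ (num_lt ha) with h' | h'
    · omega
    · obtain ⟨f, hf, hf'⟩ := exists_edge h.lt h'.1
      have h₂ := h'.2
      rw [← hf', net_V_true (mem_edgesOf.1 hf).1, net_V_true ha, Fin.val_inj] at h₂
      exact ⟨f.1, by rw [show b = f.2 from h₂.symm]; exact hf⟩
  have hboth : ∀ a b, (a, b) ∈ M → UA a → UB b → False := by
    intro a b hab hA hB
    have hab' := mem_edgesOf.1 hab
    refine hp.2 _ hab'.2 ⟨?_, ?_⟩
    · rw [net_V_false hab'.1]; exact hA.2
    · rw [net_V_true hab'.1]; exact hB.2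
  let α : Fin I.nA → ℤ := fun a => if UA a then 1 else if ∃ b, (a, b) ∈ M ∧ UB b then -1 else 0
  let β : Fin I.nB → ℤ := fun b => if UB b then 1 else if ∃ a, (a, b) ∈ M ∧ UA a then -1 else 0
  have hα : ∀ a, -1 ≤ α a := fun a => by simp only [α]; split_ifs <;> simp
  have hβ : ∀ b, -1 ≤ β b := fun b => by simp only [β]; split_ifs <;> simp
  have hmem : ∀ e ∈ M, α e.1 + β e.2 = 0 := by
    rintro ⟨a, b⟩ he
    have h₁ : (∃ b', (a, b') ∈ M ∧ UB b') ↔ UB b :=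
      ⟨fun ⟨b', hb', h'⟩ => hmat.fst_inj hb' he ▸ h', fun h' => ⟨b, he, h'⟩⟩
    have h₂ : (∃ a', (a', b) ∈ M ∧ UA a') ↔ UA a :=
      ⟨fun ⟨a', ha', h'⟩ => hmat.snd_inj ha' he ▸ h', fun h' => ⟨a, he, h'⟩⟩
    have h₃ := hboth a b he
    simp only [α, β, h₁, h₂]
    by_cases hA : UA a
    · rw [if_pos hA, if_neg (h₃ hA), if_pos hA]; rfl
    · rw [if_neg hA]
      by_cases hB : UB b
      · rw [if_pos hB, if_pos hB]; rfl
      · rw [if_neg hB, if_neg hB, if_neg hA]; rfl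
  refine IsWitness.isPopular (α := α) (β := β) hmat ⟨fun e he => ?_, hmem, fun a ha => ?_,
    fun b hb => ?_, hα, hβ⟩
  · have hA1 : UA e.1 → α e.1 = 1 := fun h' => if_pos h'
    have hB1 : UB e.2 → β e.2 = 1 := fun h' => if_pos h'
    by_cases hb : I.net.Blocking mt (I.num e)
    · rw [hA1 ⟨⟨e.2, he⟩, ?_⟩, hB1 ⟨⟨e.1, he⟩, ?_⟩]
      · linarith [voteA_le e M, voteB_le e M]
      · have := (hu true).blocking _ (num_lt he) hb
        rwa [net_V_true he] at this
      · have := (hu false).blocking _ (num_lt he) hb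
        rwa [net_V_false he] at this
    by_cases hX : I.num e ∈ X
    · have he' : e ∈ M := mem_edgesOf.2 ⟨he, hX⟩
      rw [voteA_of_mem he', voteB_of_mem he', hmem e he']
      simp
    by_cases hacc : I.net.Acceptable mt (I.num e)
    · have h₁ : voteA M e + voteB M e ≤ 0 := by
        rw [voteA_edgesOf h he, voteB_edgesOf h he, if_neg hX, if_neg hX]
        rw [Net.Blocking, Bool.forall_bool] at hb
        by_cases hA : I.net.P false (I.num e) < I.net.P false (mt false (I.net.V false (I.num e)))
        · rw [if_pos hA, if_neg fun hB => hb ⟨hA, hB⟩]; simp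
        · rw [if_neg hA]
          split_ifs <;> simp
      refine h₁.trans ?_
      by_cases hA : ∃ b, (e.1, b) ∈ M ∧ UB b
      · obtain ⟨b, hb, hUb⟩ := hA
        have hb' := mem_edgesOf.1 hb
        have h₂ := (hu true).step _ hb'.2 (by rw [net_V_true hb'.1]; exact hUb.2) _ (num_lt he)
          (by rw [Bool.not_true, net_V_false he, net_V_false hb'.1]) hacc
        rw [hB1 ⟨⟨e.1, he⟩, by rwa [net_V_true he] at h₂⟩]
        linarith [hα e.1]
      by_cases hB : ∃ a, (a, e.2) ∈ M ∧ UA a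
      · obtain ⟨a, ha, hUa⟩ := hB
        have ha' := mem_edgesOf.1 ha
        have h₂ := (hu false).step _ ha'.2 (by rw [net_V_false ha'.1]; exact hUa.2) _ (num_lt he)
          (by rw [Bool.not_false, net_V_true he, net_V_true ha'.1]) hacc
        rw [hA1 ⟨⟨e.2, he⟩, by rwa [net_V_false he] at h₂⟩]
        linarith [hβ e.2]
      simp only [α, β, if_neg hA, if_neg hB]
      split_ifs <;> simp
    · have h₁ : voteA M e + voteB M e ≤ -2 := by
        rw [voteA_edgesOf h he, voteB_edgesOf h he, if_neg hX, if_neg hX]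
        rw [Net.Acceptable, Bool.exists_bool, not_or] at hacc
        rw [if_neg fun hc => hacc.1 hc.le, if_neg fun hc => hacc.2 hc.le]
        simp
      linarith [hα e.1, hβ e.2]
  · simp only [α]
    rw [if_neg fun h' => (hUA a h').elim ha, if_neg fun ⟨b, hb, _⟩ => ha b hb]
  · simp only [β]
    rw [if_neg fun h' => (hUB b h').elim hb, if_neg fun ⟨a, ha, _⟩ => hb a ha]

end MUPM

/-! ### The program: deferred acceptance -/

namespace RAM

theorem Run.cond {W : ℕ} {e : Expr} {p q : Cmd} {s : State} {B B' : ℕ} {Q : State → Prop}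
    (hp : e.eval s ≠ 0 → Run W p s B Q) (hq : e.eval s = 0 → Run W q s B' Q) :
    Run W (.cond e p q) s (e.cost + 1 + (B + B')) Q := by
  by_cases he : e.eval s = 0
  · obtain ⟨s', T, h₁, h₂, h₃⟩ := hq he
    exact ⟨s', _, .condFalse he h₁, by omega, h₃⟩
  · obtain ⟨s', T, h₁, h₂, h₃⟩ := hp he
    exact ⟨s', _, .condTrue he h₁, by omega, h₃⟩

end RAM

namespace MUPM

open RAM

variable {I : MUPM} {s s' : State}

/-- The state contains the instance and the additional tables of the preprocessing: the missing edge
`|E|` has position `|E|` on every list (arrays 2 and 3), and array 11 holds the lists of the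
vertices of `A`. The program uses the following further memory. Registers: 6 number of digits,
8 counter of `Cmd.forEdges`, 9 and 10 current proposal and next edge to look at, 11 auxiliary edge,
12 utility, 13 cost, 14 popularity, 15 to 17 heads and tails of the queues, 18 carry. Arrays: 20 and
21 partner edges, 22 and 23 marked vertices, 24 and 25 queues, 26 the set `S`, 27 digits. -/
structure Loaded (I : MUPM) (s : State) : Prop where
  var3 : s.var 3 = I.net.m
  var4 : s.var 4 = I.t
  var5 : s.var 5 = I.k
  arr0 : s.arr 0 = I.net.V false
  arr1 : s.arr 1 = I.net.V true
  arr2 : s.arr 2 = I.net.P false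
  arr3 : s.arr 3 = I.net.P true
  arr4 : s.arr 4 = I.initArr 4
  arr5 : s.arr 5 = I.initArr 5
  arr6 : s.arr 6 = I.net.st false
  arr8 : s.arr 8 = I.net.st true
  arr10 : s.arr 10 = I.net.L true
  arr11 : s.arr 11 = I.net.L false

/-- The program `p` does not change what `Loaded` is about. -/
def Preserving (p : Cmd) : Prop :=
  (∀ x ∈ [3, 4, 5], x ∉ p.vars) ∧ ∀ a ∈ [0, 1, 2, 3, 4, 5, 6, 8, 10, 11], a ∉ p.arrs

instance (p : Cmd) : Decidable (Preserving p) := by unfold Preserving; infer_instance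

theorem Loaded.of_frame {p : Cmd} (h : I.Loaded s) (hf : Frame p s s') (hp : Preserving p) :
    I.Loaded s' where
  var3 := (hf.1 3 (hp.1 3 (by decide))).trans h.var3
  var4 := (hf.1 4 (hp.1 4 (by decide))).trans h.var4
  var5 := (hf.1 5 (hp.1 5 (by decide))).trans h.var5
  arr0 := (hf.2 0 (hp.2 0 (by decide))).trans h.arr0
  arr1 := (hf.2 1 (hp.2 1 (by decide))).trans h.arr1
  arr2 := (hf.2 2 (hp.2 2 (by decide))).trans h.arr2
  arr3 := (hf.2 3 (hp.2 3 (by decide))).trans h.arr3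
  arr4 := (hf.2 4 (hp.2 4 (by decide))).trans h.arr4
  arr5 := (hf.2 5 (hp.2 5 (by decide))).trans h.arr5
  arr6 := (hf.2 6 (hp.2 6 (by decide))).trans h.arr6
  arr8 := (hf.2 8 (hp.2 8 (by decide))).trans h.arr8
  arr10 := (hf.2 10 (hp.2 10 (by decide))).trans h.arr10
  arr11 := (hf.2 11 (hp.2 11 (by decide))).trans h.arr11

/-- The bound for the machine words. -/
abbrev word (I : MUPM) : ℕ := I.magnitude

theorem m_add_two_le_word (I : MUPM) : I.net.m + 2 ≤ I.word := by
  rw [net_m, word, magnitude]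
  omega

theorem V_lt_word (d : Bool) {i : ℕ} (hi : i < I.net.m) : I.net.V d i < I.word := by
  obtain ⟨e, he, rfl⟩ := exists_num hi
  rw [word, magnitude]
  cases d
  · rw [net_V_false he]
    have := e.1.2
    omega
  · rw [net_V_true he]
    have := e.2.2
    omega

/-- Make every endpoint of an edge unmatched and unmarked. -/
def clearCmd : Cmd := Cmd.forEdges <|
  .seq (.put 20 (.get 0 (.var 8)) (.var 3)) <|
  .seq (.put 21 (.get 1 (.var 8)) (.var 3)) <|
  .seq (.put 22 (.get 0 (.var 8)) (.const 0)) <|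
  .put 23 (.get 1 (.var 8)) (.const 0)

theorem run_clearCmd (h : I.Loaded s) :
    Run I.word clearCmd s (2 + (I.net.m * (8 + 16) + 4)) fun s' =>
      ∀ j < I.net.m, s'.arr 20 (I.net.V false j) = I.net.m ∧ s'.arr 21 (I.net.V true j) = I.net.m ∧
        s'.arr 22 (I.net.V false j) = 0 ∧ s'.arr 23 (I.net.V true j) = 0 := by
  have hW := m_add_two_le_word I
  refine Run.forEdges (B := 16) (fun i s' => ∀ j < i, s'.arr 20 (I.net.V false j) = I.net.m ∧
    s'.arr 21 (I.net.V true j) = I.net.m ∧ s'.arr 22 (I.net.V false j) = 0 ∧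
    s'.arr 23 (I.net.V true j) = 0) h.var3 (by omega) (by decide) (by decide) (by simp)
    fun i hi s' hf h8 hI => ?_
  have hL := h.of_frame hf (by decide)
  have h₁ := V_lt_word false hi
  have h₂ := V_lt_word true hi
  refine Run.mono (Run.of_wp (Q := fun s'' => ∀ j < i + 1, _) ?_) (by decide) fun _ hh => hh
  simp [wp, Expr.eval, h8, hL.var3, hL.arr0, hL.arr1, h₁, h₂]
  grind

/-- Set register 9 to the next edge after `x` on the list of the endpoint of `x` in `A`. -/
def nextCmd (x : Expr) : Cmd :=
  .cond (.get 2 (.add x (.const 1))) (.assign 9 (.add x (.const 1))) (.assign 9 (.var 3))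

/-- The proposal of the edge in register 9. -/
def proposeCmd : Cmd :=
  .cond (.add (.get 26 (.var 9)) (.lt (.get 3 (.get 21 (.get 1 (.var 9)))) (.get 3 (.var 9))))
    (nextCmd (.var 9)) <|
  .seq (.assign 11 (.get 21 (.get 1 (.var 9)))) <|
  .seq (.put 21 (.get 1 (.var 9)) (.var 9)) <|
  .cond (.lt (.var 11) (.var 3)) (nextCmd (.var 11)) (.assign 9 (.var 3))

/-- Look at the edge in register 10; a vertex of `A` starts to propose at its first edge. -/
def startCmd : Cmd :=
  .seq (.cond (.get 2 (.var 10)) .nop (.assign 9 (.var 10)))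
    (.assign 10 (.add (.var 10) (.const 1)))

/-- Deferred acceptance without the edges that are marked in array 26. -/
def acceptanceCmd : Cmd :=
  .seq (.seq (.assign 10 (.const 0)) (.assign 9 (.var 3))) <|
  .loop (.add (.lt (.var 10) (.var 3)) (.lt (.var 9) (.var 3))) <|
  .cond (.lt (.var 9) (.var 3)) proposeCmd startCmd

theorem run_acceptanceCmd (h : I.Loaded s)
    (hmB : ∀ j < I.net.m, s.arr 21 (I.net.V true j) = I.net.m) :
    Run I.word acceptanceCmd s (360 * (I.net.m + 1)) fun s' =>
      I.net.Stable (s.arr 26) (I.net.held (s'.arr 21)) ∧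
      ∀ j < I.net.m, s'.arr 21 (I.net.V true j) = I.net.m ∨ (s'.arr 21 (I.net.V true j) < I.net.m ∧
        I.net.V true (s'.arr 21 (I.net.V true j)) = I.net.V true j) := by
  have hW := m_add_two_le_word I
  have hD := I.net_good
  set m := I.net.m with hm
  let Inv : ℕ → State → Prop := fun n s' => ∃ R,
    I.net.ProposalInv (s.arr 26) (s'.var 10) (s'.var 9) (s'.arr 21) R ∧
    I.net.proposalFuel (s'.var 10) (s'.var 9) R = n
  have h₁ : Run I.word (.seq (.assign 10 (.const 0)) (.assign 9 (.var 3))) s 4 fun s' =>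
      Inv (4 * m) s' ∧ I.Loaded s' ∧ s'.arr 26 = s.arr 26 := by
    refine Run.mono (Run.of_wp (Q := fun s' => Inv (4 * m) s') ?_).frame (by decide)
      fun s' hs' => ⟨hs'.1, h.of_frame hs'.2 (by decide), hs'.2.2 26 (by decide)⟩
    simp only [wp, Expr.eval, State.setVar_var, h.var3, Inv, State.setVar_arr]
    refine ⟨by omega, by simp; omega, ∅, by simpa using .init hmB, ?_⟩
    simp [Net.proposalFuel]
    omega
  refine Run.mono (Run.seq h₁ (B' := 4 * m * (7 + 1 + 70) + (7 + 1)) fun s₁ ⟨hI₁, hL₁, h26⟩ =>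
    Run.mono (Run.loop (B := 70) Inv ?_ _ hI₁).frame le_rfl ?_) (by omega) fun _ hh => hh
  · rintro n s' hf ⟨R, hI, rfl⟩ he
    have hL := hL₁.of_frame hf (by decide)
    have h26' : s'.arr 26 = s.arr 26 := (hf.2 26 (by decide)).trans h26
    have hcur := hI.cur_le
    have hstart := hI.start_le
    refine Run.mono (Run.of_wp (Q := fun s'' => ∃ n' < _, Inv n' s'') ?_) (by decide) fun _ hh => hh
    simp only [wp, Expr.eval, hL.var3, proposeCmd, startCmd, nextCmd, State.setVar_var,
      State.setVar_arr, State.setArr_var, State.setArr_arr, h26', hL.arr1, hL.arr2, hL.arr3, Inv]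
    simp
    refine ⟨fun hc => ⟨fun hrej => ?_, fun hS hacc => ?_⟩, fun hc => ?_⟩
    · have H := hI.reject hD hc (by tauto)
      simp only [Net.next] at H
      refine ⟨fun hp => ⟨by omega, insert (s'.var 9) R, ?_⟩,
        fun hp => ⟨by omega, insert (s'.var 9) R, ?_⟩⟩
      · rw [if_neg hp] at H
        exact H.symm
      · rw [if_pos hp] at H
        exact H.symm
    · obtain ⟨R', H⟩ := hI.accept hD hc hS (not_lt.2 hacc)
      have hw := V_lt_word true hc
      have hf : s'.arr 21 (I.net.V true (s'.var 9)) < I.word := by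
        rcases hI.held _ hc with h' | h' <;> omega
      refine ⟨hf, hw, by omega, fun hlt => ?_, fun hge => ⟨by omega, R', ?_⟩⟩
      · simp only [if_pos hlt, Net.next] at H
        refine ⟨fun hp => ⟨by omega, R', ?_⟩, fun hp => ⟨by omega, R', ?_⟩⟩
        · rw [if_neg hp] at H
          exact H.symm
        · rw [if_pos hp] at H
          exact H.symm
      · rw [if_neg (not_lt.2 hge)] at H
        exact H.symm
    · have hcm : s'.var 9 = I.net.m := le_antisymm hcur hc
      have hlt : s'.var 10 < I.net.m := by
        by_contra hn
        simp [Expr.eval, hL.var3, hcm, hn] at he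
      have H := Net.ProposalInv.start (hcm ▸ hI) hlt
      rw [hcm]
      refine ⟨fun hp => ⟨by omega, R, ?_⟩, fun hp => ⟨by omega, by omega, R, ?_⟩⟩
      · rw [if_neg hp] at H
        exact H.symm
      · rw [if_pos hp] at H
        exact H.symm
  · rintro s' ⟨⟨⟨n, R, hI, _⟩, he⟩, hf⟩
    have hL := hL₁.of_frame hf (by decide)
    have hcur := hI.cur_le
    have hstart := hI.start_le
    simp only [Expr.eval, hL.var3] at he
    have h9 : s'.var 9 = m := by
      by_contra hn
      simp [show s'.var 9 < I.net.m by omega] at he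
    have h10 : s'.var 10 = m := by
      by_contra hn
      simp [show s'.var 10 < I.net.m by omega] at he
    rw [h9, h10] at hI
    exact ⟨hI.stable hD, hI.held⟩

end MUPM

/-! ### The program: the test of popularity -/

namespace MUPM

open RAM

variable {I : MUPM} {s s' : State} {X : Finset ℕ} {mt : Bool → ℕ → ℕ}

/-- The array of the endpoints of the edges on side `d`. -/
def vArr (d : Bool) : ℕ := bif d then 1 else 0
/-- The array of the positions of the edges on the lists of side `d`. -/
def pArr (d : Bool) : ℕ := bif d then 3 else 2
/-- The array of the places where the lists of side `d` start. -/
def stArr (d : Bool) : ℕ := bif d then 8 else 6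
/-- The array of the lists of side `d`. -/
def listArr (d : Bool) : ℕ := bif d then 10 else 11
/-- The array of the partner edges of the vertices of side `d`. -/
def mtArr (d : Bool) : ℕ := bif d then 21 else 20
/-- The array of the marks of the vertices of side `d`. -/
def markArr (d : Bool) : ℕ := bif d then 23 else 22
/-- The queue of the search for the marks on side `d`. -/
def queueArr (d : Bool) : ℕ := bif d then 25 else 24
/-- The register with the length of this queue. -/
def tailVar (d : Bool) : ℕ := bif d then 17 else 16

/-- The state contains the instance and the partner edges `mt`. -/
structure Ready (I : MUPM) (mt : Bool → ℕ → ℕ) (s : State) : Prop where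
  loaded : I.Loaded s
  arr20 : s.arr 20 = mt false
  arr21 : s.arr 21 = mt true

/-- The program `p` does not change what `Ready` is about. -/
def PreservingReady (p : Cmd) : Prop := Preserving p ∧ 20 ∉ p.arrs ∧ 21 ∉ p.arrs

instance (p : Cmd) : Decidable (PreservingReady p) := by unfold PreservingReady; infer_instance

theorem Ready.of_frame {p : Cmd} (h : I.Ready mt s) (hf : Frame p s s')
    (hp : PreservingReady p) : I.Ready mt s' where
  loaded := h.loaded.of_frame hf hp.1
  arr20 := (hf.2 20 hp.2.1).trans h.arr20
  arr21 := (hf.2 21 hp.2.2).trans h.arr21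

/-- Mark the endpoint on side `d` of the edge in register `r`, and enqueue the list of its
partner. -/
def markCmd (d : Bool) (r : ℕ) : Cmd :=
  .cond (.get (markArr d) (.get (vArr d) (.var r))) .nop <|
  .seq (.put (markArr d) (.get (vArr d) (.var r)) (.const 1)) <|
  .cond (.lt (.get (mtArr d) (.get (vArr d) (.var r))) (.var 3))
    (.seq (.put (queueArr d) (.var (tailVar d))
        (.get (stArr !d) (.get (vArr !d) (.get (mtArr d) (.get (vArr d) (.var r))))))
      (.assign (tailVar d) (.add (.var (tailVar d)) (.const 1))))
    .nop

/-- The invariant of the search on side `d` holds in the state `s`. -/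
def Searching (I : MUPM) (X : Finset ℕ) (mt : Bool → ℕ → ℕ) (d : Bool) (h : ℕ) (s : State) : Prop :=
  I.net.SearchInv X mt d (s.arr (markArr d)) (s.arr (queueArr d)) h (s.var (tailVar d))

theorem run_markCmd (d : Bool) {r i h : ℕ} (hs : I.Ready mt s) (hX : I.net.Matched X mt)
    (hr : s.var r = i) (hi : i < I.net.m) (hI : I.Searching X mt d h s)
    (hC : ∀ C, I.net.Closed X mt d C → C (I.net.V d i)) :
    Run I.word (markCmd d r) s 50 fun s' => I.Searching X mt d h s' ∧
      s'.arr (markArr d) (I.net.V d i) ≠ 0 ∧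
      (∀ v, s.arr (markArr d) v ≠ 0 → s'.arr (markArr d) v ≠ 0) ∧
      ∀ j < s.var (tailVar d), s'.arr (queueArr d) j = s.arr (queueArr d) j := by
  have hW := m_add_two_le_word I
  have hD := I.net_good
  have hV := V_lt_word d hi
  have ht := hI.tail_le
  have hstart : mt d (I.net.V d i) < I.net.m →
      I.net.st (!d) (I.net.V (!d) (mt d (I.net.V d i))) < I.net.m :=
    fun hlt => (hD.start_spec (!d) hlt).1
  have hL := hs.loaded
  refine Run.mono (Run.of_wp (Q := fun s' => I.Searching X mt d h s' ∧ _) ?_)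
    (by cases d <;> exact Nat.le_of_ble_eq_true rfl) fun _ hh => hh
  have hun := hI.mark_unmatched hX.isPartner hi hC
  have hma := fun hlt => hI.mark_matched hD hX.isPartner hi hC hlt hX.lt hX.inj
  cases d <;>
  · simp [wp, Expr.eval, markCmd, markArr, vArr, mtArr, queueArr, stArr, tailVar, Searching, hr,
      hL.arr0, hL.arr1, hL.arr6, hL.arr8, hs.arr20, hs.arr21, hL.var3] at *
    refine ⟨fun hne => ⟨hI, hne⟩, fun h0 => ⟨hV, by omega, fun hlt => ?_, fun hge => ?_⟩⟩
    · have H := hma hlt h0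
      have h₁ := hstart hlt
      have h₂ := H.tail_le
      refine ⟨by omega, by omega, by omega, H, ?_, ?_⟩
      · grind
      · grind
    · refine ⟨hun hge hX.lt, ?_⟩
      grind

/-- The endpoint on side `d` of the edge in register `r` does not vote against this edge. An
unmatched endpoint never does, because the missing edge `m` has position `m`. -/
def weakExpr (d : Bool) (r : ℕ) : Expr :=
  .lt (.get (pArr d) (.var r))
    (.add (.get (pArr d) (.get (mtArr d) (.get (vArr d) (.var r)))) (.const 1))

/-- Take the next position from the queue, and enqueue its successor on the same list. The edge at
this position is put into register 11. -/
def popCmd (d : Bool) : Cmd :=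
  .seq (.assign 9 (.get (queueArr d) (.var 15))) <|
  .seq (.assign 15 (.add (.var 15) (.const 1))) <|
  .seq (.cond (.lt (.add (.var 9) (.const 1)) (.var 3))
      (.cond (.get (pArr !d) (.get (listArr !d) (.add (.var 9) (.const 1))))
        (.seq (.put (queueArr d) (.var (tailVar d)) (.add (.var 9) (.const 1)))
          (.assign (tailVar d) (.add (.var (tailVar d)) (.const 1)))) .nop) .nop) <|
  .assign 11 (.get (listArr !d) (.var 9))

theorem run_popCmd (d : Bool) {h : ℕ} (hs : I.Ready mt s) (hX : I.net.Matched X mt)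
    (h15 : s.var 15 = h) (hlt : h < s.var (tailVar d)) (hI : I.Searching X mt d h s) :
    Run I.word (popCmd d) s 50 fun s' => I.Searching X mt d (h + 1) s' ∧ s'.var 15 = h + 1 ∧
      s'.var 11 = I.net.L (!d) (s.arr (queueArr d) h) ∧ h < s'.var (tailVar d) ∧
      (∀ j < s.var (tailVar d), s'.arr (queueArr d) j = s.arr (queueArr d) j) ∧
      s'.arr (markArr d) = s.arr (markArr d) := by
  have hW := m_add_two_le_word I
  have hD := I.net_good
  have ht := hI.tail_le
  have hQ := hI.lt h hlt
  have hLlt := hD.L_lt (!d) _ hQ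
  have hL := hs.loaded
  refine Run.mono (Run.of_wp (Q := fun s' => I.Searching X mt d (h + 1) s' ∧ _) ?_)
    (by cases d <;> decide) fun _ hh => hh
  have hlast := hI.pop_last hlt
  have hsucc := fun hm hP => hI.pop_succ hD hlt hm hP hX.lt
  cases d <;>
  · simp [wp, Expr.eval, popCmd, markArr, pArr, listArr, queueArr, tailVar, Searching, h15,
      hL.arr2, hL.arr3, hL.arr10, hL.arr11, hL.var3] at *
    refine ⟨by omega, by omega, fun hm => ⟨fun hP => ?_, fun hP => ?_⟩, fun hm => ?_⟩
    · have H := hsucc hm hP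
      have h₂ := H.tail_le
      refine ⟨by omega, by omega, by omega, by omega, H, by omega, ?_⟩
      grind
    · exact ⟨by omega, hlast fun _ => hP, hlt⟩
    · exact ⟨by omega, hlast fun hc => absurd hc (by omega), hlt⟩

/-- The search for the least closed set of vertices of side `d`. -/
def searchCmd (d : Bool) : Cmd :=
  .seq (.assign 15 (.const 0)) <|
  .loop (.lt (.var 15) (.var (tailVar d))) <|
  .seq (popCmd d) (.cond (.add (weakExpr false 11) (weakExpr true 11)) (markCmd d 11) .nop)

theorem eval_acceptable {r i : ℕ} (hs : I.Ready mt s) (hr : s.var r = i) :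
    Expr.eval s (.add (weakExpr false r) (weakExpr true r)) ≠ 0 ↔ I.net.Acceptable mt i := by
  simp [weakExpr, Expr.eval, pArr, mtArr, vArr, hr, hs.arr20, hs.arr21, hs.loaded.arr0,
    hs.loaded.arr1, hs.loaded.arr2, hs.loaded.arr3, Net.Acceptable]
  rw [← not_le, ← or_iff_not_imp_left]

theorem run_searchCmd (d : Bool) (hs : I.Ready mt s) (hX : I.net.Matched X mt)
    (hI : I.Searching X mt d 0 s)
    (hb : ∀ i < I.net.m, I.net.Blocking mt i → s.arr (markArr d) (I.net.V d i) ≠ 0) :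
    Run I.word (searchCmd d) s (160 * (I.net.m + 1)) fun s' =>
      (I.net.Closed X mt d fun v => s'.arr (markArr d) v ≠ 0) ∧
      ∀ C, I.net.Closed X mt d C → ∀ i < I.net.m, s'.arr (markArr d) (I.net.V d i) ≠ 0 →
        C (I.net.V d i) := by
  have hW := m_add_two_le_word I
  have hD := I.net_good
  let Inv : ℕ → State → Prop := fun n s' => ∃ h, s'.var 15 = h ∧ h + n = I.net.m ∧
    I.Searching X mt d h s' ∧
    (∀ i < I.net.m, I.net.Blocking mt i → s'.arr (markArr d) (I.net.V d i) ≠ 0) ∧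
    ∀ i < h, I.net.Acceptable mt (I.net.L (!d) (s'.arr (queueArr d) i)) →
      s'.arr (markArr d) (I.net.V d (I.net.L (!d) (s'.arr (queueArr d) i))) ≠ 0
  have h₁ : Run I.word (.assign 15 (.const 0)) s 2 fun s' => Inv I.net.m s' ∧ I.Ready mt s' := by
    refine Run.mono (Run.of_wp (Q := fun s' => Inv I.net.m s') ?_).frame (by decide)
      fun s' hs' => ⟨hs'.1, hs.of_frame hs'.2 (by decide)⟩
    simp only [wp, Expr.eval, Inv]
    refine ⟨by omega, 0, by simp, by simp, ?_, hb, by simp⟩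
    cases d <;> simpa [Searching, tailVar] using hI
  refine Run.mono (Run.seq h₁ (B' := I.net.m * (4 + 130) + 4) fun s₁ ⟨hI₁, hs₁⟩ =>
    Run.mono (Run.loop (B := 130) Inv ?_ _ hI₁) ?_ ?_) (by omega) fun _ hh => hh
  · rintro n s' hf ⟨h, h15, hn, hI', hb', hmark⟩ he
    have hs' := hs₁.of_frame hf (by cases d <;> decide)
    have hlt : h < s'.var (tailVar d) := by
      by_contra hc
      exact he (by simp [Expr.eval, h15, hc])
    have hQ := hI'.lt h hlt
    have ht := hI'.tail_le
    have hacc := fun ha C hC => hI'.closed_of_acceptable hD hlt hX.lt ha (C := C) hC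
    refine Run.mono (Run.seq (run_popCmd d hs' hX h15 hlt hI').frame (B' := 80) ?_) le_rfl
      fun _ hh => hh
    rintro s₂ ⟨⟨hI₂, h15₂, h11₂, hlt₂, hQ₂, hu₂⟩, hf₂⟩
    have hs₂ := hs'.of_frame hf₂ (by cases d <;> decide)
    have hQh := hQ₂ h hlt
    refine Run.mono (Run.cond (B := 50) (B' := 1) (fun hne => ?_) fun heq => ?_) ?_ fun _ hh => hh
    · rw [eval_acceptable hs₂ h11₂] at hne
      refine Run.mono (run_markCmd d hs₂ hX h11₂ (hD.L_lt _ _ hQ) hI₂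
        fun C hC => hacc hne C hC).frame le_rfl ?_
      rintro s₃ ⟨⟨hI₃, hm₃, hmono, hQ₃⟩, hf₃⟩
      refine ⟨n - 1, by omega, h + 1, ?_, by omega, hI₃, fun i hi hbi => ?_, fun i hi hai => ?_⟩
      · rw [hf₃.1 15 (by cases d <;> decide), h15₂]
      · exact hmono _ (hu₂ ▸ hb' i hi hbi)
      · rw [hQ₃ i (by omega), hQ₂ i (by omega)] at hai ⊢
        rcases Nat.lt_succ_iff_lt_or_eq.1 hi with hi | rfl
        · exact hmono _ (hu₂ ▸ hmark i hi hai)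
        · exact hm₃
    · have heq' : ¬ I.net.Acceptable mt _ := fun hc => (eval_acceptable hs₂ h11₂).2 hc heq
      refine Run.of_wp (p := .nop) ?_
      refine ⟨n - 1, by omega, h + 1, h15₂, by omega, hI₂, fun i hi hbi => ?_, fun i hi hai => ?_⟩
      · exact hu₂ ▸ hb' i hi hbi
      · rw [hQ₂ i (by omega)] at hai ⊢
        rcases Nat.lt_succ_iff_lt_or_eq.1 hi with hi | rfl
        · exact hu₂ ▸ hmark i hi hai
        · exact (heq' hai).elim
    · exact Nat.le_of_ble_eq_true rfl
  · exact le_of_eq rfl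
  · rintro s' ⟨⟨n, h, h15, hn, hI', hb', hmark⟩, he⟩
    have hle := hI'.head_le
    have hh : h = s'.var (tailVar d) := by
      refine le_antisymm hle (not_lt.1 fun hc => ?_)
      simp [Expr.eval, h15, hc] at he
    subst hh
    exact ⟨hI'.closed hD hb' hmark, hI'.sound⟩

end MUPM

/-! ### The program: blocking edges and the verdict on popularity -/

namespace MUPM

open RAM

variable {I : MUPM} {s s' : State} {X : Finset ℕ} {mt : Bool → ℕ → ℕ}

theorem edgesOf_range (I : MUPM) : I.edgesOf (Finset.range I.net.m) = I.edges := by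
  ext e
  rw [mem_edgesOf, Finset.mem_range, and_iff_left_iff_imp]
  exact num_lt

theorem initArr_four_num {e : Fin I.nA × Fin I.nB} (he : e ∈ I.edges) :
    I.initArr 4 (I.num e) = I.util e := toArr_num he _

theorem initArr_five_num {e : Fin I.nA × Fin I.nB} (he : e ∈ I.edges) :
    I.initArr 5 (I.num e) = I.cost e := toArr_num he _

theorem sum_util_lt_word (p : ℕ → Prop) [DecidablePred p] {i : ℕ} (hi : i ≤ I.net.m) :
    ∑ j ∈ Finset.range i, (if p j then I.initArr 4 j else 0) < I.word := by
  have h₁ : ∑ j ∈ Finset.range i, (if p j then I.initArr 4 j else 0)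
      ≤ ∑ j ∈ Finset.range I.net.m, I.initArr 4 j :=
    (Finset.sum_le_sum fun j _ => by split_ifs <;> simp).trans
      (Finset.sum_le_sum_of_subset (Finset.range_subset_range.2 hi))
  rw [← sum_edgesOf (f := I.util) (by simp) (fun _ => initArr_four_num), edgesOf_range] at h₁
  rw [word, magnitude]
  omega

theorem sum_cost_lt_word (p : ℕ → Prop) [DecidablePred p] {i : ℕ} (hi : i ≤ I.net.m) :
    ∑ j ∈ Finset.range i, (if p j then I.initArr 5 j else 0) < I.word := by
  have h₁ : ∑ j ∈ Finset.range i, (if p j then I.initArr 5 j else 0)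
      ≤ ∑ j ∈ Finset.range I.net.m, I.initArr 5 j :=
    (Finset.sum_le_sum fun j _ => by split_ifs <;> simp).trans
      (Finset.sum_le_sum_of_subset (Finset.range_subset_range.2 hi))
  rw [← sum_edgesOf (f := I.cost) (by simp) (fun _ => initArr_five_num), edgesOf_range] at h₁
  rw [word, magnitude]
  omega

/-- Compute the partner edges of the vertices of `A` and the utility of the matching. -/
def collectCmd : Cmd :=
  .seq (.assign 12 (.const 0)) <| .forEdges <|
  .cond (.eq (.get 21 (.get 1 (.var 8))) (.var 8))
    (.seq (.put 20 (.get 0 (.var 8)) (.var 8))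
      (.assign 12 (.add (.var 12) (.get 4 (.var 8))))) .nop

theorem run_collectCmd {S : ℕ → ℕ} (h : I.Loaded s) (hX : X = I.net.held (s.arr 21))
    (hst : I.net.Stable S X)
    (hmB : ∀ j < I.net.m, s.arr 21 (I.net.V true j) = I.net.m ∨
      (s.arr 21 (I.net.V true j) < I.net.m ∧
        I.net.V true (s.arr 21 (I.net.V true j)) = I.net.V true j))
    (hmA : ∀ j < I.net.m, s.arr 20 (I.net.V false j) = I.net.m) :
    Run I.word collectCmd s (40 * (I.net.m + 1)) fun s' => ∃ mt, I.Ready mt s' ∧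
      I.net.Matched X mt ∧ s'.var 12 = ∑ x ∈ X, I.initArr 4 x := by
  have hW := m_add_two_le_word I
  have hD := I.net_good
  have hmem : ∀ x, x ∈ X ↔ x < I.net.m ∧ s.arr 21 (I.net.V true x) = x := fun x => by
    rw [hX, Net.mem_held]
  let Inv : ℕ → State → Prop := fun i s' =>
    (∀ j < I.net.m, (s'.arr 20 (I.net.V false j) = I.net.m ∧
      ∀ x ∈ X, x < i → I.net.V false x ≠ I.net.V false j) ∨
      (s'.arr 20 (I.net.V false j) ∈ X ∧
        I.net.V false (s'.arr 20 (I.net.V false j)) = I.net.V false j)) ∧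
    s'.var 12 = ∑ j ∈ Finset.range i, if j ∈ X then I.initArr 4 j else 0
  have h₁ : Run I.word (.assign 12 (.const 0)) s 2 fun s' => Inv 0 s' ∧ I.Loaded s' ∧
      s'.arr 21 = s.arr 21 := by
    refine Run.mono (Run.of_wp (Q := Inv 0) ?_).frame (by decide)
      fun s' hs' => ⟨hs'.1, h.of_frame hs'.2 (by decide), hs'.2.2 21 (by decide)⟩
    simp only [wp, Expr.eval, Inv]
    exact ⟨by omega, fun j hj => .inl ⟨hmA j hj, by simp⟩, by simp⟩
  refine Run.mono (Run.seq h₁ (B' := 2 + (I.net.m * (8 + 23) + 4)) fun s₁ ⟨hI₁, hL₁, h21⟩ =>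
    Run.mono (Run.forEdges (B := 23) Inv hL₁.var3 ?_ ?_ ?_ ?_ ?_).frame le_rfl ?_) (by omega)
    fun _ hh => hh
  · omega
  · decide
  · decide
  · simpa [Inv] using hI₁
  · rintro i hi s' hf h8 hI
    have hL := hL₁.of_frame hf (by decide)
    have h21' : s'.arr 21 = s.arr 21 := (hf.2 21 (by decide)).trans h21
    have hV := V_lt_word false hi
    have hsum := sum_util_lt_word (I := I) (· ∈ X) (i := i + 1) hi
    refine Run.mono (Run.of_wp (Q := fun s'' => Inv (i + 1) (s''.setVar 8 (i + 1))) ?_)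
      (by decide) fun _ hh => hh
    have hi' := hmem i
    obtain ⟨hI1, hI2⟩ := hI
    have hsucc := Finset.sum_range_succ (fun j => if j ∈ X then I.initArr 4 j else 0) i
    rw [← hI2] at hsucc
    rw [hsucc] at hsum
    simp [wp, Expr.eval, h8, hL.arr0, hL.arr1, hL.arr4, h21', Inv, -Finset.sum_ite_mem, hsucc]
    refine ⟨fun he => ?_, fun hne => ?_⟩
    · have hiX : i ∈ X := hi'.2 ⟨hi, he⟩
      rw [if_pos hiX] at hsum
      refine ⟨hV, by omega, hsum, fun j hj => ?_, fun hc => (hc hiX).elim⟩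
      by_cases hVj : I.net.V false j = I.net.V false i
      · rw [hVj, Function.update_self]
        exact .inr ⟨hiX, rfl⟩
      · rw [Function.update_of_ne hVj]
        refine (hI1 j hj).imp_left fun hh => ⟨hh.1, fun x hx hxi => ?_⟩
        rcases hxi.lt_or_eq with hxi | rfl
        · exact hh.2 x hx hxi
        · exact Ne.symm hVj
    · have hiX : i ∉ X := fun hc => hne (hi'.1 hc).2
      refine ⟨fun j hj => (hI1 j hj).imp_left fun hh => ⟨hh.1, fun x hx hxi => ?_⟩,
        fun hc => (hiX hc).elim⟩
      rcases hxi.lt_or_eq with hxi | rfl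
      · exact hh.2 x hx hxi
      · exact (hiX hx).elim
  · rintro s' ⟨⟨hI1, hI2⟩, hf⟩
    have hL := hL₁.of_frame hf (by decide)
    have h21' : s'.arr 21 = s.arr 21 := (hf.2 21 (by decide)).trans h21
    refine ⟨fun d => bif d then s'.arr 21 else s'.arr 20, ⟨hL, rfl, rfl⟩,
      ⟨hst.lt, hst.inj, ?_⟩, ?_⟩
    · rintro (_ | _) j hj
      · exact (hI1 j hj).imp_left fun hh => ⟨hh.1, fun x hx => hh.2 x hx (hst.lt x hx)⟩
      · simp only [cond_true, h21']
        rcases hmB j hj with h' | h'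
        · refine .inl ⟨h', fun x hx hV => ?_⟩
          have := (hmem x).1 hx
          rw [hV, h'] at this
          omega
        · exact .inr ⟨(hmem _).2 ⟨h'.1, by rw [h'.2]⟩, h'.2⟩
    · rw [hI2, ← Finset.sum_filter]
      congr 1
      ext x
      rw [Finset.mem_filter, Finset.mem_range, and_iff_right_iff_imp]
      exact hst.lt x

/-- The edge in register `r` blocks the matching: both endpoints prefer it to their partner edges,
of which the missing edge `m` has the worst position. -/
def blockingExpr (r : ℕ) : Expr :=
  .eq (.const 2) <| .add
    (.lt (.get 2 (.var r)) (.get 2 (.get 20 (.get 0 (.var r)))))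
    (.lt (.get 3 (.var r)) (.get 3 (.get 21 (.get 1 (.var r)))))

theorem eval_blockingExpr {r i : ℕ} (hs : I.Ready mt s) (hr : s.var r = i) :
    (blockingExpr r).eval s ≠ 0 ↔ I.net.Blocking mt i := by
  simp only [blockingExpr, Expr.eval, hr, hs.arr20, hs.arr21, hs.loaded.arr0,
    hs.loaded.arr1, hs.loaded.arr2, hs.loaded.arr3, Net.Blocking, Bool.forall_bool]
  split_ifs <;> simp_all

/-- Compute the cost of the blocking edges, and mark their endpoints. -/
def blockersCmd : Cmd :=
  .seq (.seq (.assign 13 (.const 0)) (.seq (.assign 16 (.const 0)) (.assign 17 (.const 0)))) <|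
  .forEdges <| .cond (blockingExpr 8)
    (.seq (.assign 13 (.add (.var 13) (.get 5 (.var 8)))) (.seq (markCmd false 8) (markCmd true 8)))
    .nop

theorem Searching.congr {d : Bool} {h : ℕ} (hI : I.Searching X mt d h s)
    (h₁ : s'.arr (markArr d) = s.arr (markArr d)) (h₂ : s'.arr (queueArr d) = s.arr (queueArr d))
    (h₃ : s'.var (tailVar d) = s.var (tailVar d)) : I.Searching X mt d h s' := by
  rw [Searching, h₁, h₂, h₃]
  exact hI

open Classical in
theorem run_blockersCmd (hs : I.Ready mt s) (hX : I.net.Matched X mt)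
    (hu : ∀ d, ∀ i < I.net.m, s.arr (markArr d) (I.net.V d i) = 0) :
    Run I.word blockersCmd s (160 * (I.net.m + 1)) fun s' =>
      (∀ d, I.Searching X mt d 0 s') ∧
      (∀ d, ∀ i < I.net.m, I.net.Blocking mt i → s'.arr (markArr d) (I.net.V d i) ≠ 0) ∧
      s'.var 13 = ∑ j ∈ Finset.range I.net.m, if I.net.Blocking mt j then I.initArr 5 j else 0 := by
  have hW := m_add_two_le_word I
  let Inv : ℕ → State → Prop := fun i s' =>
    (∀ d, I.Searching X mt d 0 s') ∧
    (∀ d, ∀ j < i, I.net.Blocking mt j → s'.arr (markArr d) (I.net.V d j) ≠ 0) ∧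
    s'.var 13 = ∑ j ∈ Finset.range i, if I.net.Blocking mt j then I.initArr 5 j else 0
  have hset : ∀ i s', Inv i s' → ∀ v, Inv i (s'.setVar 8 v) := by
    rintro i s' ⟨h₁, h₂, h₃⟩ v
    refine ⟨fun d => (h₁ d).congr rfl rfl ?_, h₂, by simpa using h₃⟩
    cases d <;> simp [tailVar]
  have h₁ : Run I.word (.seq (.assign 13 (.const 0)) (.seq (.assign 16 (.const 0))
      (.assign 17 (.const 0)))) s 6 fun s' => Inv 0 s' ∧ I.Ready mt s' := by
    refine Run.mono (Run.of_wp (Q := Inv 0) ?_).frame (by decide)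
      fun s' hs' => ⟨hs'.1, hs.of_frame hs'.2 (by decide)⟩
    simp only [wp, Expr.eval, Inv]
    refine ⟨by omega, by omega, by omega, fun d => ?_, by simp, by simp⟩
    cases d <;> simpa [Searching, tailVar] using Net.SearchInv.init hX.lt (hu _)
  refine Run.mono (Run.seq h₁ fun s₁ ⟨hI₁, hs₁⟩ =>
    Run.forEdges (B := 140) Inv hs₁.loaded.var3 (by omega) (by decide) (by decide)
      (hset _ _ hI₁ _) ?_) (by omega : 6 + (2 + (I.net.m * (8 + 140) + 4)) ≤ _) fun _ hh => hh
  rintro i hi s' hf h8 ⟨hI1, hI2, hI3⟩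
  have hs' := hs₁.of_frame hf (by decide)
  refine Run.mono (Run.cond (B := 115) (B' := 1) (fun hne => ?_) fun heq => ?_) ?_
    fun s'' hh => hset (i + 1) s'' hh _
  · rw [eval_blockingExpr hs' h8] at hne
    have hsum := sum_cost_lt_word (I := I) (I.net.Blocking mt) (i := i + 1) hi
    rw [Finset.sum_range_succ, if_pos hne] at hsum
    have hA : Run I.word (.assign 13 (.add (.var 13) (.get 5 (.var 8)))) s' 6 fun s'' =>
        s''.var 13 = s'.var 13 + I.initArr 5 i := by
      refine Run.mono (Run.of_wp (Q := fun s'' => s''.var 13 = s'.var 13 + I.initArr 5 i) ?_)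
        (by decide) fun _ hh => hh
      simp only [wp, Expr.eval, hI3, h8, hs'.loaded.arr5]
      exact ⟨hsum, by simp⟩
    refine Run.mono (Run.seq hA.frame (B' := 100) fun s₂ ⟨h13, hf₂⟩ => ?_) (by omega) fun _ hh => hh
    have hs₂ := hs'.of_frame hf₂ (by decide)
    have hI₂ : ∀ d, I.Searching X mt d 0 s₂ := fun d => (hI1 d).congr
      (hf₂.2 _ (by cases d <;> decide)) (hf₂.2 _ (by cases d <;> decide))
      (hf₂.1 _ (by cases d <;> decide))
    refine Run.mono (Run.seq (run_markCmd false hs₂ hX (hf₂.1 8 (by decide) |>.trans h8) hi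
      (hI₂ false) fun C hC => hC.blocking i hi hne).frame (B' := 50)
      fun s₃ ⟨⟨hI₃, hm₃, hmono₃, _⟩, hf₃⟩ => ?_) (by omega) fun _ hh => hh
    have hs₃ := hs₂.of_frame hf₃ (by decide)
    have hI₃' : I.Searching X mt true 0 s₃ := (hI₂ true).congr
      (hf₃.2 _ (by decide)) (hf₃.2 _ (by decide)) (hf₃.1 _ (by decide))
    refine Run.mono (run_markCmd true hs₃ hX
      (hf₃.1 8 (by decide) |>.trans (hf₂.1 8 (by decide) |>.trans h8)) hi
      hI₃' fun C hC => hC.blocking i hi hne).frame le_rfl ?_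
    rintro s₄ ⟨⟨hI₄, hm₄, hmono₄, _⟩, hf₄⟩
    refine ⟨Bool.forall_bool.2 ⟨hI₃.congr (hf₄.2 _ (by decide)) (hf₄.2 _ (by decide))
      (hf₄.1 _ (by decide)), hI₄⟩, Bool.forall_bool.2 ⟨fun j hj hb => ?_, fun j hj hb => ?_⟩, ?_⟩
    · rw [hf₄.2 (markArr false) (by decide)]
      rcases Nat.lt_succ_iff_lt_or_eq.1 hj with hj | rfl
      · refine hmono₃ _ ?_
        rw [hf₂.2 (markArr false) (by decide)]
        exact hI2 false j hj hb
      · exact hm₃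
    · rcases Nat.lt_succ_iff_lt_or_eq.1 hj with hj | rfl
      · refine hmono₄ _ ?_
        rw [hf₃.2 (markArr true) (by decide), hf₂.2 (markArr true) (by decide)]
        exact hI2 true j hj hb
      · exact hm₄
    · rw [hf₄.1 13 (by decide), hf₃.1 13 (by decide), h13, Finset.sum_range_succ, if_pos hne, hI3]
  · have heq' : ¬ I.net.Blocking mt i := fun hc => (eval_blockingExpr hs' h8).2 hc heq
    refine Run.of_wp (p := .nop) ⟨hI1, fun d j hj hb => ?_, ?_⟩
    · rcases Nat.lt_succ_iff_lt_or_eq.1 hj with hj | rfl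
      · exact hI2 d j hj hb
      · exact (heq' hb).elim
    · rw [Finset.sum_range_succ, if_neg heq', hI3, add_zero]
  · decide

/-- Check that the marked vertices are matched, but not to each other. -/
def verifyCmd : Cmd :=
  .seq (.assign 14 (.const 1)) <| .forEdges <|
  .seq
    (.cond (.get 22 (.get 0 (.var 8)))
      (.cond (.lt (.get 20 (.get 0 (.var 8))) (.var 3))
        (.cond (.get 23 (.get 1 (.get 20 (.get 0 (.var 8))))) (.assign 14 (.const 0)) .nop)
        (.assign 14 (.const 0)))
      .nop)
    (.cond (.get 23 (.get 1 (.var 8)))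
      (.cond (.lt (.get 21 (.get 1 (.var 8))) (.var 3)) .nop (.assign 14 (.const 0)))
      .nop)

open Classical in
theorem run_verifyCmd (hs : I.Ready mt s) (hX : I.net.Matched X mt) :
    Run I.word verifyCmd s (60 * (I.net.m + 1)) fun s' => s'.var 14 =
      if I.net.Passes X mt (fun d => s.arr (markArr d)) then 1 else 0 := by
  have hW := m_add_two_le_word I
  obtain ⟨ok, hdef⟩ : ∃ ok : ℕ → Prop, ∀ j, ok j ↔
      (s.arr 22 (I.net.V false j) ≠ 0 → mt false (I.net.V false j) < I.net.m ∧
        s.arr 23 (I.net.V true (mt false (I.net.V false j))) = 0) ∧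
      (s.arr 23 (I.net.V true j) ≠ 0 → mt true (I.net.V true j) < I.net.m) :=
    ⟨_, fun _ => Iff.rfl⟩
  have hok : (∀ j < I.net.m, ok j) ↔ I.net.Passes X mt fun d => s.arr (markArr d) := by
    simp only [hdef]
    constructor
    · refine fun h => ⟨Bool.forall_bool.2 ⟨fun i hi hne => ((h i hi).1 hne).1,
        fun i hi hne => (h i hi).2 hne⟩, fun x hx hc => ?_⟩
      have := ((h x (hX.lt x hx)).1 hc.1).2
      rw [hX.eq_of_mem hx] at this
      exact hc.2 this
    · refine fun h j hj => ⟨fun hne => ?_, h.1 true j hj⟩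
      have h₁ := h.1 false j hj hne
      refine ⟨h₁, ?_⟩
      rcases hX.isPartner false j hj with h' | h'
      · omega
      · by_contra hc
        exact h.2 _ h'.1 ⟨by rw [h'.2]; exact hne, hc⟩
  let Inv : ℕ → State → Prop := fun i s' => s'.var 14 = if ∀ j < i, ok j then 1 else 0
  have h₁ : Run I.word (.assign 14 (.const 1)) s 2 fun s' => Inv 0 s' ∧ I.Ready mt s' ∧
      s'.arr 22 = s.arr 22 ∧ s'.arr 23 = s.arr 23 := by
    refine Run.mono (Run.of_wp (Q := Inv 0) ?_).frame (by decide) fun s' hs' =>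
      ⟨hs'.1, hs.of_frame hs'.2 (by decide), hs'.2.2 22 (by decide), hs'.2.2 23 (by decide)⟩
    simp only [wp, Expr.eval, Inv]
    exact ⟨by omega, by simp⟩
  refine Run.mono (Run.seq h₁ fun s₁ ⟨hI₁, hs₁, h22, h23⟩ =>
    Run.forEdges (B := 42) Inv hs₁.loaded.var3 (by omega) (by decide) (by decide) ?_ ?_)
    (by omega : 2 + (2 + (I.net.m * (8 + 42) + 4)) ≤ _) ?_
  · simpa [Inv] using hI₁
  · rintro i hi s' hf h8 hI
    have hs' := hs₁.of_frame hf (by decide)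
    have h22' : s'.arr 22 = s.arr 22 := (hf.2 22 (by decide)).trans h22
    have h23' : s'.arr 23 = s.arr 23 := (hf.2 23 (by decide)).trans h23
    have hL := hs'.loaded
    refine Run.mono (Run.of_wp (Q := fun s'' => Inv (i + 1) (s''.setVar 8 (i + 1))) ?_)
      (by decide) fun _ hh => hh
    simp only [Inv] at hI ⊢
    have hsucc : (∀ j < i + 1, ok j) ↔ (∀ j < i, ok j) ∧ ok i := Nat.forall_lt_succ_right
    simp [wp, Expr.eval, h8, hL.arr0, hL.arr1, hL.var3, hs'.arr20, hs'.arr21, h22', h23', hI, hsucc,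
      -Order.lt_add_one_iff]
    have hdef := hdef i
    have hW' : 0 < I.magnitude := (by omega : 0 < I.word)
    by_cases hprev : ∀ j < i, ok j <;> grind
  · rintro s' hI
    simp only [Inv, hok] at hI
    exact hI

end MUPM

/-! ### The program: the test of one set of blocking edges -/

namespace MUPM

open RAM

variable {I : MUPM} {s s' : State} {X : Finset ℕ} {mt : Bool → ℕ → ℕ}

/-- The matching `M` shows that the answer is yes. -/
def IsSolution (I : MUPM) (M : Finset (Fin I.nA × Fin I.nB)) : Prop :=
  I.IsPopular M ∧ I.t ≤ ∑ e ∈ M, I.util e ∧ ∑ e ∈ I.bp M, I.cost e ≤ I.k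

theorem sum_cost_bp_edgesOf (h : I.net.Matched X mt) [DecidablePred (I.net.Blocking mt)] :
    ∑ e ∈ I.bp (I.edgesOf X), I.cost e =
      ∑ j ∈ Finset.range I.net.m, if I.net.Blocking mt j then I.initArr 5 j else 0 := by
  have : I.bp (I.edgesOf X) = I.edgesOf {j ∈ Finset.range I.net.m | I.net.Blocking mt j} := by
    ext e
    rw [mem_bp, mem_edgesOf, Finset.mem_filter, Finset.mem_range]
    constructor
    · rintro ⟨he, hb⟩
      exact ⟨he, num_lt he, (blocks_edgesOf h he).1 hb⟩
    · rintro ⟨he, -, hb⟩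
      exact ⟨he, (blocks_edgesOf h he).2 hb⟩
  rw [this, sum_edgesOf (g := I.initArr 5) (by simp +contextual) fun _ => initArr_five_num,
    Finset.sum_filter]

/-- Set register 0 to `1` if the matching is a solution. -/
def concludeCmd : Cmd :=
  .cond (.var 14)
    (.cond (.lt (.var 12) (.var 4)) .nop
      (.cond (.lt (.var 5) (.var 13)) .nop (.assign 0 (.const 1)))) .nop

/-- Test the stable matching without the edges that are marked in array 26. -/
def testCmd : Cmd :=
  .seq clearCmd <| .seq acceptanceCmd <| .seq collectCmd <| .seq blockersCmd <|
  .seq (searchCmd false) <| .seq (searchCmd true) <| .seq verifyCmd concludeCmd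

open Classical in
theorem run_testCmd (h : I.Loaded s) :
    Run I.word testCmd s (1000 * (I.net.m + 1)) fun s' => ∃ X, I.net.Stable (s.arr 26) X ∧
      s'.var 0 = if I.IsSolution (I.edgesOf X) then 1 else s.var 0 := by
  have hW := m_add_two_le_word I
  refine Run.mono (Run.seq (run_clearCmd h).frame (B' := 970 * (I.net.m + 1)) ?_)
    (by omega) fun _ hh => hh
  rintro s₁ ⟨hclear, hf₁⟩
  have h₁ := h.of_frame hf₁ (by decide)
  refine Run.mono (Run.seq (run_acceptanceCmd h₁ fun j hj => (hclear j hj).2.1).frame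
    (B' := 610 * (I.net.m + 1)) ?_) (by omega) fun _ hh => hh
  rintro s₂ ⟨⟨hst, hmB⟩, hf₂⟩
  have h₂ := h₁.of_frame hf₂ (by decide)
  generalize hX : I.net.held (s₂.arr 21) = X at hst
  refine Run.mono (Run.seq (run_collectCmd h₂ hX.symm hst hmB fun j hj => ?_).frame
    (B' := 570 * (I.net.m + 1)) ?_) (by omega) fun _ hh => hh
  · rw [hf₂.2 20 (by decide)]
    exact (hclear j hj).1
  rintro s₃ ⟨⟨mt, hs₃, hmt, h12⟩, hf₃⟩
  refine Run.mono (Run.seq (run_blockersCmd hs₃ hmt ?_).frame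
    (B' := 410 * (I.net.m + 1)) ?_) (by omega) fun _ hh => hh
  · refine Bool.forall_bool.2 ⟨fun j hj => ?_, fun j hj => ?_⟩
    · rw [hf₃.2 (markArr false) (by decide), hf₂.2 (markArr false) (by decide)]
      exact (hclear j hj).2.2.1
    · rw [hf₃.2 (markArr true) (by decide), hf₂.2 (markArr true) (by decide)]
      exact (hclear j hj).2.2.2
  rintro s₄ ⟨⟨hI₄, hb₄, h13⟩, hf₄⟩
  have hs₄ := hs₃.of_frame hf₄ (by decide)
  refine Run.mono (Run.seq (run_searchCmd false hs₄ hmt (hI₄ false) (hb₄ false)).frame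
    (B' := 250 * (I.net.m + 1)) ?_) (by omega) fun _ hh => hh
  rintro s₅ ⟨⟨hc₅, hu₅⟩, hf₅⟩
  have hs₅ := hs₄.of_frame hf₅ (by decide)
  have hI₅ : I.Searching X mt true 0 s₅ := (hI₄ true).congr
    (hf₅.2 _ (by decide)) (hf₅.2 _ (by decide)) (hf₅.1 _ (by decide))
  refine Run.mono (Run.seq (run_searchCmd true hs₅ hmt hI₅ ?_).frame
    (B' := 90 * (I.net.m + 1)) ?_) (by omega) fun _ hh => hh
  · rw [hf₅.2 (markArr true) (by decide)]
    exact hb₄ true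
  rintro s₆ ⟨⟨hc₆, hu₆⟩, hf₆⟩
  have hs₆ := hs₅.of_frame hf₆ (by decide)
  refine Run.mono (Run.seq (run_verifyCmd hs₆ hmt).frame
    (B' := 30 * (I.net.m + 1)) ?_) (by omega) fun _ hh => hh
  rintro s₇ ⟨h14, hf₇⟩
  have hs₇ := hs₆.of_frame hf₇ (by decide)
  have hpop : I.net.Passes X mt (fun d => s₆.arr (markArr d)) ↔ I.IsPopular (I.edgesOf X) := by
    have hmark : s₆.arr (markArr false) = s₅.arr (markArr false) := hf₆.2 _ (by decide)
    refine ⟨fun hp => isPopular_of_passes hmt (Bool.forall_bool.2 ⟨?_, hc₆⟩) hp,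
      fun hp => passes_of_isPopular hmt hp (Bool.forall_bool.2 ⟨?_, hu₆⟩)⟩
    · simpa only [hmark] using hc₅
    · simpa only [hmark] using hu₅
  have hutil : s₇.var 12 = ∑ e ∈ I.edgesOf X, I.util e := by
    rw [sum_edgesOf hst.lt (g := I.initArr 4) fun _ => initArr_four_num, ← h12,
      hf₇.1 12 (by decide),
      hf₆.1 12 (by decide), hf₅.1 12 (by decide), hf₄.1 12 (by decide)]
  have hcost : s₇.var 13 = ∑ e ∈ I.bp (I.edgesOf X), I.cost e := by
    rw [sum_cost_bp_edgesOf hmt, ← h13, hf₇.1 13 (by decide), hf₆.1 13 (by decide),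
      hf₅.1 13 (by decide)]
  have h0 : s₇.var 0 = s.var 0 := by
    rw [hf₇.1 0 (by decide), hf₆.1 0 (by decide), hf₅.1 0 (by decide), hf₄.1 0 (by decide),
      hf₃.1 0 (by decide), hf₂.1 0 (by decide), hf₁.1 0 (by decide)]
  rw [hf₁.2 26 (by decide)] at hst
  refine Run.mono (Run.of_wp (Q := fun s' => ∃ X, I.net.Stable (s.arr 26) X ∧ s'.var 0 =
    if I.IsSolution (I.edgesOf X) then 1 else s.var 0) ?_)
    ((by decide : concludeCmd.time ≤ 30).trans (by omega)) fun _ hh => hh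
  rw [hpop] at h14
  have hcases : ∀ v, (v = if I.IsSolution (I.edgesOf X) then 1 else s.var 0) →
      ∃ X, I.net.Stable (s.arr 26) X ∧ v = if I.IsSolution (I.edgesOf X) then 1 else s.var 0 :=
    fun v hv => ⟨X, hst, hv⟩
  simp only [concludeCmd, wp, Expr.eval, hs₇.loaded.var4, hs₇.loaded.var5, h14, hutil, hcost]
  by_cases hp : I.IsPopular (I.edgesOf X)
  · refine ⟨fun _ => ⟨fun hlt => hcases _ ?_, fun hge => ⟨fun hlt => hcases _ ?_, fun hle =>
      ⟨by omega, hcases _ ?_⟩⟩⟩, fun hc => by simp [hp] at hc⟩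
    · have : ¬ I.IsSolution (I.edgesOf X) := fun hsol => by
        have := hsol.2.1
        simp only [ne_eq, ite_eq_right_iff, one_ne_zero, imp_false, not_not] at hlt
        omega
      rw [if_neg this, h0]
    · have : ¬ I.IsSolution (I.edgesOf X) := fun hsol => by
        have := hsol.2.2
        simp only [ne_eq, ite_eq_right_iff, one_ne_zero, imp_false, not_not] at hlt
        omega
      rw [if_neg this, h0]
    · simp only [ite_eq_right_iff, one_ne_zero, imp_false, not_lt] at hge hle
      rw [if_pos ⟨hp, hge, hle⟩]
      simp
  · refine ⟨fun hc => by simp [hp] at hc, fun _ => hcases _ ?_⟩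
    rw [if_neg fun hsol => hp hsol.1, h0]

end MUPM

/-! ### Enumeration of digit sequences -/

/-- The number with the digits `d 0, …, d (k - 1)` to base `m`. -/
def digitSum (m k : ℕ) (d : ℕ → ℕ) : ℕ := ∑ i ∈ Finset.range k, d i * m ^ i

theorem digitSum_update (m : ℕ) {k i : ℕ} (hi : i < k) (d : ℕ → ℕ) (v : ℕ) :
    digitSum m k (Function.update d i v) + d i * m ^ i = digitSum m k d + v * m ^ i := by
  have hi' := Finset.mem_range.2 hi
  rw [digitSum, digitSum, ← Finset.sum_erase_add _ _ hi', ← Finset.sum_erase_add _ _ hi',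
    Function.update_self, Finset.sum_congr rfl fun j hj => by
      rw [Function.update_of_ne (Finset.ne_of_mem_erase hj)]]
  ring

theorem digitSum_eq_finFunctionFinEquiv {m k : ℕ} {d : ℕ → ℕ} (h : ∀ i < k, d i < m) :
    digitSum m k d = finFunctionFinEquiv fun i : Fin k => (⟨d i, h i i.2⟩ : Fin m) := by
  rw [finFunctionFinEquiv_apply, digitSum, Finset.sum_range]

theorem digitSum_lt {m k : ℕ} {d : ℕ → ℕ} (h : ∀ i < k, d i < m) : digitSum m k d < m ^ k := by
  rw [digitSum_eq_finFunctionFinEquiv h]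
  exact Fin.is_lt _

theorem digitSum_inj {m k : ℕ} {d d' : ℕ → ℕ} (h : ∀ i < k, d i < m) (h' : ∀ i < k, d' i < m)
    (hd : digitSum m k d = digitSum m k d') {i : ℕ} (hi : i < k) : d i = d' i := by
  rw [digitSum_eq_finFunctionFinEquiv h, digitSum_eq_finFunctionFinEquiv h'] at hd
  have := congrFun (finFunctionFinEquiv.injective (Fin.ext hd)) ⟨i, hi⟩
  simpa using this

/-- A nonempty set with at most `k` elements is enumerated, with repetitions, by `k` digits. -/
theorem exists_digits {B : Finset ℕ} {m k : ℕ} (hB : B.Nonempty) (hm : ∀ j ∈ B, j < m)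
    (hk : B.card ≤ k) : ∃ f : ℕ → ℕ, (∀ i < k, f i < m) ∧ ∀ j, j ∈ B ↔ ∃ i < k, f i = j := by
  obtain ⟨b, hb⟩ := hB
  have hmem : ∀ i, B.toList.getD i b ∈ B := fun i => by
    rcases lt_or_ge i B.toList.length with hi | hi
    · rw [List.getD_eq_getElem _ _ hi, ← Finset.mem_toList]
      exact List.getElem_mem _
    · rwa [List.getD_eq_default _ _ hi]
  refine ⟨fun i => B.toList.getD i b, fun i _ => hm _ (hmem i), fun j => ⟨fun hj => ?_, ?_⟩⟩
  · obtain ⟨i, hi, rfl⟩ := List.getElem_of_mem (Finset.mem_toList.2 hj)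
    exact ⟨i, by simpa using hi.trans_le (by simpa using hk), List.getD_eq_getElem _ _ hi⟩
  · rintro ⟨i, -, rfl⟩
    exact hmem i

namespace MUPM

open RAM

variable {I : MUPM} {s s' : State}

/-- Mark the edges in the first cells of array 27. -/
def selectCmd : Cmd :=
  .seq (.forEdges (.put 26 (.var 8) (.const 0)))
    (.forEdges (.cond (.lt (.var 8) (.var 6)) (.put 26 (.get 27 (.var 8)) (.const 1)) .nop))

theorem run_selectCmd {k : ℕ} (h : I.Loaded s) (h6 : s.var 6 = k) (hk : k ≤ I.net.m)
    (hd : ∀ i < k, s.arr 27 i < I.net.m) :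
    Run I.word selectCmd s (40 * (I.net.m + 1)) fun s' =>
      ∀ j < I.net.m, s'.arr 26 j ≠ 0 ↔ ∃ i < k, s.arr 27 i = j := by
  have hW := m_add_two_le_word I
  refine Run.mono (Run.seq (Run.forEdges (B := 3) (fun i s' => ∀ j < i, s'.arr 26 j = 0) h.var3
    (by omega) (by decide) (by decide) (by simp) fun i hi s' hf h8 hI => ?_).frame
    (B' := 2 + (I.net.m * (8 + 9) + 4)) fun s₁ ⟨hI₁, hf₁⟩ => ?_) (by omega) fun _ hh => hh
  · refine Run.mono (Run.of_wp (Q := fun s'' => ∀ j < i + 1, _) ?_) (by decide) fun _ hh => hh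
    simp [wp, Expr.eval, h8]
    grind
  · have h₁ := h.of_frame hf₁ (by decide)
    have h27 : s₁.arr 27 = s.arr 27 := hf₁.2 27 (by decide)
    have h6' : s₁.var 6 = k := (hf₁.1 6 (by decide)).trans h6
    refine Run.mono (Run.forEdges (B := 9) (fun i s' => ∀ j < I.net.m, s'.arr 26 j ≠ 0 ↔
      ∃ l < k, l < i ∧ s.arr 27 l = j) h₁.var3
      (by omega) (by decide) (by decide) ?_ fun i hi s' hf h8 hI => ?_) le_rfl fun s' hI j hj => ?_
    · simpa using hI₁
    · have h27' : s'.arr 27 = s.arr 27 := (hf.2 27 (by decide)).trans h27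
      have h6'' : s'.var 6 = k := (hf.1 6 (by decide)).trans h6'
      refine Run.mono (Run.of_wp (Q := fun s'' => ∀ j < I.net.m, _) ?_) (by decide) fun _ hh => hh
      simp only [wp, Expr.eval, h8, h27', h6'', State.setVar_arr, State.setArr_arr, if_true]
      refine ⟨fun hlt => ?_, fun hge => ?_⟩
      · have hik : i < k := by simpa using hlt
        have := hd i hik
        refine ⟨by omega, by omega, fun j hj => ?_⟩
        by_cases hji : j = s.arr 27 i
        · subst hji
          simp only [Function.update_self]
          exact ⟨fun _ => ⟨i, hik, by omega, rfl⟩, fun _ => by omega⟩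
        · rw [Function.update_of_ne hji, hI j hj]
          refine exists_congr fun l => and_congr_right fun hl => ⟨fun hh => ⟨by omega, hh.2⟩,
            fun hh => ⟨lt_of_le_of_ne (by omega) ?_, hh.2⟩⟩
          rintro rfl
          exact hji hh.2.symm
      · have hik : k ≤ i := by simpa using hge
        intro j hj
        rw [hI j hj]
        exact exists_congr fun l => and_congr_right fun hl => ⟨fun hh => ⟨by omega, hh.2⟩,
          fun hh => ⟨by omega, hh.2⟩⟩
    · rw [hI j hj]
      exact exists_congr fun l => and_congr_right fun hl => ⟨fun hh => hh.2, fun hh =>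
        ⟨by omega, hh⟩⟩

/-- Pass to the next digit sequence. Register 18 holds the carry; it is `1` at the end if there is
no next sequence. -/
def advanceCmd : Cmd :=
  .seq (.assign 18 (.const 1)) <| .forEdges <|
  .cond (.var 18)
    (.cond (.lt (.var 8) (.var 6))
      (.cond (.lt (.add (.get 27 (.var 8)) (.const 1)) (.var 3))
        (.seq (.put 27 (.var 8) (.add (.get 27 (.var 8)) (.const 1))) (.assign 18 (.const 0)))
        (.put 27 (.var 8) (.const 0))) .nop) .nop

theorem run_advanceCmd {k : ℕ} (h : I.Loaded s) (h6 : s.var 6 = k) (hk : k ≤ I.net.m)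
    (hd : ∀ i < k, s.arr 27 i < I.net.m) :
    Run I.word advanceCmd s (50 * (I.net.m + 1)) fun s' =>
      (∀ i < k, s'.arr 27 i < I.net.m) ∧
      ((s'.var 18 = 0 ∧
          digitSum I.net.m k (s'.arr 27) = digitSum I.net.m k (s.arr 27) + 1) ∨
        (s'.var 18 = 1 ∧ I.net.m ^ k ≤ digitSum I.net.m k (s.arr 27) + 1)) := by
  have hW := m_add_two_le_word I
  let Inv : ℕ → State → Prop := fun i s' =>
    (∀ i < k, s'.arr 27 i < I.net.m) ∧
    ((s'.var 18 = 0 ∧ digitSum I.net.m k (s'.arr 27) = digitSum I.net.m k (s.arr 27) + 1) ∨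
      (s'.var 18 = 1 ∧ digitSum I.net.m k (s'.arr 27) + I.net.m ^ (min i k) =
        digitSum I.net.m k (s.arr 27) + 1))
  have h₁ : Run I.word (.assign 18 (.const 1)) s 2 fun s' => Inv 0 s' := by
    refine Run.mono (Run.of_wp (Q := Inv 0) ?_) (by decide) fun s' hs' => hs'
    simp only [wp, Expr.eval, Inv]
    exact ⟨by omega, hd, .inr (by simp)⟩
  refine Run.mono (Run.seq h₁.frame (B' := 2 + (I.net.m * (8 + 30) + 4)) fun s₁ ⟨hI₁, hf₁⟩ =>
    Run.mono (Run.forEdges (B := 30) Inv (h.of_frame hf₁ (by decide)).var3 (by omega) (by decide)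
      (by decide) (by simpa [Inv] using hI₁) fun i hi s' hf h8 hI => ?_) le_rfl ?_)
    (by omega) fun _ hh => hh
  · have h3 : s'.var 3 = I.net.m := (h.of_frame hf₁ (by decide)).of_frame hf (by decide) |>.var3
    have h6' : s'.var 6 = k := (hf.1 6 (by decide)).trans ((hf₁.1 6 (by decide)).trans h6)
    obtain ⟨hlt, hI⟩ := hI
    refine Run.mono (Run.of_wp (Q := fun s'' => Inv (i + 1) (s''.setVar 8 (i + 1))) ?_)
      (by decide) fun _ hh => hh
    simp only [wp, Expr.eval, h8, h6', h3, State.setVar_arr, State.setArr_arr, State.setVar_var,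
      State.setArr_var, if_true, Inv]
    refine ⟨fun hc => ?_, fun hc => ⟨hlt, .inl ⟨by simpa using hc, ?_⟩⟩⟩
    · obtain ⟨h18, hsum⟩ := hI.resolve_left fun hh => hc hh.1
      refine ⟨fun hik => ?_, fun hik => ⟨hlt, .inr ⟨by simpa using h18, ?_⟩⟩⟩
      · have hik : i < k := by simpa using hik
        have hdi := hlt i hik
        rw [min_eq_left hik.le] at hsum
        refine ⟨fun hdig => ⟨by omega, by omega, by omega, fun j hj => ?_, .inl ⟨by simp, ?_⟩⟩,
          fun hdig => ⟨by omega, by omega, fun j hj => ?_, .inr ⟨by simpa using h18, ?_⟩⟩⟩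
        · have hdig : s'.arr 27 i + 1 < I.net.m := by simpa using hdig
          have := hlt j hj
          by_cases hji : j = i
          · subst hji
            rwa [Function.update_self]
          · rwa [Function.update_of_ne hji]
        · have := digitSum_update I.net.m hik (s'.arr 27) (s'.arr 27 i + 1)
          rw [add_mul, one_mul] at this
          omega
        · have := hlt j hj
          by_cases hji : j = i
          · subst hji
            rw [Function.update_self]
            omega
          · rwa [Function.update_of_ne hji]
        · have hdig : s'.arr 27 i + 1 = I.net.m := by
            simp only [ite_eq_right_iff, one_ne_zero, imp_false, not_lt] at hdig
            omega
          have := digitSum_update I.net.m hik (s'.arr 27) 0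
          rw [zero_mul, add_zero] at this
          rw [min_eq_left hik, pow_succ']
          nth_rw 2 [← hdig]
          rw [add_mul, one_mul]
          omega
      · have hik : k ≤ i := by simpa using hik
        rw [min_eq_right hik] at hsum
        rwa [min_eq_right (hik.trans i.le_succ)]
    · rcases hI with hI | hI
      · exact hI.2
      · omega
  · rintro s' ⟨hlt, hI⟩
    refine ⟨hlt, hI.imp_right fun hh => ⟨hh.1, ?_⟩⟩
    have := hh.2
    rw [min_eq_right hk] at this
    omega

end MUPM

/-! ### The program: the search for a solution -/

namespace MUPM

open RAM

variable {I : MUPM} {s s' : State}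

/-- Store positions for the missing edge `|E|`, the lists of the vertices of `A`, and the number of
digits, which is the smaller one of `k` and `|E|`. -/
def prepareCmd : Cmd :=
  .seq (.put 2 (.var 3) (.var 3)) <| .seq (.put 3 (.var 3) (.var 3)) <|
  .seq (.forEdges (.put 11 (.var 8) (.var 8))) <|
  .cond (.lt (.var 3) (.var 5)) (.assign 6 (.var 3)) (.assign 6 (.var 5))

theorem run_prepareCmd (I : MUPM) :
    Run I.word prepareCmd I.initState (30 * (I.net.m + 1)) fun s =>
      I.Loaded s ∧ s.var 6 = min I.k I.net.m ∧ s.var 0 = 0 ∧ s.arr 26 = (fun _ => 0) ∧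
      s.arr 27 = fun _ => 0 := by
  have hW := m_add_two_le_word I
  have hk : I.k < I.word := by
    rw [word, magnitude]
    omega
  -- The first two commands update the positions as in the definition of `net`.
  refine Run.mono (Run.seq (Run.of_wp (p := .put 2 (.var 3) (.var 3))
    (Q := fun s => s = I.initState.setArr 2 I.net.m I.net.m) ?_) (B' := 27 * I.net.m + 20) ?_)
    (by change 3 + _ ≤ _; omega) fun _ hh => hh
  · exact ⟨(by omega : I.net.m < I.word), (by omega : I.net.m < I.word), rfl⟩
  rintro _ rfl
  refine Run.mono (Run.seq (Run.of_wp (p := .put 3 (.var 3) (.var 3))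
    (Q := fun s => s = (I.initState.setArr 2 I.net.m I.net.m).setArr 3 I.net.m I.net.m) ?_)
    (B' := 27 * I.net.m + 15) ?_) (by change 3 + _ ≤ _; omega) fun _ hh => hh
  · exact ⟨(by omega : I.net.m < I.word), (by omega : I.net.m < I.word), rfl⟩
  rintro _ rfl
  refine Run.mono (Run.seq (Run.forEdges (B := 3) (fun i s => s.arr 11 = fun j =>
    if j < i then j else 0) (m := I.net.m) rfl (by omega) (by decide) (by decide) ?_
    fun i hi s' hf h8 hI => ?_).frame (B' := 9) ?_) (by omega) fun _ hh => hh
  · funext j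
    simp [initState, initArr]
  · refine Run.mono (Run.of_wp
      (Q := fun s'' => s''.arr 11 = fun j => if j < i + 1 then j else 0) ?_) (by decide)
      fun _ hh => hh
    simp only [wp, Expr.eval, h8, hI, State.setArr_arr, if_true]
    refine ⟨by omega, by omega, ?_⟩
    funext j
    by_cases hji : j = i
    · subst hji
      simp
    · rw [Function.update_of_ne hji]
      have : j < i + 1 ↔ j < i := by omega
      simp only [this]
  · rintro s ⟨h11, hf⟩
    have hv : ∀ x, x ≠ 8 → s.var x = I.initVar x :=
      fun x hx => hf.1 x (by simpa [Cmd.forEdges, Cmd.vars])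
    have ha : ∀ a, a ≠ 11 → s.arr a =
        ((I.initState.setArr 2 I.net.m I.net.m).setArr 3 I.net.m I.net.m).arr a :=
      fun a ha => hf.2 a (by simpa [Cmd.forEdges, Cmd.arrs])
    have hL : I.Loaded s :=
      { var3 := hv 3 (by decide), var4 := hv 4 (by decide), var5 := hv 5 (by decide),
        arr0 := ha 0 (by decide), arr1 := ha 1 (by decide), arr2 := ha 2 (by decide),
        arr3 := ha 3 (by decide), arr4 := ha 4 (by decide), arr5 := ha 5 (by decide),
        arr6 := ha 6 (by decide), arr8 := ha 8 (by decide), arr10 := ha 10 (by decide),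
        arr11 := h11 }
    refine Run.mono (Run.of_wp (Q := fun s' => s'.var 6 = min I.k I.net.m) ?_).frame
      (by decide) fun s' ⟨h6, hf'⟩ => ⟨hL.of_frame hf' (by decide), h6,
        (hf'.1 0 (by decide)).trans (hv 0 (by decide)),
        (hf'.2 26 (by decide)).trans (ha 26 (by decide)),
        (hf'.2 27 (by decide)).trans (ha 27 (by decide))⟩
    simp only [wp, Expr.eval, hL.var3, hL.var5, State.setVar_var, if_true]
    refine ⟨fun hlt => ⟨by omega, ?_⟩, fun hge => ⟨by omega, ?_⟩⟩
    · have : I.net.m < I.k := by simpa using hlt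
      omega
    · have : I.k ≤ I.net.m := by simpa using hge
      omega

/-- Register 0 holds a correct verdict as far as it is `1`. -/
def Sound (I : MUPM) (s : State) : Prop :=
  s.var 0 = 0 ∨ (s.var 0 = 1 ∧ I.IsYes)

/-- Under a master list, the test finds every solution whose blocking edges are the marked ones. -/
theorem run_testCmd_of_admits (hI : I.AdmitsMasterListOnOneSide) (h : I.Loaded s)
    (hs : I.Sound s) :
    Run I.word testCmd s (1000 * (I.net.m + 1)) fun s' => I.Sound s' ∧
      (s.var 0 = 1 → s'.var 0 = 1) ∧ ∀ M, I.IsSolution M →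
        (∀ e ∈ I.edges, s.arr 26 (I.num e) ≠ 0 ↔ e ∈ I.bp M) → s'.var 0 = 1 := by
  classical
  refine Run.mono (run_testCmd h) le_rfl ?_
  rintro s' ⟨X, hX, h0⟩
  refine ⟨?_, fun h1 => ?_, fun M hM hbp => ?_⟩
  · by_cases hsol : I.IsSolution (I.edgesOf X)
    · rw [if_pos hsol] at h0
      exact .inr ⟨h0, _, hsol⟩
    · rw [if_neg hsol] at h0
      rwa [Sound, h0]
  · rw [h0, h1, ite_self]
  · have hst := hM.1.1.isStableWithout_bp
    have : I.bp M = {e ∈ I.edges | s.arr 26 (I.num e) ≠ 0} := by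
      ext e
      rw [Finset.mem_filter]
      exact ⟨fun he => ⟨(mem_bp.1 he).1, (hbp e (mem_bp.1 he).1).2 he⟩,
        fun he => (hbp e he.1).1 he.2⟩
    rw [this] at hst
    rw [hst.unique hI (isStableWithout_edgesOf hX)] at hM
    rw [h0, if_pos hM]

/-- One round for each sequence of digits: the edges with these numbers are the blocking edges. -/
def enumerateCmd : Cmd :=
  .loop (.eq (.var 18) (.const 0)) (.seq selectCmd (.seq testCmd advanceCmd))

theorem run_enumerateCmd {k : ℕ} (hI : I.AdmitsMasterListOnOneSide) (h : I.Loaded s)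
    (hs : I.Sound s) (h6 : s.var 6 = k) (hk : k ≤ I.net.m) (h27 : s.arr 27 = fun _ => 0)
    (h18 : s.var 18 = if k = 0 then 1 else 0) :
    Run I.word enumerateCmd s (1100 * (I.net.m + 1) * (I.net.m ^ k + 1)) fun s' => I.Sound s' ∧
      (s.var 0 = 1 → s'.var 0 = 1) ∧
      ∀ M, I.IsSolution M → (I.bp M).Nonempty → (I.bp M).card ≤ k → s'.var 0 = 1 := by
  -- `Found d` says that the digits `d` have been tested; the rounds that are left, `n`, are the
  -- sequences whose number to base `m` is not smaller than that of the current one. For `k = 0`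
  -- there is no round at all, since the empty set is tested beforehand.
  let Found : (ℕ → ℕ) → State → Prop := fun d s' => ∀ M, I.IsSolution M →
    (∀ e ∈ I.edges, e ∈ I.bp M ↔ ∃ i < k, d i = I.num e) → s'.var 0 = 1
  let Inv : ℕ → State → Prop := fun n s' => I.Sound s' ∧ (s.var 0 = 1 → s'.var 0 = 1) ∧
    (∀ i < k, s'.arr 27 i < I.net.m) ∧
    ((s'.var 18 = 0 ∧ n + digitSum I.net.m k (s'.arr 27) = I.net.m ^ k ∧
      ∀ d : ℕ → ℕ, (∀ i < k, d i < I.net.m) →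
        digitSum I.net.m k d < digitSum I.net.m k (s'.arr 27) → Found d s') ∨
    (s'.var 18 = 1 ∧ (0 < k → ∀ d : ℕ → ℕ, (∀ i < k, d i < I.net.m) → Found d s')))
  have h₀ : Inv (I.net.m ^ k) s := by
    refine ⟨hs, id, fun i hi => ?_, ?_⟩
    · rw [h27]
      exact (Nat.zero_le _).trans_lt (hi.trans_le hk)
    · by_cases hk0 : k = 0
      · exact .inr ⟨by rw [h18, if_pos hk0], fun hc => by omega⟩
      · exact .inl ⟨by rw [h18, if_neg hk0], by simp [h27, digitSum],
          fun d _ hlt => by simp [h27, digitSum] at hlt⟩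
  refine Run.mono (Run.loop (B := 1090 * (I.net.m + 1)) Inv ?_ _ h₀) ?_ ?_
  · rintro n s₁ hf ⟨hs₁, hmono, hd, hcase⟩ he
    have h18₁ : s₁.var 18 = 0 := by
      by_contra hc
      simp [Expr.eval, hc] at he
    obtain ⟨-, hn, hfound⟩ := hcase.resolve_right fun hh => by omega
    have h₁ := h.of_frame hf (by decide)
    have h6₁ : s₁.var 6 = k := (hf.1 6 (by decide)).trans h6
    refine Run.mono (Run.seq (run_selectCmd h₁ h6₁ hk hd).frame
      (B' := 1050 * (I.net.m + 1)) ?_) (by omega) fun _ hh => hh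
    rintro s₂ ⟨hsel, hf₂⟩
    have h₂ := h₁.of_frame hf₂ (by decide)
    have hv₂ : s₂.var 0 = s₁.var 0 := hf₂.1 0 (by decide)
    refine Run.mono (Run.seq (run_testCmd_of_admits hI h₂ (by rwa [Sound, hv₂])).frame
      (B' := 50 * (I.net.m + 1)) ?_) (by omega) fun _ hh => hh
    rintro s₃ ⟨⟨hs₃, hmono₃, htest⟩, hf₃⟩
    have h₃ := h₂.of_frame hf₃ (by decide)
    rw [hv₂] at hmono₃
    have h27₃ : s₃.arr 27 = s₁.arr 27 := (hf₃.2 27 (by decide)).trans (hf₂.2 27 (by decide))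
    have h6₃ : s₃.var 6 = k :=
      (hf₃.1 6 (by decide)).trans ((hf₂.1 6 (by decide)).trans h6₁)
    refine Run.mono (run_advanceCmd h₃ h6₃ hk (by rwa [h27₃])).frame le_rfl ?_
    rintro s₄ ⟨⟨hd₄, hcase₄⟩, hf₄⟩
    rw [h27₃] at hcase₄
    have hv₄ : s₄.var 0 = s₃.var 0 := hf₄.1 0 (by decide)
    have hlt := digitSum_lt hd
    -- All digit sequences up to the current one have been tested.
    have hall : ∀ d : ℕ → ℕ, (∀ i < k, d i < I.net.m) →
        digitSum I.net.m k d < digitSum I.net.m k (s₁.arr 27) + 1 → Found d s₄ := by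
      intro d hdm hle M hM hbp
      rw [hv₄]
      rcases Nat.lt_succ_iff_lt_or_eq.1 hle with hlt | heq
      · exact hmono₃ (hfound d hdm hlt M hM hbp)
      · refine htest M hM fun e he => ?_
        rw [hsel _ (num_lt he), hbp e he]
        exact exists_congr fun i => and_congr_right fun hi => by rw [digitSum_inj hdm hd heq hi]
    have hrest : I.Sound s₄ ∧ (s.var 0 = 1 → s₄.var 0 = 1) ∧ ∀ i < k, s₄.arr 27 i < I.net.m :=
      ⟨by rwa [Sound, hv₄], fun h1 => hv₄.trans (hmono₃ (hmono h1)), hd₄⟩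
    rcases hcase₄ with ⟨h18₄, hsum⟩ | ⟨h18₄, hsum⟩
    · exact ⟨n - 1, by omega, hrest.1, hrest.2.1, hrest.2.2, .inl ⟨h18₄, by omega,
        by rwa [hsum]⟩⟩
    · exact ⟨0, by omega, hrest.1, hrest.2.1, hrest.2.2, .inr ⟨h18₄,
        fun _ d hdm => hall d hdm ((digitSum_lt hdm).trans_le hsum)⟩⟩
  · have : Expr.cost (.eq (.var 18) (.const 0)) = 3 := rfl
    rw [this]
    have h₁ : I.net.m ^ k * (3 + 1 + 1090 * (I.net.m + 1)) ≤
        I.net.m ^ k * (1100 * (I.net.m + 1)) := Nat.mul_le_mul_left _ (by omega)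
    rw [mul_comm _ (I.net.m ^ k + 1), add_one_mul]
    exact Nat.add_le_add h₁ (by omega)
  · rintro s' ⟨⟨n, hs', hmono, -, hcase⟩, he⟩
    refine ⟨hs', hmono, fun M hM hne hcard => ?_⟩
    have h18' : s'.var 18 ≠ 0 := fun hc => by simp [Expr.eval, hc] at he
    have hk0 : 0 < k := hne.card_pos.trans_le hcard
    have hfound := (hcase.resolve_left fun hh => h18' hh.1).2 hk0
    obtain ⟨d, hd, hmem⟩ := exists_digits (B := (I.bp M).image I.num) (m := I.net.m)
      (hne.image _) (fun j hj => by
        obtain ⟨e, he, rfl⟩ := Finset.mem_image.1 hj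
        exact num_lt (mem_bp.1 he).1) (Finset.card_image_le.trans hcard)
    refine hfound d hd M hM fun e he => ?_
    rw [← hmem, Finset.mem_image]
    refine ⟨fun hb => ⟨e, hb, rfl⟩, ?_⟩
    rintro ⟨f, hf, hfe⟩
    rwa [← num_inj (mem_bp.1 hf).1 hfe]

/-- The program that decides instances with a master list. The first test takes place with array 26
still empty, so it concerns the stable matching of the whole graph. -/
def solveCmd : Cmd :=
  .seq prepareCmd <| .seq testCmd <| .seq (.assign 18 (.eq (.var 6) (.const 0))) enumerateCmd

/-- Every blocking edge costs at least `1`, so a solution has few of them. -/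
theorem card_bp_le (hc : ∀ e ∈ I.edges, 1 ≤ I.cost e) {M : Finset (Fin I.nA × Fin I.nB)}
    (hM : I.IsSolution M) : (I.bp M).card ≤ min I.k I.net.m := by
  refine le_min (le_trans ?_ hM.2.2) (Finset.card_le_card fun e he => (mem_bp.1 he).1)
  rw [Finset.card_eq_sum_ones]
  exact Finset.sum_le_sum fun e he => hc e (mem_bp.1 he).1

theorem run_solveCmd (hI : I.AdmitsMasterListOnOneSide) (hc : ∀ e ∈ I.edges, 1 ≤ I.cost e) :
    Run I.word solveCmd I.initState
      (2200 * (I.net.m + 1) * (I.net.m ^ (min I.k I.net.m) + 1)) fun s =>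
        I.Sound s ∧ (I.IsYes → s.var 0 = 1) := by
  have hW := m_add_two_le_word I
  have hassign : ∀ s₂ : State, s₂.var 6 = min I.k I.net.m →
      Run I.word (.assign 18 (.eq (.var 6) (.const 0))) s₂ 4 fun s₃ =>
        s₃.var 18 = if min I.k I.net.m = 0 then 1 else 0 := fun s₂ h6₂ => by
    refine Run.of_wp ⟨?_, ?_⟩
    · simp only [Expr.eval, h6₂]
      split_ifs <;> omega
    · simp [Expr.eval, h6₂]
  refine Run.mono (Run.seq (run_prepareCmd I) fun s₁ ⟨h₁, h6, h0, h26, h27⟩ =>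
    Run.seq (run_testCmd_of_admits hI h₁ (.inl h0)).frame fun s₂ ⟨⟨hs₂, _, htest⟩, hf₂⟩ =>
    Run.seq (hassign s₂ ((hf₂.1 6 (by decide)).trans h6)).frame fun s₃ ⟨h18, hf₃⟩ =>
    (?_ : Run I.word enumerateCmd s₃ (1100 * (I.net.m + 1) * (I.net.m ^ min I.k I.net.m + 1)) _))
    ?_ fun _ hh => hh
  · have h₂ := h₁.of_frame hf₂ (by decide)
    have h₃ := h₂.of_frame hf₃ (by decide)
    have hv : s₃.var 0 = s₂.var 0 := hf₃.1 0 (by decide)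
    refine Run.mono (run_enumerateCmd hI h₃ (by rwa [Sound, hv])
      ((hf₃.1 6 (by decide)).trans ((hf₂.1 6 (by decide)).trans h6)) (min_le_right _ _)
      ((hf₃.2 27 (by decide)).trans ((hf₂.2 27 (by decide)).trans h27)) h18) le_rfl ?_
    rintro s' ⟨hs', hmono, hfound⟩
    refine ⟨hs', fun ⟨M, hM⟩ => ?_⟩
    rcases (I.bp M).eq_empty_or_nonempty with hemp | hne
    · exact hmono (hv.trans (htest M hM fun e he => by simp [h26, hemp]))
    · exact hfound M hM hne (card_bp_le hc hM)
  · generalize I.net.m ^ _ = P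
    nlinarith

end MUPM

theorem mainTheorem2 :
    ∃ (p : RAM.Cmd) (C D : ℕ), ∀ I : MUPM,
      I.AdmitsMasterListOnOneSide → (∀ e ∈ I.edges, 1 ≤ I.cost e) →
      ∃ (s : RAM.State) (T : ℕ),
        RAM.Exec (I.magnitude ^ D) p I.initState s T ∧
        T ≤ C * (I.edges.card ^ (I.k + 1) + 1) ∧
        (I.IsYes → s.var 0 = 1) ∧ (¬ I.IsYes → s.var 0 = 0) := by
  refine ⟨MUPM.solveCmd, 8800, 1, fun I hI hc => ?_⟩
  obtain ⟨s, T, hexec, hT, hs, hyes⟩ := MUPM.run_solveCmd hI hc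
  refine ⟨s, T, by rwa [pow_one], hT.trans ?_, hyes, fun hno => hs.resolve_right fun h => hno h.2⟩
  rw [MUPM.net_m]
  generalize I.edges.card = m
  -- For `m = 0` the exponent `min k m` is `0`. Otherwise `m + 1 ≤ 2 * m` and
  -- `m ^ min k m + 1 ≤ 2 * m ^ k`.
  rcases Nat.eq_zero_or_pos m with rfl | hm
  · simp
  · have h₁ : m ^ min I.k m ≤ m ^ I.k := Nat.pow_le_pow_right hm (min_le_left _ _)
    have h₂ : 1 ≤ m ^ I.k := Nat.one_le_pow _ _ hm
    calc 2200 * (m + 1) * (m ^ min I.k m + 1) ≤ 2200 * (2 * m) * (2 * m ^ I.k) := by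
          gcongr <;> omega
      _ = 8800 * m ^ (I.k + 1) := by ring
      _ ≤ _ := by gcongr; omega
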